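/- Let $\phi\in \mathrm{SL}(2,\mathbb Z)$ be Anosov, i.e. with two distinct real eigenvalues, and let $M=T\times[0,1]/(x,0)\sim(\phi x,1)$ be the corresponding bundle over the circle, with fibre the punctured torus $T=(\mathbb R^2\setminus\mathbb Z^2)/\mathbb Z^2$. Then $\phi$ is conjugate in $\mathrm{SL}(2,\mathbb Z)$ to $\pm W$, where $W$ is a word of some length $N$ in $R=\begin{pmatrix}1&1\\0&1\end{pmatrix}$ and $L=\begin{pmatrix}1&0\\1&1\end{pmatrix}$ that begins with $R$ and ends with $L$. For every such word $W$ the following holds. The monodromy (Floyd–Hatcher) triangulation $\mathcal T$ of $M$ has tetrahedra $\mathcal T_1,\dots,\mathcal T_N$. With $W_{k}$ the product of the first $k$ letters of $W$, the tetrahedron $\mathcal T_{k+1}$ is layered over the parallelogram $W_{k}([0,1]^2)$ modulo $\mathbb Z^2$, with bottom edge over the diagonal of direction $W_{k}(-1,1)$ and top edge over the diagonal of direction $W_k(1,1)$; the top faces of each tetrahedron are glued to the bottom faces of the next one, and those of $\mathcal T_N$ to the bottom faces of $\mathcal T_1$ by the monodromy $\pm W$. Give $\mathcal T_j$ a real shape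 parameter $z_j\in\mathbb R\setminus\{0,1\}$, placed at its top and bottom edges, and the parameters $\frac{1}{1-z_j}$, $\frac{z_j-1}{z_j}$ at the other two pairs of opposite edges according to the orientation. An edge of $\mathcal T_j$ has dihedral angle $\pi$ if its parameter is negative and $0$ if it is positive. The real deformation variety $\mathscr D_{\mathbb R}\subset\mathbb R^N$ is the set of all $(z_j)$ such that, around each edge $e$ of $\mathcal T$, the product $g_e$ of the parameters is $1$ and the total dihedral angle is $2\pi$. Its tangent space at a point is the common kernel of the differentials $dg_e$. Let $H(\epsilon)$ be the exponential length of the puncture curve $\epsilon$ (the simple closed curve around the puncture in a fibre), i.e. the derivative of its holonomy, which is a product of shape parameters and their inverses along $\epsilon$; its signed length is $\log H(\epsilon)$. Let $r_+$ and $r_-$ be non-zero linear forms on $\mathbb R^2$ with $r_\pm\circ W=\lambda_\pm r_\pm$, where $\lambda_+>1>\lambda_->0$ are the eigenvalues of $W$, and let $z^{\pm}=(z^\pm_j)$ be the shape parameters (cross ratios) obtained by projecting the vertices of the parallelograms under the tetrahedra to $\mathbb R$ by $r_\pm$. Then: 1. $z^+$ and $z^-$ lie in $\mathscr D_{\mathbb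 R}$. Let $\mathcal V^{+}$, $\mathcal V^-$ be the connected components of $\mathscr D_{\mathbb R}$ that contain them. Then $\mathcal V^+\cap\mathcal V^-=\emptyset$ and $\mathcal V^+\cup\mathcal V^-=\{(z_j)\in\mathscr D_{\mathbb R} : z_j>0 \text{ for all } j\}$. 2. For $\mathcal V=\mathcal V^+$ and for $\mathcal V=\mathcal V^-$: $\mathcal V$ is smooth of dimension one and parameterized by the signed length of the puncture curve, that is, $H(\epsilon)>0$ on $\mathcal V$ and there is a smooth embedding $\gamma:\mathbb R\to\mathbb R^N$ with image $\mathcal V$ and nowhere vanishing derivative such that $\log H(\epsilon)=t$ at $\gamma(t)$ for all $t\in\mathbb R$, and the tangent space of $\mathscr D_{\mathbb R}$ at $\gamma(t)$ is the line spanned by $\gamma'(t)$. At every point of $\mathcal V$ this tangent space contains a vector all of whose entries are positive. -/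

import Mathlib

open scoped ContDiff

noncomputable section

namespace PuncturedTorus

/-! ### Oriented ideal triangulations, Thurston's equations over the reals -/

/-- An oriented (topological) ideal triangulation with tetrahedra indexed by `T`. The ideal vertices
of every tetrahedron are labelled by `Fin 4` compatibly with the orientation. The face of `t`
opposite to its vertex `f` is glued to the face of `nbr t f` opposite to the vertex `perm t f f`, and
a vertex `i ≠ f` of the first face is identified with the vertex `perm t f i` of the second. The face
pairings reverse the orientations of the faces. -/
structure IdealTriangulation (T : Type) where
  nbr : T → Fin 4 → T
  perm : T → Fin 4 → Equiv.Perm (Fin 4)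
  nbr_nbr : ∀ t f, nbr (nbr t f) (perm t f f) = t
  perm_perm : ∀ t f, perm (nbr t f) (perm t f f) = (perm t f)⁻¹
  odd : ∀ t f, Equiv.Perm.sign (perm t f) = -1
  not_self : ∀ t f, (nbr t f, perm t f f) ≠ (t, f)

/-- The shape parameter of the edge `e` of the ideal tetrahedron with vertices `∞, 0, 1, z`
(labelled `0, 1, 2, 3` in this order). -/
def edgeParam (z : ℝ) (e : Finset (Fin 4)) : ℝ :=
  if e = {0, 1} ∨ e = {2, 3} then z
  else if e = {0, 2} ∨ e = {1, 3} then 1 / (1 - z)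
  else (z - 1) / z

/-- The dihedral angle of a collapsed tetrahedron at an edge with real shape parameter `p`. -/
def dihedralAngle (p : ℝ) : ℝ := if p < 0 then Real.pi else 0

/-- The edges of the single tetrahedra, before gluing. -/
abbrev EdgeSlot (T : Type) : Type := T × {e : Finset (Fin 4) // e.card = 2}

namespace IdealTriangulation

variable {T : Type} (𝒯 : IdealTriangulation T)

/-- Two edges of tetrahedra are identified by one of the face pairings. -/
def EdgeAdj (a b : EdgeSlot T) : Prop :=
  ∃ f, f ∉ a.2.1 ∧ b.1 = 𝒯.nbr a.1 f ∧ b.2.1 = a.2.1.map (𝒯.perm a.1 f).toEmbedding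

/-- The edges of the triangulation: classes for the equivalence relation generated by `EdgeAdj`. -/
def Edge : Type := Quot 𝒯.EdgeAdj

open Classical in
/-- The edge holonomy: the product of the shape parameters around the edge `E`. -/
def edgeHolonomy [Fintype T] (z : T → ℝ) (E : 𝒯.Edge) : ℝ :=
  ∏ a : EdgeSlot T with Quot.mk 𝒯.EdgeAdj a = E, edgeParam (z a.1) a.2.1

open Classical in
/-- The total dihedral angle around the edge `E`. -/
def totalAngle [Fintype T] (z : T → ℝ) (E : 𝒯.Edge) : ℝ :=
  ∑ a : EdgeSlot T with Quot.mk 𝒯.EdgeAdj a = E, dihedralAngle (edgeParam (z a.1) a.2.1)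

/-- The real deformation variety: real shape parameters, different from `0` and `1`, for which the
edge holonomy is `1` and the total dihedral angle is `2π` at every edge. -/
def realDeformationVariety [Fintype T] : Set (T → ℝ) :=
  {z | (∀ t, z t ≠ 0 ∧ z t ≠ 1) ∧
    ∀ E : 𝒯.Edge, 𝒯.edgeHolonomy z E = 1 ∧ 𝒯.totalAngle z E = 2 * Real.pi}

/-- The (Zariski) tangent space of the deformation variety at `z`: the common kernel of the
differentials of the edge holonomies. -/
def tangentSpace [Fintype T] (z : T → ℝ) : Submodule ℝ (T → ℝ) :=
  ⨅ E : 𝒯.Edge, LinearMap.ker (fderiv ℝ (fun z' => 𝒯.edgeHolonomy z' E) z).toLinearMap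

end IdealTriangulation

/-! ### Curves on the boundary and their exponential length -/

/-- A segment `(t, π)` of a curve in the triangulated link of the ideal vertices: in the link of the
vertex `π 0` of the tetrahedron `t`, which is a triangle, it turns around the corner cut out by the
edge `π 0, π 1`, entering through the face `π 0, π 1, π 2` and leaving through the face
`π 0, π 1, π 3`. -/
abbrev Segment (T : Type) : Type := T × Equiv.Perm (Fin 4)

/-- How a curve continues after a segment: around the same edge of the triangulation, or around the
edge at the other end of the side (of a link triangle) that it has just crossed. -/
inductive Turn where
  | same
  | switch

/-- The contribution of a segment to the exponential length: the shape parameter of the edge, or its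
inverse, according to the direction in which the segment turns around it. This is the cross ratio of
the vertices in the order `π 0, π 1, π 2, π 3`. -/
def segmentLength {T : Type} (z : T → ℝ) (a : Segment T) : ℝ :=
  edgeParam (z a.1) {a.2 0, a.2 1} ^ ((Equiv.Perm.sign a.2 : ℤˣ) : ℤ)

/-- The permutations of the roles of the four vertices from one segment to the next. -/
def Turn.shift : Turn → Equiv.Perm (Fin 4)
  | .same => Equiv.swap 2 3
  | .switch => Equiv.swap 1 2 * Equiv.swap 1 3

namespace IdealTriangulation

variable {T : Type} (𝒯 : IdealTriangulation T)

/-- The segment that follows `(t, π)`: the face `π 0, π 1, π 3` of `t`, opposite to `π 2`, is crossed.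
With `σ` the gluing permutation, the next segment is around the edge `σ (π 0), σ (π 1)` for
`Turn.same`, and around the edge `σ (π 0), σ (π 3)` for `Turn.switch`. -/
def next (a : Segment T) (m : Turn) : Segment T :=
  (𝒯.nbr a.1 (a.2 2), 𝒯.perm a.1 (a.2 2) * a.2 * m.shift)

/-- The exponential length of the curve with first segment `a` and turns `ms` (one turn after each
segment; for a closed curve the last turn leads back to `a`): the derivative of its holonomy. -/
def curveLength (z : T → ℝ) : Segment T → List Turn → ℝ
  | _, [] => 1
  | a, m :: ms => segmentLength z a * curveLength z (𝒯.next a m) ms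

end IdealTriangulation

/-! ### The monodromy triangulation of a punctured torus bundle -/

/-- Distinct real eigenvalues. -/
def IsAnosov (φ : Matrix.SpecialLinearGroup (Fin 2) ℤ) : Prop :=
  ∃ a b : ℝ, a ≠ b ∧
    Module.End.HasEigenvalue (Matrix.toLin' (φ.1.map (Int.cast : ℤ → ℝ))) a ∧
    Module.End.HasEigenvalue (Matrix.toLin' (φ.1.map (Int.cast : ℤ → ℝ))) b

inductive Letter where
  | R
  | L

/-- The standard transvection matrices. -/
def Letter.mat : Letter → Matrix (Fin 2) (Fin 2) ℤ
  | .R => !![1, 1; 0, 1]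
  | .L => !![1, 0; 1, 1]

/-- The product of the first (left-most) `k` letters of the word. -/
def prefixMat {n : ℕ} (w : Fin (n + 1) → Letter) (k : ℕ) : Matrix (Fin 2) (Fin 2) ℤ :=
  ((List.ofFn fun i => (w i).mat).take k).prod

/-- The word as a matrix. -/
def wordMat {n : ℕ} (w : Fin (n + 1) → Letter) : Matrix (Fin 2) (Fin 2) ℤ :=
  prefixMat w (n + 1)

/-- The word `w`, of the form `R ⋯ R L ⋯ L R ⋯ R ⋯ L ⋯ L` (it begins with `R` and ends with `L`),
and the sign `s` describe the monodromy `φ` up to conjugation: `A φ A⁻¹ = s W`. -/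
def IsMonodromyWord (φ : Matrix.SpecialLinearGroup (Fin 2) ℤ) {n : ℕ} (w : Fin (n + 1) → Letter)
    (s : ℤˣ) : Prop :=
  w 0 = .R ∧ w (Fin.last n) = .L ∧
    ∃ A : Matrix.SpecialLinearGroup (Fin 2) ℤ, (A * φ * A⁻¹).1 = (s : ℤ) • wordMat w

/-- The vertices of the unit square. The `k`-th tetrahedron of the monodromy triangulation
(`k = 0, …, n`) is layered over the parallelogram with vertices `prefixMat w k *ᵥ corner i`, up to
integer translations. Its top edge is the diagonal from `corner 0` to `corner 1`, its bottom edge the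
diagonal from `corner 2` to `corner 3` (which are the two edges with shape parameter `z`), and the
labels `0, 1, 2, 3` agree with the orientation. The faces opposite to `2` and `3` are the top faces,
those opposite to `0` and `1` the bottom faces. -/
def corner : Fin 4 → Fin 2 → ℤ := ![![0, 0], ![1, 1], ![0, 1], ![1, 0]]

def Letter.partner : Letter → Fin 4 → Fin 4
  | .R => ![3, 2, 1, 0]
  | .L => ![2, 3, 0, 1]

/-- The gluing of the face opposite to `f` for two consecutive tetrahedra, in either direction, if the
frame of the upper one is obtained from that of the lower one by the matrix `X`. -/
def Letter.layerPerm (X : Letter) (f : Fin 4) : Equiv.Perm (Fin 4) := Equiv.swap f (X.partner f)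

/-- On each top face (opposite to `2` or `3`) of the lower tetrahedron, the vertex identification is
the one given by the matrix of the letter and an integer translation. -/
theorem layerPerm_affine (X : Letter) (f : Fin 4) (hf : 2 ≤ f) : ∃ v : Fin 2 → ℤ, ∀ i, i ≠ f →
    corner i = X.mat.mulVec (corner (X.layerPerm f i)) + v := by
  have hf' : f = 2 ∨ f = 3 := by fin_cases f <;> simp_all
  rcases hf' with rfl | rfl <;> cases X
  · exact ⟨![0, 0], by decide⟩
  · exact ⟨![0, -1], by decide⟩
  · exact ⟨![-1, 0], by decide⟩
  · exact ⟨![0, 0], by decide⟩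

/-- The rotation of the unit square by `π`, on the labels of its vertices. -/
def halfTurn : Equiv.Perm (Fin 4) := Equiv.swap 0 1 * Equiv.swap 2 3

/-- The tetrahedron glued to the `k`-th one along the face opposite to `f`: the next one (cyclically)
for the top faces, the previous one for the bottom faces. -/
def monoNbr {n : ℕ} (k : Fin (n + 1)) (f : Fin 4) : Fin (n + 1) :=
  if 2 ≤ f then k + 1 else k - 1

/-- The letter of the layer that contains the face opposite to `f` of the `k`-th tetrahedron. -/
def monoLetter {n : ℕ} (w : Fin (n + 1) → Letter) (k : Fin (n + 1)) (f : Fin 4) : Letter :=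
  if 2 ≤ f then w k else w (k - 1)

/-- The face opposite to `f` of the `k`-th tetrahedron is a top face of the last tetrahedron or a
bottom face of the first one. -/
def IsSeam {n : ℕ} (k : Fin (n + 1)) (f : Fin 4) : Prop :=
  if 2 ≤ f then k = Fin.last n else k = 0

instance {n : ℕ} (k : Fin (n + 1)) (f : Fin 4) : Decidable (IsSeam k f) := by
  unfold IsSeam
  infer_instance

/-- The gluing permutations. The top of the stack of tetrahedra is glued to its bottom by the
monodromy `s W`; if `s = -1`, this differs from the gluing by `W` by a half turn. -/
def monoPerm {n : ℕ} (w : Fin (n + 1) → Letter) (s : ℤˣ) (k : Fin (n + 1)) (f : Fin 4) :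
    Equiv.Perm (Fin 4) :=
  (if s = -1 ∧ IsSeam k f then halfTurn else 1) * (monoLetter w k f).layerPerm f

theorem monoPerm_apply_self_le {n : ℕ} (w : Fin (n + 1) → Letter) (s : ℤˣ) (k : Fin (n + 1))
    (f : Fin 4) : 2 ≤ monoPerm w s k f f ↔ ¬ 2 ≤ f := by
  have h : ∀ f : Fin 4, ∀ X : Letter, (2 ≤ X.layerPerm f f ↔ ¬ 2 ≤ f) ∧
      (2 ≤ (halfTurn * X.layerPerm f) f ↔ ¬ 2 ≤ f) := by
    intro f X
    cases X <;> revert f <;> decide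
  unfold monoPerm
  split_ifs
  · exact (h _ _).2
  · simpa using (h _ _).1

theorem monoNbr_monoNbr {n : ℕ} (w : Fin (n + 1) → Letter) (s : ℤˣ) (k : Fin (n + 1))
    (f : Fin 4) : monoNbr (monoNbr k f) (monoPerm w s k f f) = k := by
  unfold monoNbr
  simp only [monoPerm_apply_self_le]
  split_ifs <;> simp

/-- The monodromy (Floyd–Hatcher) triangulation of the mapping torus of `s W`. -/
def monodromyTriangulation {n : ℕ} (w : Fin (n + 1) → Letter) (s : ℤˣ) :
    IdealTriangulation (Fin (n + 1)) where
  nbr := monoNbr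
  perm := monoPerm w s
  nbr_nbr := monoNbr_monoNbr w s
  perm_perm := by
    intro k f
    have hL : monoLetter w (monoNbr k f) (monoPerm w s k f f) = monoLetter w k f := by
      unfold monoLetter monoNbr
      simp only [monoPerm_apply_self_le]
      split_ifs <;> simp
    have hS : IsSeam (monoNbr k f) (monoPerm w s k f f) ↔ IsSeam k f := by
      unfold IsSeam monoNbr
      simp only [monoPerm_apply_self_le]
      split_ifs
      · rw [← Fin.last_add_one n, add_left_inj]
      · rw [← Fin.last_add_one n, sub_eq_iff_eq_add]
    have key : ∀ f : Fin 4, ∀ X : Letter,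
        X.layerPerm (X.layerPerm f f) = (X.layerPerm f)⁻¹ ∧
        halfTurn * X.layerPerm ((halfTurn * X.layerPerm f) f) =
          (halfTurn * X.layerPerm f)⁻¹ := by
      intro f X
      cases X <;> revert f <;> decide
    conv_lhs => rw [monoPerm]
    rw [hL, if_congr (and_congr_right fun _ => hS) rfl rfl]
    unfold monoPerm
    split_ifs
    · exact (key _ _).2
    · simpa using (key _ _).1
  odd := by
    intro k f
    have key : ∀ f : Fin 4, ∀ X : Letter, Equiv.Perm.sign (X.layerPerm f) = -1 ∧
        Equiv.Perm.sign (halfTurn * X.layerPerm f) = -1 := by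
      intro f X
      cases X <;> revert f <;> decide
    unfold monoPerm
    split_ifs
    · exact (key _ _).2
    · simpa using (key _ _).1
  not_self := by
    intro k f h
    have h1 := monoPerm_apply_self_le w s k f
    have h2 : monoPerm w s k f f = f := (Prod.ext_iff.1 h).2
    rw [h2] at h1
    tauto

/-- The first segment of the puncture curve, in the last tetrahedron: in the link of its vertex `0`
it turns around the top edge. -/
def punctureStart (n : ℕ) : Segment (Fin (n + 1)) := (Fin.last n, 1)

/-- The turns of the puncture curve. In the link of the puncture, which is layered over a small circle
around a lattice point of the plane, the curve goes once around this circle: twice, it passes in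
succession under an edge (in the last tetrahedron), up through tetrahedron `0`, over an edge (in
tetrahedron `1`), and down through tetrahedron `0`. -/
def punctureTurns : List Turn :=
  [.same, .switch, .same, .switch, .same, .switch, .same, .switch]

/-- The puncture curve closes up. -/
theorem puncture_closed {n : ℕ} (w : Fin (n + 1) → Letter) (s : ℤˣ) (h0 : w 0 = .R)
    (h1 : w (Fin.last n) = .L) :
    punctureTurns.foldl (monodromyTriangulation w s).next (punctureStart n) = punctureStart n := by
  cases n with
  | zero =>
    have h2 : w 0 = .L := h1
    rw [h0] at h2
    cases h2
  | succ n =>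
    have h01 : (0 : Fin (n + 2)) ≠ Fin.last (n + 1) := (Fin.last_pos).ne
    have hm : (0 : Fin (n + 2)) - 1 = Fin.last (n + 1) := by
      rw [sub_eq_iff_eq_add, Fin.last_add_one]
    obtain ⟨h, hh, hs⟩ : ∃ h : Equiv.Perm (Fin 4), (h = 1 ∨ h = halfTurn) ∧
        (if s = -1 then halfTurn else 1) = h := by
      by_cases hs : s = -1
      · exact ⟨_, Or.inr rfl, if_pos hs⟩
      · exact ⟨_, Or.inl rfl, if_neg hs⟩
    have e1 : ∀ π m, 2 ≤ π 2 → (monodromyTriangulation w s).next (Fin.last (n + 1), π) m =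
        (0, h * Letter.L.layerPerm (π 2) * π * m.shift) := by
      intro π m hπ
      simp [IdealTriangulation.next, monodromyTriangulation, monoNbr, monoPerm, monoLetter, IsSeam,
        hπ, h1, hs]
    have e2 : ∀ π m, 2 ≤ π 2 → (monodromyTriangulation w s).next (0, π) m =
        (1, Letter.R.layerPerm (π 2) * π * m.shift) := by
      intro π m hπ
      simp [IdealTriangulation.next, monodromyTriangulation, monoNbr, monoPerm, monoLetter, IsSeam,
        hπ, h0, h01]
    have e3 : ∀ π m, ¬ 2 ≤ π 2 → (monodromyTriangulation w s).next (0, π) m =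
        (Fin.last (n + 1), h * Letter.L.layerPerm (π 2) * π * m.shift) := by
      intro π m hπ
      simp [IdealTriangulation.next, monodromyTriangulation, monoNbr, monoPerm, monoLetter, IsSeam,
        if_neg hπ, hm, h1, hs]
    have e4 : ∀ π m, ¬ 2 ≤ π 2 → (monodromyTriangulation w s).next (1, π) m =
        (0, Letter.R.layerPerm (π 2) * π * m.shift) := by
      intro π m hπ
      simp [IdealTriangulation.next, monodromyTriangulation, monoNbr, monoPerm, monoLetter, IsSeam,
        if_neg hπ, h0]
    have half : ∀ π, π = 1 ∨ π = halfTurn → [.same, .switch, .same, .switch].foldl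
        (monodromyTriangulation w s).next (Fin.last (n + 1), π) =
          (Fin.last (n + 1), halfTurn * π) := by
      intro π hπ
      simp only [List.foldl]
      rcases hh with rfl | rfl <;> rcases hπ with rfl | rfl <;>
      · rw [e1 _ _ (by decide), e2 _ _ (by decide), e4 _ _ (by decide), e3 _ _ (by decide)]
        refine congrArg (Prod.mk _) ?_
        decide
    have hp : punctureTurns = [.same, .switch, .same, .switch] ++ [.same, .switch, .same, .switch] :=
      rfl
    rw [hp, List.foldl_append, punctureStart, half _ (Or.inl rfl), half _ (Or.inr (mul_one _))]
    refine congrArg (Prod.mk _) ?_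
    decide

/-- The exponential length of the puncture curve. -/
def punctureLength {n : ℕ} (w : Fin (n + 1) → Letter) (s : ℤˣ) (z : Fin (n + 1) → ℝ) : ℝ :=
  (monodromyTriangulation w s).curveLength z (punctureStart n) punctureTurns

/-! ### The two canonical solutions -/

/-- The cross ratio, normalized so that `∞, 0, 1, z` have cross ratio `z`. -/
def crossRatio (a b c d : ℝ) : ℝ := ((d - b) * (c - a)) / ((d - a) * (c - b))

/-- `z` is the system of shape parameters obtained by projecting the vertices of the parallelograms
under the tetrahedra to the line by a linear form `r` on the plane with `r ∘ W = μ r`. -/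
def IsProjectionShape {n : ℕ} (w : Fin (n + 1) → Letter) (μ : ℝ) (z : Fin (n + 1) → ℝ) : Prop :=
  ∃ r : (Fin 2 → ℝ) →ₗ[ℝ] ℝ, r ≠ 0 ∧
    (∀ v, r (((wordMat w).map (Int.cast : ℤ → ℝ)).mulVec v) = μ * r v) ∧
    ∀ k : Fin (n + 1),
      let p : Fin 4 → ℝ := fun i => r fun j => (((prefixMat w k).mulVec (corner i) j : ℤ) : ℝ)
      z k = crossRatio (p 0) (p 1) (p 2) (p 3)

end PuncturedTorus

end

/-!
The edges of the triangulation are the top edges of the tetrahedra. If all `z j` are positive, then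
the dihedral angles `π` of the `j`-th tetrahedron lie at one pair of its side edges: those fixed by
the letter `σ j`, which is `R` if `z j > 1` and `L` if `z j < 1`. These two edges belong to the
top edge of the tetrahedron at the last letter `σ j` before `j`, so the angle conditions say that
`j ↦ lastBefore w (σ j) j` is a bijection. This forces `σ j = w (j - 1)` for all `j`, or `σ j = w j`
for all `j`. As `z j ≠ 1`, each of the two patterns describes a relatively clopen set.

For the first pattern put `z j = 1 + exp (x j)` or `z j = sigmoid (x j)`. The logarithms of the edge
equations then read `∑ j, f i j (x j) = 2 * x i` with non-decreasing `f i j` such that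
`∑ i, f i j t = 2 * t`. The Jacobian has column sums zero, is non-negative off the diagonal and has
positive entries along a cycle, so its kernel is a line spanned by a positive vector. In the same
way the supremum of two solutions is a solution, and therefore any two solutions are comparable.
Summing the equations with their positions as weights expresses the logarithm of the puncture length
on the solutions as a strictly decreasing function of `x`. It is injective by comparability, a local
coordinate by the inverse function theorem, and proper. The second pattern reduces to the first one
by reading the word backwards with its letters exchanged and inverting the shapes.

The eigenforms of `W` give one point for each pattern: its shapes are the squares of the ratios of
the values of the form on the sides of the parallelograms.

For the existence of the word let the trace be greater than `2`, up to sign. Conjugation decreases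
the difference of the diagonal entries as long as the other two entries have opposite signs.
Afterwards all entries can be made non-negative, and a non-negative matrix of determinant one is a
word; a rotation of the word makes it begin with `R` and end with `L`.
-/

noncomputable section

namespace PuncturedTorus

/-! ### Cyclic words and the edges of the triangulation -/

section CyclicWords

variable {α : Type*} {n : ℕ} (w : Fin (n + 1) → α)

/-- The number of steps back, at least one, from position `j` to the previous letter `X` of the
cyclic word `w` (junk value `0` if `X` does not occur in `w`). -/
def stepsBack (X : α) (j : Fin (n + 1)) : ℕ :=
  sInf {d : ℕ | 1 ≤ d ∧ w (j - d • (1 : Fin (n + 1))) = X}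

/-- The position of the last letter `X` strictly before position `j`, in cyclic order. -/
def lastBefore (X : α) (j : Fin (n + 1)) : Fin (n + 1) :=
  j - stepsBack w X j • (1 : Fin (n + 1))

variable {w} {X : α}

theorem nsmul_one_surjective : Function.Surjective fun d : ℕ => d • (1 : Fin (n + 1)) := by
  refine fun i => ⟨i, ?_⟩
  induction i using Fin.induction with
  | zero => exact zero_nsmul 1
  | succ i ih => exact (succ_nsmul 1 _).trans (congrArg (· + 1) ih |>.trans Fin.coeSucc_eq_succ)

theorem stepsBack_spec (hX : X ∈ Set.range w) (j : Fin (n + 1)) :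
    1 ≤ stepsBack w X j ∧ w (lastBefore w X j) = X := by
  obtain ⟨i, hi⟩ := hX
  obtain ⟨d, hd : d • 1 = j - 1 - i⟩ := nsmul_one_surjective (j - 1 - i)
  refine Nat.sInf_mem (s := {d : ℕ | 1 ≤ d ∧ w (j - d • (1 : Fin (n + 1))) = X})
    ⟨d + 1, by lia, ?_⟩
  rw [succ_nsmul, hd, ← hi]
  congr 1
  abel

theorem one_le_stepsBack (hX : X ∈ Set.range w) (j : Fin (n + 1)) : 1 ≤ stepsBack w X j :=
  (stepsBack_spec hX j).1

theorem apply_lastBefore (hX : X ∈ Set.range w) (j : Fin (n + 1)) : w (lastBefore w X j) = X :=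
  (stepsBack_spec hX j).2

theorem stepsBack_le {j : Fin (n + 1)} {d : ℕ} (hd : 1 ≤ d)
    (h : w (j - d • (1 : Fin (n + 1))) = X) : stepsBack w X j ≤ d :=
  Nat.sInf_le (s := {d : ℕ | 1 ≤ d ∧ w (j - d • (1 : Fin (n + 1))) = X}) ⟨hd, h⟩

theorem stepsBack_succ_of_eq {j : Fin (n + 1)} (h : w j = X) : stepsBack w X (j + 1) = 1 :=
  le_antisymm (stepsBack_le le_rfl (by simpa using h)) (one_le_stepsBack ⟨j, h⟩ _)

theorem succ_sub_succ_nsmul_one (j : Fin (n + 1)) (d : ℕ) :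
    j + 1 - (d + 1) • (1 : Fin (n + 1)) = j - d • (1 : Fin (n + 1)) := by
  rw [succ_nsmul, add_sub_add_right_eq_sub]

theorem stepsBack_succ_of_ne (hX : X ∈ Set.range w) {j : Fin (n + 1)} (h : w j ≠ X) :
    stepsBack w X (j + 1) = stepsBack w X j + 1 := by
  refine le_antisymm (stepsBack_le (by lia) ?_) ?_
  · rw [succ_sub_succ_nsmul_one]
    exact apply_lastBefore hX j
  · obtain ⟨d, hd⟩ := Nat.exists_eq_add_of_le' (one_le_stepsBack hX (j + 1))
    have hwd : w (j - d • (1 : Fin (n + 1))) = X := by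
      rw [← succ_sub_succ_nsmul_one, ← hd]
      exact apply_lastBefore hX (j + 1)
    have hd0 : d ≠ 0 := by
      rintro rfl
      exact h (by simpa using hwd)
    have := stepsBack_le (Nat.one_le_iff_ne_zero.2 hd0) hwd
    lia

theorem lastBefore_succ_of_eq {j : Fin (n + 1)} (h : w j = X) : lastBefore w X (j + 1) = j := by
  rw [lastBefore, stepsBack_succ_of_eq h, one_nsmul, add_sub_cancel_right]

theorem lastBefore_succ_of_ne (hX : X ∈ Set.range w) {j : Fin (n + 1)} (h : w j ≠ X) :
    lastBefore w X (j + 1) = lastBefore w X j := by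
  rw [lastBefore, lastBefore, stepsBack_succ_of_ne hX h, succ_sub_succ_nsmul_one]

theorem cyclicWord_induction (hX : X ∈ Set.range w) {P : Fin (n + 1) → Prop}
    (after : ∀ j, w j = X → P (j + 1)) (step : ∀ j, w j ≠ X → P j → P (j + 1))
    (j : Fin (n + 1)) : P j := by
  suffices ∀ d j, stepsBack w X j = d → P j from this _ j rfl
  intro d
  induction d with
  | zero =>
    intro j hj
    exact absurd (one_le_stepsBack hX j) (by lia)
  | succ d ih =>
    intro j hj
    obtain ⟨i, rfl⟩ : ∃ i, j = i + 1 := ⟨j - 1, (sub_add_cancel j 1).symm⟩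
    by_cases hi : w i = X
    · exact after i hi
    · rw [stepsBack_succ_of_ne hX hi, Nat.add_right_cancel_iff] at hj
      exact step i hi (ih i hj)

variable (w) in
/-- The position of the previous occurrence of the letter `w (j - 1)`. The edge with this index is
the bottom edge of the `j`-th tetrahedron, if every edge has the index of the tetrahedron of which
it is the top edge. -/
def bottomIndex (j : Fin (n + 1)) : Fin (n + 1) := lastBefore w (w (j - 1)) (j - 1)

theorem bottomIndex_succ (j : Fin (n + 1)) : bottomIndex w (j + 1) = lastBefore w (w j) j := by
  rw [bottomIndex, add_sub_cancel_right]

end CyclicWords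

instance : DecidableEq Letter := fun X Y => by
  cases X <;> cases Y <;> first | exact isTrue rfl | exact isFalse (by rintro ⟨⟩)

/-- The edges of a layered tetrahedron, up to the half turn: the top edge, the bottom edge, and the
two edges over the vertical (letter `R`) or horizontal (letter `L`) sides of the square. The letter
`X` fixes the sides of kind `X`. -/
inductive EdgeKind where
  | top
  | bottom
  | side (X : Letter)

namespace EdgeKind

instance : DecidableEq EdgeKind := fun κ κ' => by
  rcases κ with _ | _ | ⟨_ | _⟩ <;> rcases κ' with _ | _ | ⟨_ | _⟩ <;>
    first | exact isTrue rfl | exact isFalse (by rintro ⟨⟩)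

/-- The kind of an edge of a tetrahedron. -/
def of (e : Finset (Fin 4)) : EdgeKind :=
  if e = {0, 1} then top else if e = {2, 3} then bottom
  else if e = {0, 2} ∨ e = {1, 3} then side .R else side .L

/-- The kind in the next tetrahedron, across a layer with letter `X`, of an edge in a top face. The
bottom edge lies in no top face. -/
def up (X : Letter) : EdgeKind → EdgeKind
  | top => side X
  | bottom => bottom
  | side Y => if Y = X then bottom else side Y

/-- The kind in the previous tetrahedron, across a layer with letter `X`, of an edge in a bottom
face. The top edge lies in no bottom face. -/
def down (X : Letter) : EdgeKind → EdgeKind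
  | top => top
  | bottom => side X
  | side Y => if Y = X then top else side Y

theorem of_map_layerPerm_top (X : Letter) {g : Equiv.Perm (Fin 4)} (hg : g = 1 ∨ g = halfTurn) :
    ∀ f : Fin 4, 2 ≤ f → ∀ e : Finset (Fin 4), e.card = 2 → f ∉ e → of e ≠ bottom ∧
      of (e.map (g * X.layerPerm f).toEmbedding) = (of e).up X := by
  rcases hg with rfl | rfl <;> cases X <;> decide

theorem of_map_layerPerm_bottom (X : Letter) {g : Equiv.Perm (Fin 4)}
    (hg : g = 1 ∨ g = halfTurn) :
    ∀ f : Fin 4, ¬ 2 ≤ f → ∀ e : Finset (Fin 4), e.card = 2 → f ∉ e → of e ≠ top ∧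
      of (e.map (g * X.layerPerm f).toEmbedding) = (of e).down X := by
  rcases hg with rfl | rfl <;> cases X <;> decide

theorem exists_bottom_face_of_ne_top : ∀ e : Finset (Fin 4), e.card = 2 → of e ≠ top →
    ∃ f : Fin 4, ¬ 2 ≤ f ∧ f ∉ e := by
  decide

theorem of_eq_top_iff : ∀ e : Finset (Fin 4), of e = top ↔ e = {0, 1} := by
  decide

theorem up_down (X : Letter) {κ : EdgeKind} (hκ : κ ≠ top) : (κ.down X).up X = κ := by
  rcases κ with _ | _ | Y
  · exact absurd rfl hκ
  · simp [up, down]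
  · by_cases h : Y = X <;> simp [up, down, h]

theorem down_ne_bottom (X : Letter) {κ : EdgeKind} (hκ : κ ≠ top) : κ.down X ≠ bottom := by
  rcases κ with _ | _ | Y
  · exact absurd rfl hκ
  · simp [down]
  · by_cases h : Y = X <;> simp [down, h]

/-- The shape parameter at the edges of the given kind. -/
def param (z : ℝ) : EdgeKind → ℝ
  | top | bottom => z
  | side .R => 1 / (1 - z)
  | side .L => (z - 1) / z

end EdgeKind

open EdgeKind in
theorem edgeParam_eq_param (z : ℝ) (e : Finset (Fin 4)) : edgeParam z e = (of e).param z := by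
  have : ¬ ({0, 2} : Finset (Fin 4)) = {0, 1} ∧ ¬ ({0, 2} : Finset (Fin 4)) = {2, 3} ∧
      ¬ ({1, 3} : Finset (Fin 4)) = {0, 1} ∧ ¬ ({1, 3} : Finset (Fin 4)) = {2, 3} := by decide
  unfold edgeParam of
  split_ifs <;> first | rfl | grind

section Edges

variable {n : ℕ} (w : Fin (n + 1) → Letter)

/-- The index of the edge of the triangulation that contains the edges of the given kind of the
`j`-th tetrahedron; an edge has the index of the tetrahedron of which it is the top edge. -/
def edgeIndex (j : Fin (n + 1)) : EdgeKind → Fin (n + 1)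
  | .top => j
  | .bottom => bottomIndex w j
  | .side X => lastBefore w X j

variable {w} (s : ℤˣ)

theorem edgeIndex_succ_up (hw : w.Surjective) (j : Fin (n + 1)) {κ : EdgeKind}
    (hκ : κ ≠ .bottom) : edgeIndex w (j + 1) (κ.up (w j)) = edgeIndex w j κ := by
  rcases κ with _ | _ | Y
  · exact lastBefore_succ_of_eq rfl
  · exact absurd rfl hκ
  · by_cases hY : Y = w j
    · rw [EdgeKind.up, if_pos hY, hY]
      exact bottomIndex_succ j
    · simp only [EdgeKind.up, if_neg hY, edgeIndex]
      exact lastBefore_succ_of_ne (hw Y) (Ne.symm hY)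

theorem edgeIndex_pred_down (hw : w.Surjective) (j : Fin (n + 1)) {κ : EdgeKind}
    (hκ : κ ≠ .top) : edgeIndex w (j - 1) (κ.down (w (j - 1))) = edgeIndex w j κ := by
  have h := edgeIndex_succ_up hw (j - 1) (EdgeKind.down_ne_bottom (w (j - 1)) hκ)
  rwa [EdgeKind.up_down _ hκ, sub_add_cancel, eq_comm] at h

theorem seamPerm_eq_one_or_halfTurn (k : Fin (n + 1)) (f : Fin 4) :
    (if s = -1 ∧ IsSeam k f then halfTurn else 1) = 1 ∨
      (if s = -1 ∧ IsSeam k f then halfTurn else 1) = halfTurn := by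
  split_ifs <;> simp

theorem edgeIndex_eq_of_edgeAdj (hw : w.Surjective) {a b : EdgeSlot (Fin (n + 1))}
    (h : (monodromyTriangulation w s).EdgeAdj a b) :
    edgeIndex w a.1 (.of a.2.1) = edgeIndex w b.1 (.of b.2.1) := by
  obtain ⟨f, hf, hnbr, hmap⟩ := h
  rw [hnbr, hmap]
  simp only [monodromyTriangulation, monoNbr, monoPerm, monoLetter]
  have hseam := seamPerm_eq_one_or_halfTurn s a.1 f
  by_cases h2f : 2 ≤ f
  · obtain ⟨hne, hup⟩ := EdgeKind.of_map_layerPerm_top (w a.1) hseam f h2f a.2.1 a.2.2 hf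
    rw [if_pos h2f, if_pos h2f, hup, edgeIndex_succ_up hw _ hne]
  · obtain ⟨hne, hdown⟩ :=
      EdgeKind.of_map_layerPerm_bottom (w (a.1 - 1)) hseam f h2f a.2.1 a.2.2 hf
    rw [if_neg h2f, if_neg h2f, hdown, edgeIndex_pred_down hw _ hne]

variable (w) in
/-- The edge of the triangulation that contains the top edge of the `k`-th tetrahedron. -/
def topEdge (k : Fin (n + 1)) : (monodromyTriangulation w s).Edge :=
  Quot.mk _ (k, ⟨{0, 1}, rfl⟩)

theorem exists_edgeAdj_pred (j : Fin (n + 1)) (e : {e : Finset (Fin 4) // e.card = 2})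
    (he : EdgeKind.of e.1 ≠ .top) : ∃ e' : {e : Finset (Fin 4) // e.card = 2},
      (monodromyTriangulation w s).EdgeAdj (j, e) (j - 1, e') ∧
        EdgeKind.of e'.1 = (EdgeKind.of e.1).down (w (j - 1)) := by
  obtain ⟨f, h2f, hf⟩ := EdgeKind.exists_bottom_face_of_ne_top e.1 e.2 he
  obtain ⟨-, hdown⟩ := EdgeKind.of_map_layerPerm_bottom (w (j - 1))
    (seamPerm_eq_one_or_halfTurn s j f) f h2f e.1 e.2 hf
  refine ⟨⟨e.1.map (monoPerm w s j f).toEmbedding, by rw [Finset.card_map, e.2]⟩,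
    ⟨f, hf, ?_, rfl⟩, ?_⟩
  · simp [monodromyTriangulation, monoNbr, h2f]
  · rw [← hdown]
    simp only [monoPerm, monoLetter, if_neg h2f]

theorem mk_eq_topEdge_of_pred (hw : w.Surjective) {j : Fin (n + 1)}
    {e : {e : Finset (Fin 4) // e.card = 2}} (he : EdgeKind.of e.1 ≠ .top)
    (ih : ∀ e' : {e : Finset (Fin 4) // e.card = 2},
      EdgeKind.of e'.1 = (EdgeKind.of e.1).down (w (j - 1)) →
        Quot.mk _ (j - 1, e') = topEdge w s (edgeIndex w (j - 1) (.of e'.1))) :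
    Quot.mk _ (j, e) = topEdge w s (edgeIndex w j (.of e.1)) := by
  obtain ⟨e', hadj, he'⟩ := exists_edgeAdj_pred s j e he
  rw [Quot.sound hadj, ih e' he', edgeIndex_eq_of_edgeAdj s hw hadj]

theorem mk_eq_topEdge_of_top {j : Fin (n + 1)} {e : {e : Finset (Fin 4) // e.card = 2}}
    (he : EdgeKind.of e.1 = .top) :
    Quot.mk _ (j, e) = topEdge w s (edgeIndex w j (.of e.1)) := by
  obtain rfl : e = ⟨{0, 1}, rfl⟩ := Subtype.ext ((EdgeKind.of_eq_top_iff _).1 he)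
  rfl

theorem mk_eq_topEdge_of_side (hw : w.Surjective) (X : Letter) (j : Fin (n + 1)) :
    ∀ e : {e : Finset (Fin 4) // e.card = 2}, EdgeKind.of e.1 = .side X →
      Quot.mk _ (j, e) = topEdge w s (edgeIndex w j (.of e.1)) := by
  induction j using cyclicWord_induction (hw X) with
  | after j hj =>
    intro e he
    refine mk_eq_topEdge_of_pred s hw (by simp [he]) fun e' he' => mk_eq_topEdge_of_top s ?_
    simp [he', he, hj, EdgeKind.down]
  | step j hj ih =>
    intro e he
    refine mk_eq_topEdge_of_pred s hw (by simp [he]) fun e' he' => ?_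
    rw [add_sub_cancel_right] at he' ⊢
    exact ih e' (by rw [he', he, EdgeKind.down, if_neg (Ne.symm hj)])

theorem mk_eq_topEdge (hw : w.Surjective) (a : EdgeSlot (Fin (n + 1))) :
    Quot.mk _ a = topEdge w s (edgeIndex w a.1 (.of a.2.1)) := by
  obtain ⟨j, e⟩ := a
  rcases he : EdgeKind.of e.1 with _ | _ | X <;> rw [← he]
  · exact mk_eq_topEdge_of_top s he
  · exact mk_eq_topEdge_of_pred s hw (by simp [he]) fun e' he' =>
      mk_eq_topEdge_of_side s hw _ _ e' (by rw [he', he, EdgeKind.down])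
  · exact mk_eq_topEdge_of_side s hw X j e he

theorem mk_eq_topEdge_iff (hw : w.Surjective) (a : EdgeSlot (Fin (n + 1))) (k : Fin (n + 1)) :
    Quot.mk _ a = topEdge w s k ↔ edgeIndex w a.1 (.of a.2.1) = k := by
  refine ⟨fun h => ?_, fun h => h ▸ mk_eq_topEdge s hw a⟩
  exact congrArg (Quot.lift (fun a => edgeIndex w a.1 (.of a.2.1))
    fun _ _ hab => edgeIndex_eq_of_edgeAdj s hw hab) h

theorem topEdge_surjective (hw : w.Surjective) : Function.Surjective (topEdge w s) := by
  rintro ⟨a⟩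
  exact ⟨_, (mk_eq_topEdge s hw a).symm⟩

@[to_additive]
theorem prod_edgeKind_of {M : Type*} [CommMonoid M] (f : EdgeKind → M) :
    ∏ e : {e : Finset (Fin 4) // e.card = 2}, f (.of e.1) =
      f .top * f .bottom * f (.side .R) ^ 2 * f (.side .L) ^ 2 := by
  have huniv : (Finset.univ : Finset {e : Finset (Fin 4) // e.card = 2}).val.map
      (fun e => EdgeKind.of e.1) =
        {.top, .bottom, .side .R, .side .R, .side .L, .side .L} := by decide
  calc ∏ e : {e : Finset (Fin 4) // e.card = 2}, f (.of e.1)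
      = (((Finset.univ : Finset {e : Finset (Fin 4) // e.card = 2}).val.map
          fun e => EdgeKind.of e.1).map f).prod := by rw [Multiset.map_map]; rfl
    _ = f .top * f .bottom * f (.side .R) ^ 2 * f (.side .L) ^ 2 := by
        rw [huniv]; simp [pow_two, mul_assoc]

open Classical in
@[to_additive]
theorem prod_filter_mk_eq_topEdge {M : Type*} [CommMonoid M] (hw : w.Surjective)
    (f : Fin (n + 1) → EdgeKind → M) (k : Fin (n + 1)) :
    ∏ a : EdgeSlot (Fin (n + 1)) with Quot.mk _ a = topEdge w s k, f a.1 (.of a.2.1) =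
      ∏ j, (if j = k then f j .top else 1) * (if bottomIndex w j = k then f j .bottom else 1) *
        (if lastBefore w .R j = k then f j (.side .R) else 1) ^ 2 *
          (if lastBefore w .L j = k then f j (.side .L) else 1) ^ 2 := by
  simp only [mk_eq_topEdge_iff s hw]
  rw [Finset.prod_filter, Fintype.prod_prod_type]
  exact Finset.prod_congr rfl fun j _ =>
    prod_edgeKind_of fun κ => if edgeIndex w j κ = k then f j κ else 1

theorem edgeHolonomy_topEdge (hw : w.Surjective) (z : Fin (n + 1) → ℝ) (k : Fin (n + 1)) :
    (monodromyTriangulation w s).edgeHolonomy z (topEdge w s k) =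
      ∏ j, (if j = k then z j else 1) * (if bottomIndex w j = k then z j else 1) *
        (if lastBefore w .R j = k then 1 / (1 - z j) else 1) ^ 2 *
          (if lastBefore w .L j = k then (z j - 1) / z j else 1) ^ 2 := by
  rw [IdealTriangulation.edgeHolonomy]
  simp only [edgeParam_eq_param]
  exact prod_filter_mk_eq_topEdge s hw (fun j κ => κ.param (z j)) k

theorem totalAngle_topEdge (hw : w.Surjective) (z : Fin (n + 1) → ℝ) (k : Fin (n + 1)) :
    (monodromyTriangulation w s).totalAngle z (topEdge w s k) =
      ∑ j, ((if j = k then dihedralAngle (z j) else 0) +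
        (if bottomIndex w j = k then dihedralAngle (z j) else 0) +
        2 • (if lastBefore w .R j = k then dihedralAngle (1 / (1 - z j)) else 0) +
          2 • (if lastBefore w .L j = k then dihedralAngle ((z j - 1) / z j) else 0)) := by
  rw [IdealTriangulation.totalAngle]
  simp only [edgeParam_eq_param]
  exact sum_filter_mk_eq_topEdge s hw (fun j κ => dihedralAngle (κ.param (z j))) k

end Edges

/-! ### Balanced systems of equations on a cycle -/

theorem cyclic_backward_induction {n : ℕ} {P : Fin (n + 1) → Prop} {i : Fin (n + 1)} (base : P i)
    (step : ∀ j, P (j + 1) → P j) (j : Fin (n + 1)) : P j := by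
  obtain ⟨d, hd : d • 1 = i - j⟩ := nsmul_one_surjective (i - j)
  obtain rfl : j = i - d • 1 := by rw [hd, sub_sub_cancel]
  clear hd
  induction d with
  | zero => simpa using base
  | succ d ih => exact step _ (by rwa [succ_nsmul, ← sub_sub, sub_add_cancel])

open Matrix in
theorem mulVec_sup_zero_eq_zero {ι : Type*} [Fintype ι] {A : Matrix ι ι ℝ}
    (hsum : ∀ j, ∑ i, A i j = 0) (hA : ∀ i j, j ≠ i → 0 ≤ A i j) {v : ι → ℝ} (hv : A *ᵥ v = 0) :
    A *ᵥ (v ⊔ 0) = 0 := by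
  have hnonneg : ∀ i, 0 ≤ ∑ j, A i j * max (v j) 0 := by
    intro i
    rcases le_total (v i) 0 with h | h
    · refine Finset.sum_nonneg fun j _ => ?_
      obtain rfl | hj := eq_or_ne j i
      · rw [max_eq_right h, mul_zero]
      · exact mul_nonneg (hA i j hj) (le_max_right _ _)
    · refine (congrFun hv i).symm.le.trans (Finset.sum_le_sum fun j _ => ?_)
      obtain rfl | hj := eq_or_ne j i
      · rw [max_eq_left h]
      · exact mul_le_mul_of_nonneg_left (le_max_left _ _) (hA i j hj)
  have htotal : ∑ i, ∑ j, A i j * max (v j) 0 = 0 := by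
    rw [Finset.sum_comm]
    simp [← Finset.sum_mul, hsum]
  exact (Fintype.sum_eq_zero_iff_of_nonneg hnonneg).1 htotal

section CyclicKernel

open Matrix

variable {n : ℕ} {A : Matrix (Fin (n + 1)) (Fin (n + 1)) ℝ}

theorem nonpos_or_pos_of_mulVec_eq_zero (hsum : ∀ j, ∑ i, A i j = 0)
    (hA : ∀ i j, j ≠ i → 0 ≤ A i j) (hcycle : ∀ j, j ≠ j + 1 → 0 < A (j + 1) j)
    {v : Fin (n + 1) → ℝ} (hv : A *ᵥ v = 0) : (∀ j, v j ≤ 0) ∨ ∀ j, 0 < v j := by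
  refine or_iff_not_imp_right.2 fun hpos => ?_
  push Not at hpos
  obtain ⟨i, hi⟩ := hpos
  refine cyclic_backward_induction hi fun j hj => ?_
  obtain hne | hne := eq_or_ne j (j + 1)
  · rwa [hne]
  have hterm : ∀ k, 0 ≤ A (j + 1) k * max (v k) 0 := by
    intro k
    obtain rfl | hk := eq_or_ne k (j + 1)
    · rw [max_eq_right hj, mul_zero]
    · exact mul_nonneg (hA _ k hk) (le_max_right _ _)
  have hrow : ∑ k, A (j + 1) k * max (v k) 0 = 0 :=
    congrFun (mulVec_sup_zero_eq_zero hsum hA hv) (j + 1)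
  have hzero := congrFun ((Fintype.sum_eq_zero_iff_of_nonneg hterm).1 hrow) j
  exact max_eq_right_iff.1 ((mul_eq_zero.1 hzero).resolve_left (hcycle j hne).ne')

theorem eq_zero_or_pos_or_neg_of_mulVec_eq_zero (hsum : ∀ j, ∑ i, A i j = 0)
    (hA : ∀ i j, j ≠ i → 0 ≤ A i j) (hcycle : ∀ j, j ≠ j + 1 → 0 < A (j + 1) j)
    {v : Fin (n + 1) → ℝ} (hv : A *ᵥ v = 0) : v = 0 ∨ (∀ j, 0 < v j) ∨ ∀ j, v j < 0 := by
  have hneg : A *ᵥ (-v) = 0 := by rw [mulVec_neg, hv, neg_zero]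
  rcases nonpos_or_pos_of_mulVec_eq_zero hsum hA hcycle hv with h | h
  · rcases nonpos_or_pos_of_mulVec_eq_zero hsum hA hcycle hneg with h' | h'
    · exact Or.inl (funext fun j => le_antisymm (h j) (by simpa using h' j))
    · exact Or.inr (Or.inr fun j => by simpa using h' j)
  · exact Or.inr (Or.inl h)

end CyclicKernel

/-- A system of equations `∑ j, inflow i j (x j) = 2 * x i` in the unknowns `x j`, cyclically
ordered: the `j`-th unknown distributes its outflow `2 * x j` to the equations, and the equation
`j + 1` gets a strictly increasing share. The functions `heightTerm j` make up a strictly increasing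
function which is a proper coordinate on the set of solutions. -/
structure BalancedSystem (n : ℕ) where
  inflow : Fin (n + 1) → Fin (n + 1) → ℝ → ℝ
  heightTerm : Fin (n + 1) → ℝ → ℝ
  contDiff_inflow : ∀ i j, ContDiff ℝ ∞ (inflow i j)
  contDiff_heightTerm : ∀ j, ContDiff ℝ ∞ (heightTerm j)
  deriv_inflow_nonneg : ∀ i j t, 0 ≤ deriv (inflow i j) t
  deriv_inflow_succ_pos : ∀ j t, 0 < deriv (inflow (j + 1) j) t
  deriv_heightTerm_pos : ∀ j t, 0 < deriv (heightTerm j) t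
  sum_inflow : ∀ j t, ∑ i, inflow i j t = 2 * t
  exists_heightTerm_atTop : ∃ j, Filter.Tendsto (heightTerm j) .atTop .atTop
  exists_heightTerm_atBot : ∃ j, Filter.Tendsto (heightTerm j) .atBot .atBot
  tendsto_atTop : ∀ j, Filter.Tendsto (heightTerm j) .atTop .atTop ∨
    Filter.Tendsto (inflow (j + 1) j) .atTop .atTop
  tendsto_atBot : ∀ j, Filter.Tendsto (heightTerm j) .atBot .atBot ∨
    Filter.Tendsto (inflow (j + 1) j) .atBot .atBot

namespace BalancedSystem

variable {n : ℕ} (B : BalancedSystem n)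

/-- The difference of the two sides of the equations. -/
def flow (x : Fin (n + 1) → ℝ) (i : Fin (n + 1)) : ℝ :=
  -2 * x i + ∑ j, B.inflow i j (x j)

/-- The coordinate on the set of solutions. -/
def height (x : Fin (n + 1) → ℝ) : ℝ := ∑ j, B.heightTerm j (x j)

/-- The set of solutions of a balanced system. -/
def solutions : Set (Fin (n + 1) → ℝ) := {x | B.flow x = 0}

/-- The matrix of the differential of `flow`. -/
def jacobian (x : Fin (n + 1) → ℝ) : Matrix (Fin (n + 1)) (Fin (n + 1)) ℝ :=
  fun i j => (if j = i then -2 else 0) + deriv (B.inflow i j) (x j)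

theorem monotone_inflow (i j : Fin (n + 1)) : Monotone (B.inflow i j) :=
  monotone_of_deriv_nonneg ((B.contDiff_inflow i j).differentiable (by simp))
    (B.deriv_inflow_nonneg i j)

theorem strictMono_inflow_succ (j : Fin (n + 1)) : StrictMono (B.inflow (j + 1) j) :=
  strictMono_of_deriv_pos (B.deriv_inflow_succ_pos j)

theorem strictMono_heightTerm (j : Fin (n + 1)) : StrictMono (B.heightTerm j) :=
  strictMono_of_deriv_pos (B.deriv_heightTerm_pos j)

theorem contDiff_flow : ContDiff ℝ ∞ B.flow :=
  contDiff_pi.2 fun i => (contDiff_const.mul (contDiff_apply ℝ ℝ i)).add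
    (ContDiff.sum fun j _ => (B.contDiff_inflow i j).comp (contDiff_apply ℝ ℝ j))

theorem contDiff_height : ContDiff ℝ ∞ B.height :=
  ContDiff.sum fun j _ => (B.contDiff_heightTerm j).comp (contDiff_apply ℝ ℝ j)

theorem differentiable_flow : Differentiable ℝ B.flow := B.contDiff_flow.differentiable (by simp)

theorem differentiable_height : Differentiable ℝ B.height :=
  B.contDiff_height.differentiable (by simp)

theorem hasFDerivAt_sum_comp_apply {f : Fin (n + 1) → ℝ → ℝ} (hf : ∀ j, ContDiff ℝ ∞ (f j))
    (x : Fin (n + 1) → ℝ) : HasFDerivAt (fun x : Fin (n + 1) → ℝ => ∑ j, f j (x j))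
      (∑ j, deriv (f j) (x j) • (.proj j : (Fin (n + 1) → ℝ) →L[ℝ] ℝ)) x :=
  HasFDerivAt.fun_sum fun j _ =>
    ((hf j).differentiable (by simp) (x j)).hasDerivAt.comp_hasFDerivAt x (hasFDerivAt_apply j x)

open Matrix in
theorem fderiv_flow_apply (x v : Fin (n + 1) → ℝ) :
    fderiv ℝ B.flow x v = B.jacobian x *ᵥ v := by
  ext i
  have h : HasFDerivAt (fun x => B.flow x i) _ x :=
    ((hasFDerivAt_apply i x).const_mul (-2)).add
      (hasFDerivAt_sum_comp_apply (B.contDiff_inflow i) x)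
  rw [show fderiv ℝ B.flow x v i = fderiv ℝ (fun x => B.flow x i) x v from
    (DFunLike.congr_fun (fderiv_apply (B.differentiable_flow x) i) v).symm, h.fderiv]
  simp [jacobian, mulVec, dotProduct, add_mul, Finset.sum_add_distrib]

theorem fderiv_height_apply (x v : Fin (n + 1) → ℝ) :
    fderiv ℝ B.height x v = ∑ j, deriv (B.heightTerm j) (x j) * v j := by
  have h : HasFDerivAt B.height _ x := hasFDerivAt_sum_comp_apply B.contDiff_heightTerm x
  simp [h.fderiv]

theorem sum_flow (x : Fin (n + 1) → ℝ) : ∑ i, B.flow x i = 0 := by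
  simp only [flow]
  rw [Finset.sum_add_distrib, Finset.sum_comm, ← Finset.sum_add_distrib]
  exact Finset.sum_eq_zero fun j _ => by rw [B.sum_inflow]; ring

theorem sum_fderiv_flow (x v : Fin (n + 1) → ℝ) : ∑ i, fderiv ℝ B.flow x v i = 0 := by
  have h := HasFDerivAt.fun_sum (u := Finset.univ) fun i _ =>
    hasFDerivAt_pi'.1 (B.differentiable_flow x).hasFDerivAt i
  simp only [B.sum_flow] at h
  simpa using DFunLike.congr_fun (h.unique (hasFDerivAt_const 0 x)) v

theorem sum_jacobian (x : Fin (n + 1) → ℝ) (j : Fin (n + 1)) : ∑ i, B.jacobian x i j = 0 := by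
  simpa [fderiv_flow_apply] using B.sum_fderiv_flow x (Pi.single j 1)

theorem jacobian_of_ne (x : Fin (n + 1) → ℝ) {i j : Fin (n + 1)} (h : j ≠ i) :
    B.jacobian x i j = deriv (B.inflow i j) (x j) := by
  rw [jacobian, if_neg h, zero_add]

theorem fderiv_height_pos (x : Fin (n + 1) → ℝ) {v : Fin (n + 1) → ℝ} (hv : ∀ j, 0 < v j) :
    0 < fderiv ℝ B.height x v := by
  rw [fderiv_height_apply]
  exact Finset.sum_pos (fun j _ => mul_pos (B.deriv_heightTerm_pos j _) (hv j))
    Finset.univ_nonempty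

theorem eq_zero_or_pos_or_neg_of_fderiv_flow_eq_zero (x : Fin (n + 1) → ℝ)
    {v : Fin (n + 1) → ℝ} (hv : fderiv ℝ B.flow x v = 0) :
    v = 0 ∨ (∀ j, 0 < v j) ∨ ∀ j, v j < 0 := by
  rw [fderiv_flow_apply] at hv
  refine eq_zero_or_pos_or_neg_of_mulVec_eq_zero (B.sum_jacobian x) (fun i j hij => ?_)
    (fun j hj => ?_) hv
  · exact B.jacobian_of_ne x hij ▸ B.deriv_inflow_nonneg i j _
  · exact B.jacobian_of_ne x hj ▸ B.deriv_inflow_succ_pos j _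

theorem eq_zero_of_fderiv_flow_eq_zero (x : Fin (n + 1) → ℝ) {v : Fin (n + 1) → ℝ}
    (hv : fderiv ℝ B.flow x v = 0) (hheight : fderiv ℝ B.height x v = 0) : v = 0 := by
  rcases B.eq_zero_or_pos_or_neg_of_fderiv_flow_eq_zero x hv with h | h | h
  · exact h
  · exact absurd hheight (B.fderiv_height_pos x h).ne'
  · have := B.fderiv_height_pos x (v := -v) fun j => neg_pos.2 (h j)
    rw [map_neg, hheight, neg_zero] at this
    exact absurd this (lt_irrefl 0)

theorem pos_of_fderiv_flow_eq_zero (x : Fin (n + 1) → ℝ) {v : Fin (n + 1) → ℝ}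
    (hv : fderiv ℝ B.flow x v = 0) (hheight : 0 < fderiv ℝ B.height x v) (j : Fin (n + 1)) :
    0 < v j := by
  rcases B.eq_zero_or_pos_or_neg_of_fderiv_flow_eq_zero x hv with h | h | h
  · rw [h, map_zero] at hheight
    exact absurd hheight (lt_irrefl 0)
  · exact h j
  · have := B.fderiv_height_pos x (v := -v) fun j => neg_pos.2 (h j)
    rw [map_neg] at this
    exact absurd hheight (by linarith)

variable {B} {x y : Fin (n + 1) → ℝ}

theorem flow_le_flow_of_le (h : x ≤ y) {i : Fin (n + 1)} (hi : x i = y i) :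
    B.flow x i ≤ B.flow y i := by
  rw [flow, flow, hi]
  gcongr with j
  exact B.monotone_inflow i j (h j)

-- The flow of the supremum is non-negative in every equation, and its entries sum to zero.
theorem sup_mem_solutions (hx : x ∈ B.solutions) (hy : y ∈ B.solutions) :
    x ⊔ y ∈ B.solutions := by
  refine (Fintype.sum_eq_zero_iff_of_nonneg fun i => ?_).1 (B.sum_flow (x ⊔ y))
  rcases le_total (x i) (y i) with h | h
  · exact (congrFun hy i).symm.le.trans (flow_le_flow_of_le le_sup_right (by simp [h]))
  · exact (congrFun hx i).symm.le.trans (flow_le_flow_of_le le_sup_left (by simp [h]))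

theorem inflow_sub_le_of_mem_solutions (hx : x ∈ B.solutions) (hy : y ∈ B.solutions) (h : x ≤ y)
    (j : Fin (n + 1)) :
    B.inflow (j + 1) j (y j) - B.inflow (j + 1) j (x j) ≤ 2 * (y (j + 1) - x (j + 1)) := by
  have hterm : B.inflow (j + 1) j (y j) - B.inflow (j + 1) j (x j) ≤
      ∑ k, (B.inflow (j + 1) k (y k) - B.inflow (j + 1) k (x k)) :=
    Finset.single_le_sum (f := fun k => B.inflow (j + 1) k (y k) - B.inflow (j + 1) k (x k))
      (fun k _ => sub_nonneg.2 (B.monotone_inflow _ k (h k))) (Finset.mem_univ j)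
  have hflow_x : -2 * x (j + 1) + ∑ k, B.inflow (j + 1) k (x k) = 0 := congrFun hx (j + 1)
  have hflow_y : -2 * y (j + 1) + ∑ k, B.inflow (j + 1) k (y k) = 0 := congrFun hy (j + 1)
  rw [Finset.sum_sub_distrib] at hterm
  linarith

theorem heightTerm_sub_le (h : x ≤ y) (j : Fin (n + 1)) :
    B.heightTerm j (y j) - B.heightTerm j (x j) ≤ B.height y - B.height x := by
  rw [height, height, ← Finset.sum_sub_distrib]
  exact Finset.single_le_sum (f := fun k => B.heightTerm k (y k) - B.heightTerm k (x k))
    (fun k _ => sub_nonneg.2 ((B.strictMono_heightTerm k).monotone (h k))) (Finset.mem_univ j)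

theorem eq_of_le_of_apply_eq (hx : x ∈ B.solutions) (hy : y ∈ B.solutions) (h : x ≤ y)
    {i : Fin (n + 1)} (hi : x i = y i) : x = y := by
  ext j
  induction j using cyclic_backward_induction (i := i) with
  | base => exact hi
  | step j hj =>
    have hle := inflow_sub_le_of_mem_solutions hx hy h j
    exact le_antisymm (h j) ((B.strictMono_inflow_succ j).le_iff_le.1 (by linarith))

theorem le_total_of_mem_solutions (hx : x ∈ B.solutions) (hy : y ∈ B.solutions) :
    x ≤ y ∨ y ≤ x := by
  have hsup := sup_mem_solutions hx hy
  rcases le_total (x 0) (y 0) with h0 | h0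
  · exact Or.inl (sup_eq_right.1
      (eq_of_le_of_apply_eq hy hsup le_sup_right (i := 0) (by simp [h0])).symm)
  · exact Or.inr (sup_eq_left.1
      (eq_of_le_of_apply_eq hx hsup le_sup_left (i := 0) (by simp [h0])).symm)

theorem eq_of_le_of_height_eq (h : x ≤ y) (hheight : B.height x = B.height y) : x = y := by
  ext j
  have hle := heightTerm_sub_le (B := B) h j
  exact le_antisymm (h j) ((B.strictMono_heightTerm j).le_iff_le.1 (by linarith))

theorem height_injOn_solutions : Set.InjOn B.height B.solutions := by
  intro x hx y hy h
  rcases le_total_of_mem_solutions hx hy with hle | hle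
  · exact eq_of_le_of_height_eq hle h
  · exact (eq_of_le_of_height_eq hle h.symm).symm

theorem exists_upper_bound (hx : x ∈ B.solutions) (c : ℝ) (j : Fin (n + 1)) :
    ∃ C, ∀ y ∈ B.solutions, x ≤ y → B.height y ≤ c → y j ≤ C := by
  have of_heightTerm : ∀ j, Filter.Tendsto (B.heightTerm j) .atTop .atTop →
      ∃ C, ∀ y ∈ B.solutions, x ≤ y → B.height y ≤ c → y j ≤ C := by
    intro j hj
    obtain ⟨C, hC⟩ := (hj.eventually_gt_atTop
      (c - B.height x + B.heightTerm j (x j))).exists_forall_of_atTop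
    refine ⟨C, fun y _ hxy hc => not_lt.1 fun hlt => ?_⟩
    linarith [hC _ hlt.le, heightTerm_sub_le (B := B) hxy j]
  obtain ⟨i, hi⟩ := B.exists_heightTerm_atTop
  induction j using cyclic_backward_induction (i := i) with
  | base => exact of_heightTerm i hi
  | step j ih =>
    obtain ⟨C, hC⟩ := ih
    refine (B.tendsto_atTop j).elim (of_heightTerm j) fun hj => ?_
    obtain ⟨D, hD⟩ := (hj.eventually_gt_atTop
      (2 * (C - x (j + 1)) + B.inflow (j + 1) j (x j))).exists_forall_of_atTop
    refine ⟨D, fun y hy hxy hc => not_lt.1 fun hlt => ?_⟩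
    linarith [hD _ hlt.le, inflow_sub_le_of_mem_solutions hx hy hxy j, hC y hy hxy hc]

theorem exists_lower_bound (hx : x ∈ B.solutions) (c : ℝ) (j : Fin (n + 1)) :
    ∃ C, ∀ y ∈ B.solutions, y ≤ x → c ≤ B.height y → C ≤ y j := by
  have of_heightTerm : ∀ j, Filter.Tendsto (B.heightTerm j) .atBot .atBot →
      ∃ C, ∀ y ∈ B.solutions, y ≤ x → c ≤ B.height y → C ≤ y j := by
    intro j hj
    obtain ⟨C, hC⟩ := (hj.eventually_lt_atBot
      (B.heightTerm j (x j) - (B.height x - c))).exists_forall_of_atBot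
    refine ⟨C, fun y _ hyx hc => not_lt.1 fun hlt => ?_⟩
    linarith [hC _ hlt.le, heightTerm_sub_le (B := B) hyx j]
  obtain ⟨i, hi⟩ := B.exists_heightTerm_atBot
  induction j using cyclic_backward_induction (i := i) with
  | base => exact of_heightTerm i hi
  | step j ih =>
    obtain ⟨C, hC⟩ := ih
    refine (B.tendsto_atBot j).elim (of_heightTerm j) fun hj => ?_
    obtain ⟨D, hD⟩ := (hj.eventually_lt_atBot
      (B.inflow (j + 1) j (x j) - 2 * (x (j + 1) - C))).exists_forall_of_atBot
    refine ⟨D, fun y hy hyx hc => not_lt.1 fun hlt => ?_⟩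
    linarith [hD _ hlt.le, inflow_sub_le_of_mem_solutions hy hx hyx j, hC y hy hyx hc]

variable (B)

theorem isClosed_solutions : IsClosed B.solutions :=
  isClosed_eq B.contDiff_flow.continuous continuous_const

theorem isCompact_solutions_inter_preimage_Icc (a c : ℝ) :
    IsCompact (B.solutions ∩ B.height ⁻¹' Set.Icc a c) := by
  rcases Set.eq_empty_or_nonempty B.solutions with h | ⟨x, hx⟩
  · simp [h]
  choose C hC using exists_upper_bound hx c
  choose D hD using exists_lower_bound hx a
  refine IsCompact.of_isClosed_subset (isCompact_Icc (a := D ⊓ x) (b := C ⊔ x))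
    (B.isClosed_solutions.inter (isClosed_Icc.preimage B.contDiff_height.continuous)) ?_
  rintro y ⟨hy, hay, hyc⟩
  rcases le_total_of_mem_solutions hx hy with h | h
  · exact ⟨inf_le_right.trans h, fun j => (hC j y hy h hyc).trans le_sup_left⟩
  · exact ⟨fun j => inf_le_left.trans (hD j y hy h hay), h.trans le_sup_right⟩

theorem isClosed_image_height : IsClosed (B.height '' B.solutions) := by
  refine isClosed_of_closure_subset fun t ht => ?_
  have hslab : IsClosed (B.height '' B.solutions ∩ Set.Icc (t - 1) (t + 1)) := by
    rw [← Set.image_inter_preimage]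
    exact ((B.isCompact_solutions_inter_preimage_Icc _ _).image
      B.contDiff_height.continuous).isClosed
  have hmem : t ∈ closure (B.height '' B.solutions ∩ Set.Icc (t - 1) (t + 1)) := by
    rw [mem_closure_iff_nhdsWithin_neBot] at ht ⊢
    rwa [nhdsWithin_inter_of_mem'
      (mem_nhdsWithin_of_mem_nhds (Icc_mem_nhds (sub_one_lt t) (lt_add_one t)))]
  rw [hslab.closure_eq] at hmem
  exact hmem.1

/-- The equations combined with the height, to which the inverse function theorem applies: the
solution of height `t` is the point with value `t` in all entries. -/
def chart (x : Fin (n + 1) → ℝ) (i : Fin (n + 1)) : ℝ := B.flow x i + B.height x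

theorem contDiff_chart : ContDiff ℝ ∞ B.chart :=
  contDiff_pi.2 fun i => (contDiff_pi.1 B.contDiff_flow i).add B.contDiff_height

theorem eq_zero_and_eq_of_add_eq {f : Fin (n + 1) → ℝ} {a t : ℝ} (hf : ∑ i, f i = 0)
    (h : ∀ i, f i + a = t) : f = 0 ∧ a = t := by
  have hsum : ∑ i, (f i + a) = ∑ _i : Fin (n + 1), t := Finset.sum_congr rfl fun i _ => h i
  rw [Finset.sum_add_distrib, hf, zero_add, Finset.sum_const, Finset.sum_const] at hsum
  have hat : a = t := nsmul_right_injective (by simp) hsum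
  exact ⟨funext fun i => by linarith [h i, show (0 : Fin (n + 1) → ℝ) i = 0 from rfl], hat⟩

theorem chart_eq_const_iff (x : Fin (n + 1) → ℝ) (t : ℝ) :
    (B.chart x = fun _ => t) ↔ x ∈ B.solutions ∧ B.height x = t := by
  refine ⟨fun h => eq_zero_and_eq_of_add_eq (B.sum_flow x) (congrFun h), fun ⟨hx, ht⟩ => ?_⟩
  ext i
  rw [chart, hx, ht, Pi.zero_apply, zero_add]

theorem fderiv_chart_apply (x v : Fin (n + 1) → ℝ) (i : Fin (n + 1)) :
    fderiv ℝ B.chart x v i = fderiv ℝ B.flow x v i + fderiv ℝ B.height x v := by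
  have h : HasFDerivAt B.chart _ x := hasFDerivAt_pi.2 fun i =>
    (hasFDerivAt_pi'.1 (B.differentiable_flow x).hasFDerivAt i).add
      (B.differentiable_height x).hasFDerivAt
  rw [h.fderiv]
  rfl

theorem fderiv_chart_injective (x : Fin (n + 1) → ℝ) :
    Function.Injective (fderiv ℝ B.chart x) := by
  refine (injective_iff_map_eq_zero _).2 fun v hv => ?_
  obtain ⟨hflow, hheight⟩ := eq_zero_and_eq_of_add_eq (B.sum_fderiv_flow x v)
    fun i => (B.fderiv_chart_apply x v i).symm.trans (congrFun hv i)
  exact B.eq_zero_of_fderiv_flow_eq_zero x hflow hheight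

/-- The differential of the chart as an equivalence. -/
def fderivChartEquiv (x : Fin (n + 1) → ℝ) : (Fin (n + 1) → ℝ) ≃L[ℝ] (Fin (n + 1) → ℝ) :=
  (LinearEquiv.ofInjectiveEndo (fderiv ℝ B.chart x).toLinearMap
    (B.fderiv_chart_injective x)).toContinuousLinearEquiv

theorem hasFDerivAt_chart (x : Fin (n + 1) → ℝ) :
    HasFDerivAt B.chart (B.fderivChartEquiv x : (Fin (n + 1) → ℝ) →L[ℝ] (Fin (n + 1) → ℝ)) x :=
  (B.contDiff_chart.differentiable (by simp) x).hasFDerivAt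

theorem exists_local_curve {x : Fin (n + 1) → ℝ} (hx : x ∈ B.solutions) :
    ∃ γ : ℝ → Fin (n + 1) → ℝ, ContDiffAt ℝ ∞ γ (B.height x) ∧
      ∀ᶠ t in nhds (B.height x), γ t ∈ B.solutions ∧ B.height (γ t) = t := by
  have hn : (∞ : WithTop ℕ∞) ≠ 0 := by simp
  have hx_const : B.chart x = fun _ => B.height x := (B.chart_eq_const_iff x _).2 ⟨hx, rfl⟩
  have hd := B.hasFDerivAt_chart x
  have hf : ContDiffAt ℝ ∞ B.chart x := B.contDiff_chart.contDiffAt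
  have hdiag : ContDiff ℝ ∞ (fun (t : ℝ) (_ : Fin (n + 1)) => t) :=
    contDiff_pi.2 fun _ => contDiff_id
  have hsmooth := hf.to_localInverse hd hn
  have hinverse := (hf.hasStrictFDerivAt' hd hn).eventually_right_inverse
  rw [hx_const] at hsmooth hinverse
  refine ⟨fun t => hf.localInverse hd hn fun _ => t,
    ContDiffAt.comp (B.height x) hsmooth hdiag.contDiffAt, ?_⟩
  filter_upwards [(hdiag.continuous.tendsto (B.height x)).eventually hinverse] with t ht
  exact (B.chart_eq_const_iff _ t).1 ht

theorem surjOn_height_solutions (h : B.solutions.Nonempty) :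
    Set.SurjOn B.height B.solutions Set.univ := by
  have hopen : IsOpen (B.height '' B.solutions) := by
    refine isOpen_iff_mem_nhds.2 ?_
    rintro _ ⟨x, hx, rfl⟩
    obtain ⟨γ, -, hγ⟩ := B.exists_local_curve hx
    filter_upwards [hγ] with t ht using ⟨γ t, ht⟩
  exact (IsClopen.eq_univ ⟨B.isClosed_image_height, hopen⟩ (h.image _)).ge

section Curve

variable {B} {γ : ℝ → Fin (n + 1) → ℝ}

theorem contDiff_of_height_eq (hγ : ∀ t, γ t ∈ B.solutions) (hheight : ∀ t, B.height (γ t) = t) :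
    ContDiff ℝ ∞ γ := by
  refine contDiff_iff_contDiffAt.2 fun t => ?_
  obtain ⟨η, hη, hsol⟩ := B.exists_local_curve (hγ t)
  rw [hheight] at hη hsol
  refine hη.congr_of_eventuallyEq ?_
  filter_upwards [hsol] with u hu
  exact height_injOn_solutions (hγ u) hu.1 (by rw [hheight, hu.2])

theorem hasDerivAt_of_height_eq (hγ : ∀ t, γ t ∈ B.solutions) (hheight : ∀ t, B.height (γ t) = t)
    (t : ℝ) : HasDerivAt γ (deriv γ t) t :=
  ((contDiff_of_height_eq hγ hheight).differentiable (by simp) t).hasDerivAt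

theorem range_of_height_eq (hγ : ∀ t, γ t ∈ B.solutions) (hheight : ∀ t, B.height (γ t) = t) :
    Set.range γ = B.solutions := by
  ext x
  refine ⟨?_, fun hx => ⟨B.height x, height_injOn_solutions (hγ _) hx (hheight _)⟩⟩
  rintro ⟨t, rfl⟩
  exact hγ t

theorem fderiv_flow_deriv_curve (hγ : ∀ t, γ t ∈ B.solutions) (hheight : ∀ t, B.height (γ t) = t)
    (t : ℝ) : fderiv ℝ B.flow (γ t) (deriv γ t) = 0 := by
  have h := (B.differentiable_flow (γ t)).hasFDerivAt.comp_hasDerivAt t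
    (hasDerivAt_of_height_eq hγ hheight t)
  rw [show B.flow ∘ γ = fun _ => 0 from funext hγ] at h
  exact h.unique (hasDerivAt_const t 0)

theorem fderiv_height_deriv_curve (hγ : ∀ t, γ t ∈ B.solutions) (hheight : ∀ t, B.height (γ t) = t)
    (t : ℝ) : fderiv ℝ B.height (γ t) (deriv γ t) = 1 := by
  have h := (B.differentiable_height (γ t)).hasFDerivAt.comp_hasDerivAt t
    (hasDerivAt_of_height_eq hγ hheight t)
  rw [show B.height ∘ γ = id from funext hheight] at h
  exact h.unique (hasDerivAt_id t)

theorem deriv_curve_pos (hγ : ∀ t, γ t ∈ B.solutions) (hheight : ∀ t, B.height (γ t) = t) (t : ℝ)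
    (j : Fin (n + 1)) : 0 < deriv γ t j :=
  B.pos_of_fderiv_flow_eq_zero (γ t) (fderiv_flow_deriv_curve hγ hheight t)
    (by rw [fderiv_height_deriv_curve hγ hheight]; exact one_pos) j

theorem fderiv_flow_eq_zero_iff_mem_span (hγ : ∀ t, γ t ∈ B.solutions)
    (hheight : ∀ t, B.height (γ t) = t) (t : ℝ) (v : Fin (n + 1) → ℝ) :
    fderiv ℝ B.flow (γ t) v = 0 ↔ v ∈ Submodule.span ℝ {deriv γ t} := by
  have hflow := fderiv_flow_deriv_curve hγ hheight t
  rw [Submodule.mem_span_singleton]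
  constructor
  · intro hv
    refine ⟨fderiv ℝ B.height (γ t) v, (sub_eq_zero.1 ?_).symm⟩
    refine B.eq_zero_of_fderiv_flow_eq_zero (γ t) ?_ ?_
    · rw [map_sub, map_smul, hflow, hv, smul_zero, sub_zero]
    · rw [map_sub, map_smul, fderiv_height_deriv_curve hγ hheight, smul_eq_mul, mul_one, sub_self]
  · rintro ⟨a, rfl⟩
    rw [map_smul, hflow, smul_zero]

end Curve

theorem exists_curve (h : B.solutions.Nonempty) : ∃ γ : ℝ → Fin (n + 1) → ℝ,
    ContDiff ℝ ∞ γ ∧ Set.range γ = B.solutions ∧ (∀ t, B.height (γ t) = t) ∧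
      (∀ t j, 0 < deriv γ t j) ∧
        ∀ t v, fderiv ℝ B.flow (γ t) v = 0 ↔ v ∈ Submodule.span ℝ {deriv γ t} := by
  choose γ hγ hheight using fun t => B.surjOn_height_solutions h (Set.mem_univ t)
  exact ⟨γ, contDiff_of_height_eq hγ hheight, range_of_height_eq hγ hheight, hheight,
    deriv_curve_pos hγ hheight, fderiv_flow_eq_zero_iff_mem_span hγ hheight⟩

end BalancedSystem

/-! ### Shape parameters on the two sides of `1` -/

namespace Letter

/-- The exchange of the two letters. -/
def other : Letter → Letter
  | .R => .L
  | .L => .R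

theorem other_ne : ∀ X : Letter, X.other ≠ X
  | .R => nofun
  | .L => nofun

/-- A coordinate on the positive shape parameters other than `1`: those greater than `1` for the
letter `R`, those less than `1` for the letter `L`. -/
def param : Letter → ℝ → ℝ
  | .R, x => 1 + Real.exp x
  | .L, x => Real.sigmoid x

/-- The set of values of `Letter.param`. -/
def InRange : Letter → ℝ → Prop
  | .R, z => 1 < z
  | .L, z => 0 < z ∧ z < 1

variable (X : Letter)

theorem inRange_iff (z : ℝ) : X.InRange z ↔ ∃ x, X.param x = z := by
  cases X with
  | R =>
    refine ⟨fun h => ⟨Real.log (z - 1), ?_⟩, ?_⟩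
    · rw [param, Real.exp_log (sub_pos.2 h), add_sub_cancel]
    · rintro ⟨x, rfl⟩
      exact lt_add_of_pos_right 1 (Real.exp_pos x)
  | L => exact (Set.ext_iff.1 Real.range_sigmoid z).symm

variable {X} in
theorem InRange.pos {z : ℝ} (h : X.InRange z) : 0 < z := by
  cases X with
  | R => exact zero_lt_one.trans h
  | L => exact h.1

variable {X} in
theorem InRange.ne_one {z : ℝ} (h : X.InRange z) : z ≠ 1 := by
  cases X with
  | R => exact h.ne'
  | L => exact h.2.ne

theorem inRange_param (x : ℝ) : X.InRange (X.param x) := (X.inRange_iff _).2 ⟨x, rfl⟩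

theorem param_pos (x : ℝ) : 0 < X.param x := (X.inRange_param x).pos

theorem contDiff_param : ContDiff ℝ ∞ X.param := by
  cases X with
  | R => exact contDiff_const.add Real.contDiff_exp
  | L => exact contDiff_sigmoid.of_le le_top

theorem deriv_param_pos (x : ℝ) : 0 < deriv X.param x := by
  cases X with
  | R =>
    have hderiv : HasDerivAt (param .R) (Real.exp x) x := (Real.hasDerivAt_exp x).const_add 1
    exact hderiv.deriv ▸ Real.exp_pos x
  | L =>
    have hderiv : HasDerivAt (param .L) _ x := Real.hasDerivAt_sigmoid x
    exact hderiv.deriv ▸ mul_pos (Real.sigmoid_pos x) (sub_pos.2 (Real.sigmoid_lt_one x))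

theorem param_R_mul_param_L (x : ℝ) : param .R x * param .L x = Real.exp x := by
  simp only [param, Real.sigmoid_def, Real.exp_neg]
  field_simp
  ring

/-- The logarithm of the shape parameter in terms of the coordinate of `Letter.param`. -/
def logParam (x : ℝ) : ℝ := Real.log (X.param x)

theorem logParam_R_add_logParam_L (x : ℝ) : logParam .R x + logParam .L x = x := by
  rw [logParam, logParam, ← Real.log_mul (param_pos _ x).ne' (param_pos _ x).ne',
    param_R_mul_param_L, Real.log_exp]

theorem contDiff_logParam : ContDiff ℝ ∞ X.logParam :=
  X.contDiff_param.log fun x => (X.param_pos x).ne'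

theorem deriv_logParam_pos (x : ℝ) : 0 < deriv X.logParam x := by
  have hparam := (X.contDiff_param.differentiable (by simp) x).hasDerivAt
  have hderiv : HasDerivAt X.logParam _ x := hparam.log (X.param_pos x).ne'
  exact hderiv.deriv ▸ div_pos (X.deriv_param_pos x) (X.param_pos x)

theorem monotone_logParam : Monotone X.logParam :=
  (strictMono_of_deriv_pos X.deriv_logParam_pos).monotone

theorem logParam_L_nonpos (x : ℝ) : logParam .L x ≤ 0 :=
  Real.log_nonpos (param_pos .L x).le (Real.sigmoid_le_one x)

theorem logParam_R_nonneg (x : ℝ) : 0 ≤ logParam .R x :=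
  Real.log_nonneg (inRange_param .R x).le

theorem tendsto_logParam_R_atTop : Filter.Tendsto (logParam .R) .atTop .atTop :=
  Filter.tendsto_atTop_mono
    (fun x => show x ≤ _ by linarith [logParam_R_add_logParam_L x, logParam_L_nonpos x])
    Filter.tendsto_id

theorem tendsto_logParam_L_atBot : Filter.Tendsto (logParam .L) .atBot .atBot :=
  Filter.tendsto_atBot_mono
    (fun x => show _ ≤ x by linarith [logParam_R_add_logParam_L x, logParam_R_nonneg x])
    Filter.tendsto_id

/-- The linear combination of the two functions `Letter.logParam` with coefficients `c`. -/
def logCombination (c : Letter → ℝ) (t : ℝ) : ℝ := c .R * logParam .R t + c .L * logParam .L t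

variable {c : Letter → ℝ}

theorem contDiff_logCombination (c : Letter → ℝ) : ContDiff ℝ ∞ (logCombination c) :=
  (contDiff_const.mul (contDiff_logParam .R)).add (contDiff_const.mul (contDiff_logParam .L))

theorem deriv_logCombination (c : Letter → ℝ) (t : ℝ) : deriv (logCombination c) t =
    c .R * deriv (logParam .R) t + c .L * deriv (logParam .L) t := by
  have hparam (Y : Letter) := (Y.contDiff_logParam.differentiable (by simp) t).hasDerivAt
  exact (((hparam .R).const_mul (c .R)).add ((hparam .L).const_mul (c .L))).deriv

theorem deriv_logCombination_nonneg (hc : ∀ Y, 0 ≤ c Y) (t : ℝ) :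
    0 ≤ deriv (logCombination c) t := by
  rw [deriv_logCombination]
  exact add_nonneg (mul_nonneg (hc _) (deriv_logParam_pos _ t).le)
    (mul_nonneg (hc _) (deriv_logParam_pos _ t).le)

variable {X} in
theorem deriv_logCombination_pos (hc : ∀ Y, 0 ≤ c Y) (hX : 0 < c X) (t : ℝ) :
    0 < deriv (logCombination c) t := by
  have hR := deriv_logParam_pos .R t
  have hL := deriv_logParam_pos .L t
  rw [deriv_logCombination]
  cases X with
  | R => exact add_pos_of_pos_of_nonneg (mul_pos hX hR) (mul_nonneg (hc _) hL.le)
  | L => exact add_pos_of_nonneg_of_pos (mul_nonneg (hc _) hR.le) (mul_pos hX hL)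

theorem tendsto_logCombination_atTop (hL : 0 ≤ c .L) (hR : 0 < c .R) :
    Filter.Tendsto (logCombination c) .atTop .atTop := by
  refine Filter.tendsto_atTop_add_right_of_le' _ (c .L * logParam .L 0)
    (tendsto_logParam_R_atTop.const_mul_atTop hR) ?_
  filter_upwards [Filter.eventually_ge_atTop 0] with t ht
  exact mul_le_mul_of_nonneg_left (monotone_logParam .L ht) hL

theorem tendsto_logCombination_atBot (hR : 0 ≤ c .R) (hL : 0 < c .L) :
    Filter.Tendsto (logCombination c) .atBot .atBot := by
  refine Filter.tendsto_atBot_add_left_of_ge' _ (c .R * logParam .R 0) ?_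
    (tendsto_logParam_L_atBot.const_mul_atBot hL)
  filter_upwards [Filter.eventually_le_atBot 0] with t ht
  exact mul_le_mul_of_nonneg_left (monotone_logParam .R ht) hR

/-- The logarithm of the square of the shape parameter of the edges of kind `EdgeKind.side`. -/
def logSq : Letter → ℝ → ℝ
  | .R, z => -2 * Real.log (1 - z)
  | .L, z => 2 * Real.log (1 - z) - 2 * Real.log z

theorem two_log_add_logSq_add_logSq (z : ℝ) :
    2 * Real.log z + logSq .R z + logSq .L z = 0 := by
  simp only [logSq]
  ring

theorem exp_logSq {z : ℝ} (h0 : z ≠ 0) (h1 : z ≠ 1) :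
    Real.exp (X.logSq z) = (EdgeKind.side X).param z ^ 2 := by
  have exp_two_mul_log {a : ℝ} (ha : a ≠ 0) : Real.exp (2 * Real.log a) = a ^ 2 := by
    rw [two_mul, Real.exp_add, Real.exp_log_eq_abs ha, ← sq, sq_abs]
  have h1' : 1 - z ≠ 0 := sub_ne_zero.2 h1.symm
  cases X with
  | R =>
    rw [logSq, EdgeKind.param, neg_mul, Real.exp_neg, exp_two_mul_log h1', one_div, inv_pow]
  | L =>
    rw [logSq, EdgeKind.param, Real.exp_sub, exp_two_mul_log h1', exp_two_mul_log h0, div_pow,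
      sub_sq_comm]

theorem logSq_param_self (x : ℝ) : X.logSq (X.param x) = -2 * x := by
  cases X with
  | R => simp [logSq, param]
  | L =>
    have hexp : Real.sigmoid (-x) = Real.sigmoid x * Real.exp (-x) :=
      (Real.sigmoid_mul_rexp_neg x).symm
    rw [logSq, param, ← Real.sigmoid_neg, hexp,
      Real.log_mul (Real.sigmoid_pos x).ne' (Real.exp_ne_zero _), Real.log_exp]
    ring

variable {X} in
theorem logSq_param_of_ne {Y : Letter} (h : Y ≠ X) (x : ℝ) :
    Y.logSq (X.param x) = 2 * Y.logParam x := by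
  have hself := X.logSq_param_self x
  have hsum := two_log_add_logSq_add_logSq (X.param x)
  have hlog := logParam_R_add_logParam_L x
  cases X <;> cases Y <;> first | exact absurd rfl h | (simp only [logParam] at *; linarith)

end Letter

/-! ### The logarithmic edge equations -/

section LogHolonomy

variable {n : ℕ} (w : Fin (n + 1) → Letter)

/-- The logarithm of the holonomy of the edge `topEdge w s k`, for positive shape parameters. -/
def logHolonomy (z : Fin (n + 1) → ℝ) (k : Fin (n + 1)) : ℝ :=
  ∑ j, ((if j = k then Real.log (z j) else 0) +
    (if bottomIndex w j = k then Real.log (z j) else 0) +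
    (if lastBefore w .R j = k then Letter.logSq .R (z j) else 0) +
    (if lastBefore w .L j = k then Letter.logSq .L (z j) else 0))

variable {w}

theorem edgeHolonomy_eq_exp (s : ℤˣ) (hw : w.Surjective) {z : Fin (n + 1) → ℝ}
    (hpos : ∀ j, 0 < z j) (hone : ∀ j, z j ≠ 1) (k : Fin (n + 1)) :
    (monodromyTriangulation w s).edgeHolonomy z (topEdge w s k) =
      Real.exp (logHolonomy w z k) := by
  rw [edgeHolonomy_topEdge s hw, logHolonomy, Real.exp_sum]
  refine Finset.prod_congr rfl fun j _ => ?_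
  have hR := Letter.exp_logSq .R (hpos j).ne' (hone j)
  have hL := Letter.exp_logSq .L (hpos j).ne' (hone j)
  simp only [EdgeKind.param] at hR hL
  simp only [Real.exp_add, apply_ite Real.exp, Real.exp_zero, Real.exp_log (hpos j), hR, hL,
    ite_pow, one_pow]

theorem sum_mul_logHolonomy (p z : Fin (n + 1) → ℝ) :
    ∑ k, p k * logHolonomy w z k =
      ∑ j, (p j * Real.log (z j) + p (bottomIndex w j) * Real.log (z j) +
        p (lastBefore w .R j) * Letter.logSq .R (z j) +
        p (lastBefore w .L j) * Letter.logSq .L (z j)) := by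
  simp only [logHolonomy, Finset.mul_sum]
  rw [Finset.sum_comm]
  refine Finset.sum_congr rfl fun j _ => ?_
  simp only [mul_add, Finset.sum_add_distrib, mul_ite, mul_zero, Finset.sum_ite_eq,
    Finset.mem_univ, if_true]

/-- The position of an index in the cyclic order, counted from the last one. -/
def position (k : Fin (n + 1)) : ℝ := ((k + 1 : Fin (n + 1)) : ℕ)

theorem position_succ (k : Fin (n + 1)) :
    position (k + 1) = position k + 1 - (n + 1) * (if k + 1 = Fin.last n then 1 else 0) := by
  unfold position
  rw [Fin.val_add_one (k + 1)]
  split_ifs with h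
  · rw [h, Fin.val_last]
    ring
  · push_cast
    ring

/-- The number of times that the way back from `j` to the preceding letter `X` passes the last
position, for a word that begins with `R` and ends with `L`. -/
def wraps (X : Letter) (j : Fin (n + 1)) : ℝ :=
  (if j = Fin.last n then 1 else 0) + (if X = .R ∧ j = 0 then 1 else 0)

theorem surjective_of_first_of_last (hfirst : w 0 = .R) (hlast : w (Fin.last n) = .L) :
    w.Surjective
  | .R => ⟨0, hfirst⟩
  | .L => ⟨Fin.last n, hlast⟩

theorem wraps_succ_of_eq (hlast : w (Fin.last n) = .L) {X : Letter} {j : Fin (n + 1)}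
    (hj : w j = X) : wraps X (j + 1) = if j + 1 = Fin.last n then 1 else 0 := by
  have hzero : ¬ (X = .R ∧ j + 1 = 0) := by
    rintro ⟨rfl, h⟩
    rw [← Fin.last_add_one n, add_left_inj] at h
    simp [h, hlast] at hj
  rw [wraps, if_neg hzero, add_zero]

theorem wraps_succ_of_ne (hfirst : w 0 = .R) (hlast : w (Fin.last n) = .L) {X : Letter}
    {j : Fin (n + 1)} (hj : w j ≠ X) :
    wraps X (j + 1) = wraps X j + if j + 1 = Fin.last n then 1 else 0 := by
  have hzero : ¬ (X = .R ∧ j = 0) := by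
    rintro ⟨rfl, rfl⟩
    exact hj hfirst
  have hwrap : X = .R ∧ j + 1 = 0 ↔ j = Fin.last n := by
    rw [← Fin.last_add_one n, add_left_inj, and_iff_right_iff_imp]
    rintro rfl
    rw [hlast] at hj
    cases X <;> simp_all
  rw [wraps, wraps, if_neg hzero, if_congr hwrap rfl rfl]
  ring

theorem position_lastBefore (hfirst : w 0 = .R) (hlast : w (Fin.last n) = .L) (X : Letter)
    (j : Fin (n + 1)) :
    position (lastBefore w X j) = position j - stepsBack w X j + (n + 1) * wraps X j := by
  have hX : X ∈ Set.range w := surjective_of_first_of_last hfirst hlast X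
  induction j using cyclicWord_induction hX with
  | after j hj =>
    rw [lastBefore_succ_of_eq hj, stepsBack_succ_of_eq hj, position_succ,
      wraps_succ_of_eq hlast hj]
    push_cast
    ring
  | step j hj ih =>
    rw [lastBefore_succ_of_ne hX hj, stepsBack_succ_of_ne hX hj, ih, position_succ,
      wraps_succ_of_ne hfirst hlast hj]
    push_cast
    ring

theorem position_bottomIndex (hfirst : w 0 = .R) (hlast : w (Fin.last n) = .L)
    (j : Fin (n + 1)) :
    position (bottomIndex w j) = position j - (stepsBack w (w (j - 1)) (j - 1) + 1) +
      (n + 1) * ((if j = Fin.last n then 1 else 0) + wraps (w (j - 1)) (j - 1)) := by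
  have hsucc := position_succ (j - 1)
  rw [sub_add_cancel] at hsucc
  rw [bottomIndex, position_lastBefore hfirst hlast, hsucc]
  ring

theorem sum_wraps_mul (hfirst : w 0 = .R) (f : Fin (n + 1) → ℝ) :
    ∑ j, wraps (w (j - 1)) (j - 1) * f j = f 0 + f 1 := by
  have hzero (j : Fin (n + 1)) : w j = .R ∧ j = 0 ↔ j = 0 := by
    rw [and_iff_right_iff_imp]
    rintro rfl
    exact hfirst
  rw [← Equiv.sum_comp (Equiv.addRight (1 : Fin (n + 1)))]
  simp [wraps, add_mul, Finset.sum_add_distrib, hzero]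

/-- Half the logarithm of the exponential length of the puncture curve. -/
def logPuncture (z : Fin (n + 1) → ℝ) : ℝ :=
  Real.log (z (Fin.last n)) - Real.log (z 0) - Letter.logSq .R (z 0) - Real.log (z 1)

-- Differences of positions are numbers of steps, except across the end of the word; this exception
-- contributes the puncture length.
theorem sum_position_mul_logHolonomy (hfirst : w 0 = .R) (hlast : w (Fin.last n) = .L)
    (z : Fin (n + 1) → ℝ) :
    ∑ k, position k * logHolonomy w z k =
      -∑ j, (((stepsBack w (w (j - 1)) (j - 1) : ℝ) + 1) * Real.log (z j) +
        stepsBack w .R j * Letter.logSq .R (z j) + stepsBack w .L j * Letter.logSq .L (z j)) -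
      (n + 1) * logPuncture z := by
  have hterm (j : Fin (n + 1)) : position j * Real.log (z j) +
      position (bottomIndex w j) * Real.log (z j) +
      position (lastBefore w .R j) * Letter.logSq .R (z j) +
      position (lastBefore w .L j) * Letter.logSq .L (z j) =
      -(((stepsBack w (w (j - 1)) (j - 1) : ℝ) + 1) * Real.log (z j) +
        stepsBack w .R j * Letter.logSq .R (z j) + stepsBack w .L j * Letter.logSq .L (z j)) +
      (n + 1) * (wraps (w (j - 1)) (j - 1) * Real.log (z j) -
        (if j = Fin.last n then 1 else 0) * Real.log (z j) +
        (if j = 0 then 1 else 0) * Letter.logSq .R (z j)) := by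
    rw [position_bottomIndex hfirst hlast, position_lastBefore hfirst hlast,
      position_lastBefore hfirst hlast]
    simp only [wraps, reduceCtorEq, false_and, if_false, true_and]
    linear_combination (position j + (n + 1) * (if j = Fin.last n then (1 : ℝ) else 0)) *
      Letter.two_log_add_logSq_add_logSq (z j)
  rw [sum_mul_logHolonomy, Finset.sum_congr rfl fun j _ => hterm j, Finset.sum_add_distrib,
    Finset.sum_neg_distrib, ← Finset.mul_sum]
  simp only [Finset.sum_add_distrib, Finset.sum_sub_distrib,
    sum_wraps_mul hfirst fun j => Real.log (z j), ite_mul, one_mul, zero_mul, Finset.sum_ite_eq',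
    Finset.mem_univ, if_true, logPuncture]
  ring

end LogHolonomy

section WordSystem

variable {n : ℕ} (w : Fin (n + 1) → Letter)

/-- The coefficients of the inflow of `wordSystem` as combinations of the functions
`Letter.logParam`. -/
def inflowCoeff (i j : Fin (n + 1)) (Y : Letter) : ℝ :=
  if Y = w (j - 1) then (if j + 1 = i then 1 else 0) + (if bottomIndex w j + 1 = i then 1 else 0)
  else 2 * (if lastBefore w Y j + 1 = i then 1 else 0)

/-- The coefficients of the height of `wordSystem` as combinations of the functions
`Letter.logParam`. -/
def heightCoeff (j : Fin (n + 1)) (Y : Letter) : ℝ :=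
  if Y = w (j - 1) then stepsBack w Y (j - 1) - 1 else 2 * (stepsBack w Y j - 1)

theorem inflowCoeff_nonneg (i j : Fin (n + 1)) (Y : Letter) : 0 ≤ inflowCoeff w i j Y := by
  unfold inflowCoeff
  split_ifs <;> norm_num

theorem inflowCoeff_succ_pos {j : Fin (n + 1)} {Y : Letter} (hY : Y = w (j - 1)) :
    0 < inflowCoeff w (j + 1) j Y := by
  rw [inflowCoeff, if_pos hY, if_pos rfl]
  split_ifs <;> norm_num

theorem sum_inflowCoeff (j : Fin (n + 1)) (Y : Letter) : ∑ i, inflowCoeff w i j Y = 2 := by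
  unfold inflowCoeff
  split_ifs
  · simp [Finset.sum_add_distrib, one_add_one_eq_two]
  · simp

variable {w}

theorem heightCoeff_pos (hw : w.Surjective) {j : Fin (n + 1)} {Y : Letter} (hY : Y ≠ w (j - 1)) :
    0 < heightCoeff w j Y := by
  have hsteps := stepsBack_succ_of_ne (hw Y) hY.symm
  have hone : (1 : ℝ) ≤ stepsBack w Y (j - 1) := by exact_mod_cast one_le_stepsBack (hw Y) (j - 1)
  rw [sub_add_cancel] at hsteps
  rw [heightCoeff, if_neg hY, hsteps]
  push_cast
  linarith

theorem heightCoeff_nonneg (hw : w.Surjective) (j : Fin (n + 1)) (Y : Letter) :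
    0 ≤ heightCoeff w j Y := by
  by_cases hY : Y = w (j - 1)
  · rw [heightCoeff, if_pos hY, sub_nonneg]
    exact_mod_cast one_le_stepsBack (hw Y) (j - 1)
  · exact (heightCoeff_pos hw hY).le

/-- The balanced system that the edge equations become if the shape parameters behind each letter
are given by the coordinate `Letter.param` of this letter. -/
def wordSystem (hw : w.Surjective) : BalancedSystem n where
  inflow i j := Letter.logCombination (inflowCoeff w i j)
  heightTerm j := Letter.logCombination (heightCoeff w j)
  contDiff_inflow _ _ := Letter.contDiff_logCombination _
  contDiff_heightTerm _ := Letter.contDiff_logCombination _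
  deriv_inflow_nonneg i j := Letter.deriv_logCombination_nonneg (inflowCoeff_nonneg w i j)
  deriv_inflow_succ_pos j := Letter.deriv_logCombination_pos (inflowCoeff_nonneg w _ j)
    (inflowCoeff_succ_pos w rfl)
  deriv_heightTerm_pos j := Letter.deriv_logCombination_pos (heightCoeff_nonneg hw j)
    (heightCoeff_pos hw (w (j - 1)).other_ne)
  sum_inflow j t := by
    simp only [Letter.logCombination, Finset.sum_add_distrib, ← Finset.sum_mul,
      sum_inflowCoeff, ← mul_add, Letter.logParam_R_add_logParam_L]
  exists_heightTerm_atTop := by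
    obtain ⟨i, hi⟩ := hw .L
    exact ⟨i + 1, Letter.tendsto_logCombination_atTop (heightCoeff_nonneg hw _ _)
      (heightCoeff_pos hw (by simp [hi]))⟩
  exists_heightTerm_atBot := by
    obtain ⟨i, hi⟩ := hw .R
    exact ⟨i + 1, Letter.tendsto_logCombination_atBot (heightCoeff_nonneg hw _ _)
      (heightCoeff_pos hw (by simp [hi]))⟩
  tendsto_atTop j := by
    by_cases hj : Letter.R = w (j - 1)
    · exact .inr (Letter.tendsto_logCombination_atTop (inflowCoeff_nonneg w _ j _)
        (inflowCoeff_succ_pos w hj))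
    · exact .inl (Letter.tendsto_logCombination_atTop (heightCoeff_nonneg hw _ _)
        (heightCoeff_pos hw hj))
  tendsto_atBot j := by
    by_cases hj : Letter.L = w (j - 1)
    · exact .inr (Letter.tendsto_logCombination_atBot (inflowCoeff_nonneg w _ j _)
        (inflowCoeff_succ_pos w hj))
    · exact .inl (Letter.tendsto_logCombination_atBot (heightCoeff_nonneg hw _ _)
        (heightCoeff_pos hw hj))

variable (w) in
/-- The shape parameters as functions of the coordinates of `wordSystem`. -/
def wordParam (x : Fin (n + 1) → ℝ) : Fin (n + 1) → ℝ := fun j => (w (j - 1)).param (x j)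

variable (hw : w.Surjective)

theorem logHolonomy_wordParam (x : Fin (n + 1) → ℝ) (k : Fin (n + 1)) :
    logHolonomy w (wordParam w x) k = (wordSystem hw).flow x (k + 1) := by
  have hterm (j : Fin (n + 1)) : (if j = k then Real.log (wordParam w x j) else 0) +
      (if bottomIndex w j = k then Real.log (wordParam w x j) else 0) +
      (if lastBefore w .R j = k then Letter.logSq .R (wordParam w x j) else 0) +
      (if lastBefore w .L j = k then Letter.logSq .L (wordParam w x j) else 0) =
      (if j = k + 1 then -2 * x j else 0) + (wordSystem hw).inflow (k + 1) j (x j) := by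
    obtain ⟨i, rfl⟩ : ∃ i, j = i + 1 := ⟨j - 1, by simp⟩
    have hlast := lastBefore_succ_of_eq (w := w) (j := i) rfl
    have hself := (w i).logSq_param_self (x (i + 1))
    simp only [wordParam, wordSystem, Letter.logCombination, inflowCoeff, add_sub_cancel_right,
      add_left_inj]
    rcases hX : w i with _ | _
    all_goals
      rw [hX] at hlast hself
      rw [hlast, hself, Letter.logSq_param_of_ne (by simp)]
      simp only [Letter.logParam, reduceCtorEq, if_true, if_false]
      split_ifs <;> ring
  rw [logHolonomy, Finset.sum_congr rfl fun j _ => hterm j, Finset.sum_add_distrib,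
    Finset.sum_ite_eq', if_pos (Finset.mem_univ _), BalancedSystem.flow]

theorem heightTerm_wordSystem (x : Fin (n + 1) → ℝ) (j : Fin (n + 1)) :
    (wordSystem hw).heightTerm j (x j) =
      ((stepsBack w (w (j - 1)) (j - 1) : ℝ) + 1) * Real.log (wordParam w x j) +
        stepsBack w .R j * Letter.logSq .R (wordParam w x j) +
        stepsBack w .L j * Letter.logSq .L (wordParam w x j) := by
  obtain ⟨i, rfl⟩ : ∃ i, j = i + 1 := ⟨j - 1, by simp⟩
  have hsteps := stepsBack_succ_of_eq (w := w) (j := i) rfl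
  have hself := (w i).logSq_param_self (x (i + 1))
  have hlog := Letter.logParam_R_add_logParam_L (x (i + 1))
  simp only [wordParam, wordSystem, Letter.logCombination, heightCoeff, add_sub_cancel_right]
  rcases hX : w i with _ | _
  all_goals
    rw [hX] at hsteps hself
    rw [hsteps, hself, Letter.logSq_param_of_ne (by simp), ← Letter.logParam]
    simp only [reduceCtorEq, if_true, if_false]
    push_cast
    linear_combination -2 * hlog

theorem height_wordSystem (hfirst : w 0 = .R) (hlast : w (Fin.last n) = .L)
    {x : Fin (n + 1) → ℝ} (hx : x ∈ (wordSystem hw).solutions) :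
    (wordSystem hw).height x = -((n + 1) * logPuncture (wordParam w x)) := by
  have hsum := sum_position_mul_logHolonomy hfirst hlast (wordParam w x)
  have hzero : (wordSystem hw).flow x = 0 := hx
  simp only [logHolonomy_wordParam hw, hzero, Pi.zero_apply, mul_zero, Finset.sum_const_zero]
    at hsum
  rw [BalancedSystem.height, Finset.sum_congr rfl fun j _ => heightTerm_wordSystem hw x j]
  linarith

end WordSystem

/-! ### The puncture curve -/

theorem IdealTriangulation.curveLength_append {T : Type} (𝒯 : IdealTriangulation T) (z : T → ℝ)
    (a : Segment T) (l l' : List Turn) : 𝒯.curveLength z a (l ++ l') =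
      𝒯.curveLength z a l * 𝒯.curveLength z (l.foldl 𝒯.next a) l' := by
  induction l generalizing a with
  | nil => simp [curveLength]
  | cons m l ih => simp [curveLength, ih, mul_assoc]

theorem segmentLength_eq {T : Type} (z : T → ℝ) (t : T) {π : Equiv.Perm (Fin 4)} {κ : EdgeKind}
    {ε : ℤˣ} (hκ : EdgeKind.of {π 0, π 1} = κ) (hε : Equiv.Perm.sign π = ε) :
    segmentLength z (t, π) = κ.param (z t) ^ (ε : ℤ) := by
  rw [segmentLength, edgeParam_eq_param, hκ, hε]

section Puncture

variable {n : ℕ} {w : Fin (n + 1) → Letter} {s : ℤˣ}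

theorem next_of_two_le {k : Fin (n + 1)} {π : Equiv.Perm (Fin 4)} (hπ : 2 ≤ π 2) (m : Turn) :
    (monodromyTriangulation w s).next (k, π) m =
      (k + 1, (if s = -1 ∧ k = Fin.last n then halfTurn else 1) * (w k).layerPerm (π 2) * π *
        m.shift) := by
  simp only [IdealTriangulation.next, monodromyTriangulation, monoNbr, monoPerm, monoLetter,
    IsSeam, if_pos hπ]

theorem next_of_not_two_le {k : Fin (n + 1)} {π : Equiv.Perm (Fin 4)} (hπ : ¬ 2 ≤ π 2)
    (m : Turn) :
    (monodromyTriangulation w s).next (k + 1, π) m =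
      (k, (if s = -1 ∧ k = Fin.last n then halfTurn else 1) * (w k).layerPerm (π 2) * π *
        m.shift) := by
  have hseam : k + 1 = 0 ↔ k = Fin.last n := by rw [← Fin.last_add_one n, add_left_inj]
  simp only [IdealTriangulation.next, monodromyTriangulation, monoNbr, monoPerm, monoLetter,
    IsSeam, if_neg hπ, add_sub_cancel_right, hseam]

theorem exists_next_around_puncture (hfirst : w 0 = .R) (hlast : w (Fin.last n) = .L) (s : ℤˣ) :
    ∃ g : Equiv.Perm (Fin 4), (g = 1 ∨ g = halfTurn) ∧
    (∀ π m, 2 ≤ π 2 → (monodromyTriangulation w s).next (Fin.last n, π) m =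
      (0, g * Letter.L.layerPerm (π 2) * π * m.shift)) ∧
    (∀ π m, ¬ 2 ≤ π 2 → (monodromyTriangulation w s).next (0, π) m =
      (Fin.last n, g * Letter.L.layerPerm (π 2) * π * m.shift)) ∧
    (∀ π m, 2 ≤ π 2 → (monodromyTriangulation w s).next (0, π) m =
      (1, Letter.R.layerPerm (π 2) * π * m.shift)) ∧
    ∀ π m, ¬ 2 ≤ π 2 → (monodromyTriangulation w s).next (1, π) m =
      (0, Letter.R.layerPerm (π 2) * π * m.shift) := by
  have hne : (0 : Fin (n + 1)) ≠ Fin.last n := fun h => by simp [← h, hfirst] at hlast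
  refine ⟨if s = -1 then halfTurn else 1, (ite_eq_or_eq _ _ _).symm, fun π m hπ => ?_,
    fun π m hπ => ?_, fun π m hπ => ?_, fun π m hπ => ?_⟩
  · simp [next_of_two_le hπ, hlast]
  · rw [← Fin.last_add_one n, next_of_not_two_le hπ]
    simp [hlast]
  · simp [next_of_two_le hπ, hfirst, hne]
  · simpa [hfirst, hne] using next_of_not_two_le (w := w) (s := s) (k := 0) hπ m

theorem foldl_next_half_puncture (hfirst : w 0 = .R) (hlast : w (Fin.last n) = .L)
    {π : Equiv.Perm (Fin 4)} (hπ : π = 1 ∨ π = halfTurn) :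
    [.same, .switch, .same, .switch].foldl (monodromyTriangulation w s).next (Fin.last n, π) =
      (Fin.last n, halfTurn * π) := by
  obtain ⟨g, hg, up, down, up', down'⟩ := exists_next_around_puncture hfirst hlast s
  rcases hg with rfl | rfl <;> rcases hπ with rfl | rfl
  all_goals
    rw [List.foldl, up _ _ (by decide), List.foldl, up' _ _ (by decide), List.foldl,
      down' _ _ (by decide), List.foldl, down _ _ (by decide), List.foldl]
    refine congrArg (Prod.mk _) ?_
    decide

theorem curveLength_half_puncture (hfirst : w 0 = .R) (hlast : w (Fin.last n) = .L)
    (z : Fin (n + 1) → ℝ) {π : Equiv.Perm (Fin 4)} (hπ : π = 1 ∨ π = halfTurn) :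
    (monodromyTriangulation w s).curveLength z (Fin.last n, π) [.same, .switch, .same, .switch] =
      z (Fin.last n) * ((z 0 - 1) / z 0) * (z 1)⁻¹ * (1 / (1 - z 0))⁻¹ := by
  obtain ⟨g, hg, up, -, up', down'⟩ := exists_next_around_puncture hfirst hlast s
  simp only [IdealTriangulation.curveLength]
  rcases hg with rfl | rfl <;> rcases hπ with rfl | rfl
  all_goals
    rw [up _ _ (by decide), up' _ _ (by decide), down' _ _ (by decide),
      segmentLength_eq z _ (κ := .top) (ε := 1) (by decide) (by decide),
      segmentLength_eq z _ (κ := .side .L) (ε := 1) (by decide) (by decide),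
      segmentLength_eq z _ (κ := .bottom) (ε := -1) (by decide) (by decide),
      segmentLength_eq z _ (κ := .side .R) (ε := -1) (by decide) (by decide)]
    simp only [EdgeKind.param, Units.val_one, Units.val_neg, zpow_one, zpow_neg, mul_one,
      mul_assoc]

theorem punctureLength_eq (hfirst : w 0 = .R) (hlast : w (Fin.last n) = .L) (s : ℤˣ)
    (z : Fin (n + 1) → ℝ) : punctureLength w s z =
    (z (Fin.last n) * ((z 0 - 1) / z 0) * (z 1)⁻¹ * (1 / (1 - z 0))⁻¹) ^ 2 := by
  have hturns : punctureTurns =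
      [.same, .switch, .same, .switch] ++ [.same, .switch, .same, .switch] := rfl
  rw [punctureLength, hturns, IdealTriangulation.curveLength_append, punctureStart,
    foldl_next_half_puncture hfirst hlast (.inl rfl),
    curveLength_half_puncture hfirst hlast z (.inl rfl),
    curveLength_half_puncture hfirst hlast z (.inr (mul_one _)), sq]

variable {z : Fin (n + 1) → ℝ}

theorem punctureLength_pos (hfirst : w 0 = .R) (hlast : w (Fin.last n) = .L) (hzero : ∀ j, z j ≠ 0)
    (hone : ∀ j, z j ≠ 1) (s : ℤˣ) : 0 < punctureLength w s z := by
  have hlast_ne := hzero (Fin.last n)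
  have h0_ne := hzero 0
  have h1_ne := hzero 1
  have hsub : z 0 - 1 ≠ 0 := sub_ne_zero.2 (hone 0)
  have hsub' : 1 - z 0 ≠ 0 := sub_ne_zero.2 (hone 0).symm
  rw [punctureLength_eq hfirst hlast]
  positivity

theorem log_punctureLength (hfirst : w 0 = .R) (hlast : w (Fin.last n) = .L) (hzero : ∀ j, z j ≠ 0)
    (hone : ∀ j, z j ≠ 1) (s : ℤˣ) :
    Real.log (punctureLength w s z) = 2 * logPuncture z := by
  have hlast_ne := hzero (Fin.last n)
  have h0_ne := hzero 0
  have h1_ne := hzero 1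
  have hsub : z 0 - 1 ≠ 0 := sub_ne_zero.2 (hone 0)
  have hsub' : 1 - z 0 ≠ 0 := sub_ne_zero.2 (hone 0).symm
  rw [punctureLength_eq hfirst hlast, Real.log_pow,
    Real.log_mul (by positivity) (by positivity), Real.log_mul (by positivity) (by positivity),
    Real.log_mul (by positivity) (by positivity), Real.log_div hsub h0_ne, Real.log_inv,
    Real.log_inv, one_div, Real.log_inv, ← Real.log_neg_eq_log (z 0 - 1), neg_sub, logPuncture,
    Letter.logSq]
  push_cast
  ring

end Puncture

/-! ### Reversing a word -/

theorem Letter.other_other (X : Letter) : X.other.other = X := by cases X <;> rfl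

theorem Letter.logSq_inv (X : Letter) {z : ℝ} (hzero : z ≠ 0) (hone : z ≠ 1) :
    X.logSq z⁻¹ = -X.other.logSq z := by
  have hlog : Real.log (1 - z⁻¹) = Real.log (1 - z) - Real.log z := by
    rw [← Real.log_div (sub_ne_zero.2 hone.symm) hzero, ← Real.log_neg_eq_log]
    congr 1
    field_simp
    ring
  cases X <;> simp only [logSq, other, hlog, Real.log_inv] <;> ring

section Reverse

variable {n : ℕ} (w : Fin (n + 1) → Letter)

/-- The word read backwards, with the letters exchanged. -/
def reverseWord (i : Fin (n + 1)) : Letter := (w (-(i + 1))).other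

variable {w}

theorem reverseWord_neg_succ (j : Fin (n + 1)) : reverseWord w (-(j + 1)) = (w j).other := by
  simp [reverseWord]

theorem reverseWord_eq_iff {i : Fin (n + 1)} {X : Letter} :
    reverseWord w i = X ↔ w (-(i + 1)) = X.other := by
  rw [reverseWord]
  exact ⟨fun h => by rw [← h, Letter.other_other], fun h => by rw [h, Letter.other_other]⟩

theorem mem_range_reverseWord {X : Letter} (hX : X.other ∈ Set.range w) :
    X ∈ Set.range (reverseWord w) := by
  obtain ⟨i, hi⟩ := hX
  exact ⟨-(i + 1), by rw [reverseWord_neg_succ, hi, Letter.other_other]⟩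

theorem reverseWord_surjective (hw : w.Surjective) : (reverseWord w).Surjective :=
  fun X => mem_range_reverseWord (hw X.other)

theorem bottomIndex_neg_lastBefore_reverseWord {X : Letter} (hX : X.other ∈ Set.range w)
    (i : Fin (n + 1)) :
    bottomIndex w (-(lastBefore (reverseWord w) X i)) = lastBefore w X.other (-i) := by
  have hX' := mem_range_reverseWord hX
  have hshift (i : Fin (n + 1)) : -(i + 1) + 1 = -i := by abel
  induction i using cyclicWord_induction hX' with
  | after i hi =>
    rw [lastBefore_succ_of_eq hi, ← hshift, bottomIndex_succ, reverseWord_eq_iff.1 hi]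
  | step i hi ih =>
    rw [lastBefore_succ_of_ne hX' hi, ih, ← hshift,
      lastBefore_succ_of_ne hX (mt reverseWord_eq_iff.2 hi)]

theorem bottomIndex_neg_bottomIndex_reverseWord (i : Fin (n + 1)) :
    bottomIndex w (-(bottomIndex (reverseWord w) i)) = -i := by
  obtain ⟨j, rfl⟩ : ∃ j, i = -(j + 1) + 1 := ⟨-i, by abel⟩
  have hj : (reverseWord w (-(j + 1))).other = w j := by
    rw [reverseWord_neg_succ, Letter.other_other]
  rw [bottomIndex_succ, bottomIndex_neg_lastBefore_reverseWord (hj ▸ Set.mem_range_self j), hj,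
    neg_neg, lastBefore_succ_of_eq rfl]
  abel

theorem bottomIndex_bijective : Function.Bijective (bottomIndex w) :=
  Function.Surjective.bijective_of_finite fun j => ⟨-(bottomIndex (reverseWord w) (-j)), by
    rw [bottomIndex_neg_bottomIndex_reverseWord, neg_neg]⟩

theorem logHolonomy_reverseWord (hw : w.Surjective) {z : Fin (n + 1) → ℝ} (hzero : ∀ j, z j ≠ 0)
    (hone : ∀ j, z j ≠ 1) (k : Fin (n + 1)) :
    logHolonomy (reverseWord w) (fun i => (z (-i))⁻¹) k =
      -logHolonomy w z (bottomIndex w (-k)) := by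
  have hinj (i j : Fin (n + 1)) : bottomIndex w (-i) = bottomIndex w (-j) ↔ i = j := by
    rw [bottomIndex_bijective.1.eq_iff, neg_inj]
  rw [logHolonomy, logHolonomy, ← Finset.sum_neg_distrib,
    ← Equiv.sum_comp (Equiv.neg (Fin (n + 1))) (fun j => -(_ + _ + _ + _))]
  refine Finset.sum_congr rfl fun i _ => ?_
  have hbottom : -i = bottomIndex w (-k) ↔ bottomIndex (reverseWord w) i = k := by
    rw [← bottomIndex_neg_bottomIndex_reverseWord, hinj]
  have hside (X : Letter) : lastBefore w X.other (-i) = bottomIndex w (-k) ↔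
      lastBefore (reverseWord w) X i = k := by
    rw [← bottomIndex_neg_lastBefore_reverseWord (hw _), hinj]
  have hR := hside .L
  have hL := hside .R
  simp only [Letter.other] at hR hL
  simp only [Equiv.neg_apply, hbottom, hR, hL, hinj, Letter.logSq_inv _ (hzero _) (hone _),
    Letter.other, Real.log_inv]
  split_ifs <;> ring

theorem logPuncture_inv_neg {z : Fin (n + 1) → ℝ} (hzero : z 0 ≠ 0) (hone : z 0 ≠ 1) :
    logPuncture (fun i => (z (-i))⁻¹) = logPuncture z := by
  have hlast : -Fin.last n = 1 := by rw [neg_eq_iff_add_eq_zero, Fin.last_add_one]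
  have hneg : (-1 : Fin (n + 1)) = Fin.last n := by rw [← hlast, neg_neg]
  simp only [logPuncture, hlast, hneg, neg_zero, Letter.logSq_inv _ hzero hone, Real.log_inv,
    Letter.other]
  linarith [Letter.two_log_add_logSq_add_logSq (z 0)]

end Reverse

/-! ### Curves of shape parameters -/

theorem isEmbedding_of_deriv_pos {ι : Type*} [Finite ι] {f : ℝ → ι → ℝ} {ε : ℝ} (i : ι)
    (hf : Differentiable ℝ f) (hpos : ∀ t, 0 < ε * deriv f t i) : Topology.IsEmbedding f := by
  have := Fintype.ofFinite ι
  have hcont : Continuous fun x : ι → ℝ => ε * x i := by fun_prop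
  have hmono : StrictMono ((fun x : ι → ℝ => ε * x i) ∘ f) :=
    strictMono_of_hasDerivAt_pos
      (fun t => (hasDerivAt_pi.1 (hf t).hasDerivAt i).const_mul ε) hpos
  exact .of_comp hf.continuous hcont <| hmono.isEmbedding_of_ordConnected
    (isPreconnected_range (hcont.comp hf.continuous)).ordConnected

section

variable {n : ℕ} {w : Fin (n + 1) → Letter}

theorem differentiableAt_edgeHolonomy (s : ℤˣ) (hw : w.Surjective) {z : Fin (n + 1) → ℝ}
    (hzero : ∀ j, z j ≠ 0) (hone : ∀ j, z j ≠ 1) (k : Fin (n + 1)) :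
    DifferentiableAt ℝ
      (fun y => (monodromyTriangulation w s).edgeHolonomy y (topEdge w s k)) z := by
  simp only [edgeHolonomy_topEdge s hw]
  refine (HasFDerivAt.finsetProd fun j _ => DifferentiableAt.hasFDerivAt ?_).differentiableAt
  have hsub : 1 - z j ≠ 0 := sub_ne_zero.2 (hone j).symm
  have hite (p : Prop) [Decidable p] {f : (Fin (n + 1) → ℝ) → ℝ} (hf : DifferentiableAt ℝ f z) :
      DifferentiableAt ℝ (fun y => if p then f y else 1) z := by
    split_ifs
    · exact hf
    · exact differentiableAt_const _
  have hj : DifferentiableAt ℝ (fun y : Fin (n + 1) → ℝ => y j) z := differentiableAt_apply j z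
  have hR : DifferentiableAt ℝ (fun y : Fin (n + 1) → ℝ => 1 / (1 - y j)) z := by
    fun_prop (disch := exact hsub)
  have hL : DifferentiableAt ℝ (fun y : Fin (n + 1) → ℝ => (y j - 1) / y j) z := by
    fun_prop (disch := exact hzero j)
  exact (((hite _ hj).fun_mul (hite _ hj)).fun_mul ((hite _ hR).fun_pow 2)).fun_mul
    ((hite _ hL).fun_pow 2)

/-- `V` is a smooth curve of shape parameters, parameterized by the signed length of the puncture
curve, with a positive tangent vector at each point. -/
structure IsPunctureCurve (w : Fin (n + 1) → Letter) (s : ℤˣ) (V : Set (Fin (n + 1) → ℝ)) :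
    Prop where
  punctureLength_pos : ∀ z ∈ V, 0 < punctureLength w s z
  exists_pos_tangent : ∀ z ∈ V, ∃ v ∈ (monodromyTriangulation w s).tangentSpace z, ∀ k, 0 < v k
  exists_parameterization : ∃ γ : ℝ → Fin (n + 1) → ℝ,
    ContDiff ℝ ∞ γ ∧ Topology.IsEmbedding γ ∧ Set.range γ = V ∧
    (∀ t, deriv γ t ≠ 0) ∧
    (∀ t, (monodromyTriangulation w s).tangentSpace (γ t) = Submodule.span ℝ {deriv γ t}) ∧
    ∀ t, Real.log (punctureLength w s (γ t)) = t

end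

/-- A parameterization of shape parameters by the unknowns of a balanced system which turns the
edge equations into those of the system and the length of the puncture curve into the height. The
shape parameter `j` is a function `coord j` of the unknown `index j`, increasing if `orient` is
positive and decreasing if it is negative. -/
structure ShapeChart {n : ℕ} (w : Fin (n + 1) → Letter) (B : BalancedSystem n) where
  coord : Fin (n + 1) → ℝ → ℝ
  index : Equiv.Perm (Fin (n + 1))
  orient : ℝ
  edge : Fin (n + 1) → Fin (n + 1)
  sgn : ℝ
  scale : ℝ
  contDiff_coord : ∀ j, ContDiff ℝ ∞ (coord j)
  orient_mul_deriv_pos : ∀ j x, 0 < orient * deriv (coord j) x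
  coord_pos : ∀ j x, 0 < coord j x
  coord_ne_one : ∀ j x, coord j x ≠ 1
  edge_surjective : Function.Surjective edge
  sgn_ne_zero : sgn ≠ 0
  scale_ne_zero : scale ≠ 0
  logHolonomy_eq : ∀ x k,
    logHolonomy w (fun j => coord j (x (index j))) (edge k) = sgn * B.flow x k
  height_eq : ∀ x ∈ B.solutions,
    B.height x = scale * logPuncture (fun j => coord j (x (index j)))

namespace ShapeChart

variable {n : ℕ} {w : Fin (n + 1) → Letter} {B : BalancedSystem n} (C : ShapeChart w B)

/-- The shape parameters with the given coordinates. -/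
def shape (x : Fin (n + 1) → ℝ) : Fin (n + 1) → ℝ := fun j => C.coord j (x (C.index j))

theorem shape_pos (x : Fin (n + 1) → ℝ) (j : Fin (n + 1)) : 0 < C.shape x j := C.coord_pos j _

theorem shape_ne_one (x : Fin (n + 1) → ℝ) (j : Fin (n + 1)) : C.shape x j ≠ 1 :=
  C.coord_ne_one j _

theorem contDiff_shape : ContDiff ℝ ∞ C.shape :=
  contDiff_pi.2 fun j => (C.contDiff_coord j).comp (contDiff_apply ℝ ℝ (C.index j))

theorem hasFDerivAt_shape (x : Fin (n + 1) → ℝ) : HasFDerivAt C.shape (fderiv ℝ C.shape x) x :=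
  (C.contDiff_shape.differentiable (by simp) x).hasFDerivAt

theorem fderiv_shape_apply (x v : Fin (n + 1) → ℝ) (j : Fin (n + 1)) :
    fderiv ℝ C.shape x v j = deriv (C.coord j) (x (C.index j)) * v (C.index j) := by
  have hcoord := ((C.contDiff_coord j).differentiable (by simp) (x (C.index j))).hasDerivAt
  have h := (hasFDerivAt_pi'.1 (C.hasFDerivAt_shape x) j).unique
    (hcoord.comp_hasFDerivAt x (hasFDerivAt_apply (C.index j) x))
  exact congr($h v)

theorem deriv_coord_ne_zero (j : Fin (n + 1)) (x : ℝ) : deriv (C.coord j) x ≠ 0 :=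
  right_ne_zero_of_mul (C.orient_mul_deriv_pos j x).ne'

theorem fderiv_shape_bijective (x : Fin (n + 1) → ℝ) :
    Function.Bijective (fderiv ℝ C.shape x) := by
  refine ⟨(injective_iff_map_eq_zero _).2 fun v hv => funext fun i => ?_, fun u =>
    ⟨fun i => u (C.index.symm i) / deriv (C.coord (C.index.symm i)) (x i), funext fun j => ?_⟩⟩
  · have h := congrFun hv (C.index.symm i)
    rw [fderiv_shape_apply, Equiv.apply_symm_apply] at h
    exact (mul_eq_zero.1 h).resolve_left (C.deriv_coord_ne_zero _ _)
  · rw [fderiv_shape_apply, Equiv.symm_apply_apply, mul_div_cancel₀ _ (C.deriv_coord_ne_zero _ _)]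

theorem edgeHolonomy_shape (s : ℤˣ) (hw : w.Surjective) (x : Fin (n + 1) → ℝ) (i : Fin (n + 1)) :
    (monodromyTriangulation w s).edgeHolonomy (C.shape x) (topEdge w s (C.edge i)) =
      Real.exp (C.sgn * B.flow x i) := by
  rw [edgeHolonomy_eq_exp s hw (C.shape_pos x) (C.shape_ne_one x), ← C.logHolonomy_eq]
  rfl

theorem fderiv_edgeHolonomy_shape (s : ℤˣ) (hw : w.Surjective) {x : Fin (n + 1) → ℝ}
    (hx : x ∈ B.solutions) (v : Fin (n + 1) → ℝ) (i : Fin (n + 1)) :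
    fderiv ℝ (fun z => (monodromyTriangulation w s).edgeHolonomy z (topEdge w s (C.edge i)))
      (C.shape x) (fderiv ℝ C.shape x v) = C.sgn * fderiv ℝ B.flow x v i := by
  have hcomp := (differentiableAt_edgeHolonomy s hw (fun j => (C.shape_pos x j).ne')
    (C.shape_ne_one x) (C.edge i)).hasFDerivAt.comp x (C.hasFDerivAt_shape x)
  simp only [Function.comp_def, C.edgeHolonomy_shape s hw] at hcomp
  have hexp := ((hasFDerivAt_pi'.1 (B.differentiable_flow x).hasFDerivAt i).const_mul C.sgn).exp
  have hflow : B.flow x = 0 := hx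
  simpa [hflow] using congr($(hcomp.unique hexp) v)

theorem fderiv_shape_mem_tangentSpace_iff (s : ℤˣ) (hw : w.Surjective) {x : Fin (n + 1) → ℝ}
    (hx : x ∈ B.solutions) (v : Fin (n + 1) → ℝ) :
    fderiv ℝ C.shape x v ∈ (monodromyTriangulation w s).tangentSpace (C.shape x) ↔
      fderiv ℝ B.flow x v = 0 := by
  have hsurj : Function.Surjective fun i => topEdge w s (C.edge i) :=
    (topEdge_surjective s hw).comp C.edge_surjective
  rw [IdealTriangulation.tangentSpace, Submodule.mem_iInf, hsurj.forall, funext_iff]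
  refine forall_congr' fun i => ?_
  change fderiv ℝ _ (C.shape x) (fderiv ℝ C.shape x v) = 0 ↔ _
  rw [C.fderiv_edgeHolonomy_shape s hw hx, mul_eq_zero, or_iff_right C.sgn_ne_zero]
  rfl

theorem log_punctureLength_shape (s : ℤˣ) (hfirst : w 0 = .R) (hlast : w (Fin.last n) = .L)
    {x : Fin (n + 1) → ℝ} (hx : x ∈ B.solutions) :
    Real.log (punctureLength w s (C.shape x)) = 2 * (B.height x / C.scale) := by
  rw [log_punctureLength hfirst hlast (fun j => (C.shape_pos x j).ne') (C.shape_ne_one x),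
    C.height_eq x hx, mul_div_cancel_left₀ _ C.scale_ne_zero]
  rfl

theorem tangentSpace_shape (s : ℤˣ) (hw : w.Surjective) {x u : Fin (n + 1) → ℝ}
    (hx : x ∈ B.solutions) (hker : ∀ v, fderiv ℝ B.flow x v = 0 ↔ v ∈ Submodule.span ℝ {u}) :
    (monodromyTriangulation w s).tangentSpace (C.shape x) =
      Submodule.span ℝ {fderiv ℝ C.shape x u} := by
  ext y
  obtain ⟨v, rfl⟩ := (C.fderiv_shape_bijective x).2 y
  rw [C.fderiv_shape_mem_tangentSpace_iff s hw hx, hker, Submodule.mem_span_singleton,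
    Submodule.mem_span_singleton]
  simp only [← map_smul, (C.fderiv_shape_bijective x).1.eq_iff]

theorem orient_mul_fderiv_shape_pos (x : Fin (n + 1) → ℝ) {v : Fin (n + 1) → ℝ}
    (hv : ∀ j, 0 < v j) (j : Fin (n + 1)) : 0 < C.orient * fderiv ℝ C.shape x v j := by
  rw [fderiv_shape_apply, ← mul_assoc]
  exact mul_pos (C.orient_mul_deriv_pos j _) (hv _)

/-- The image in shape parameters of a curve of unknowns, with the time rescaled such that a curve
parameterized by height becomes parameterized by the length of the puncture curve. -/
def shapeCurve (γ : ℝ → Fin (n + 1) → ℝ) (t : ℝ) : Fin (n + 1) → ℝ :=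
  C.shape (γ (C.scale / 2 * t))

theorem half_scale_ne_zero : C.scale / 2 ≠ 0 := div_ne_zero C.scale_ne_zero two_ne_zero

section Curve

variable {γ : ℝ → Fin (n + 1) → ℝ}

theorem range_shapeCurve : Set.range (C.shapeCurve γ) = C.shape '' Set.range γ := by
  rw [← Set.range_comp]
  exact (mul_left_surjective₀ C.half_scale_ne_zero).range_comp (C.shape ∘ γ)

theorem contDiff_shapeCurve (hγ : ContDiff ℝ ∞ γ) : ContDiff ℝ ∞ (C.shapeCurve γ) :=
  C.contDiff_shape.comp (hγ.comp (contDiff_const.mul contDiff_id))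

theorem deriv_shapeCurve (hγ : ContDiff ℝ ∞ γ) (t : ℝ) : deriv (C.shapeCurve γ) t =
    (C.scale / 2) • fderiv ℝ C.shape (γ (C.scale / 2 * t)) (deriv γ (C.scale / 2 * t)) := by
  have hscale : HasDerivAt (fun t : ℝ => C.scale / 2 * t) (C.scale / 2) t := by
    simpa using (hasDerivAt_id t).const_mul (C.scale / 2)
  have hγt := (hγ.differentiable (by simp) (C.scale / 2 * t)).hasDerivAt.scomp t hscale
  rw [← map_smul]
  exact ((C.hasFDerivAt_shape _).comp_hasDerivAt t hγt).deriv

theorem isEmbedding_shapeCurve (hγ : ContDiff ℝ ∞ γ) (hpos : ∀ t j, 0 < deriv γ t j) :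
    Topology.IsEmbedding (C.shapeCurve γ) := by
  refine isEmbedding_of_deriv_pos (ε := C.orient * (C.scale / 2)) 0
    ((C.contDiff_shapeCurve hγ).differentiable (by simp)) fun t => ?_
  have h := mul_pos (mul_self_pos.2 C.half_scale_ne_zero)
    (C.orient_mul_fderiv_shape_pos (γ (C.scale / 2 * t)) (hpos (C.scale / 2 * t)) 0)
  rw [C.deriv_shapeCurve hγ, Pi.smul_apply, smul_eq_mul]
  linarith

theorem deriv_shapeCurve_ne_zero (hγ : ContDiff ℝ ∞ γ) (hpos : ∀ t j, 0 < deriv γ t j) (t : ℝ) :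
    deriv (C.shapeCurve γ) t ≠ 0 := by
  rw [C.deriv_shapeCurve hγ]
  refine smul_ne_zero C.half_scale_ne_zero fun h => ?_
  simpa [h] using
    C.orient_mul_fderiv_shape_pos (γ (C.scale / 2 * t)) (hpos (C.scale / 2 * t)) 0

end Curve

theorem isPunctureCurve (s : ℤˣ) (hfirst : w 0 = .R) (hlast : w (Fin.last n) = .L)
    (hne : B.solutions.Nonempty) : IsPunctureCurve w s (C.shape '' B.solutions) := by
  have hw : w.Surjective := surjective_of_first_of_last hfirst hlast
  obtain ⟨γ, hγ, hrange, hheight, hpos, hker⟩ := B.exists_curve hne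
  have hmem (t : ℝ) : γ t ∈ B.solutions := hrange ▸ Set.mem_range_self t
  have htangent (t : ℝ) := C.tangentSpace_shape s hw (hmem t) (hker t)
  refine ⟨?_, ?_, C.shapeCurve γ, C.contDiff_shapeCurve hγ, C.isEmbedding_shapeCurve hγ hpos,
    hrange ▸ C.range_shapeCurve, C.deriv_shapeCurve_ne_zero hγ hpos, fun t => ?_, fun t => ?_⟩
  · rintro _ ⟨x, -, rfl⟩
    exact punctureLength_pos hfirst hlast (fun j => (C.shape_pos x j).ne') (C.shape_ne_one x) s
  · rw [← hrange]
    rintro _ ⟨_, ⟨t, rfl⟩, rfl⟩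
    refine ⟨C.orient • fderiv ℝ C.shape (γ t) (deriv γ t), Submodule.smul_mem _ _ ?_,
      C.orient_mul_fderiv_shape_pos _ (hpos t)⟩
    exact htangent t ▸ Submodule.mem_span_singleton_self _
  · rw [C.deriv_shapeCurve hγ, Submodule.span_singleton_smul_eq C.half_scale_ne_zero.isUnit]
    exact htangent _
  · rw [shapeCurve, C.log_punctureLength_shape s hfirst hlast (hmem _), hheight]
    field_simp [C.scale_ne_zero]

end ShapeChart

theorem Letter.other_param (X : Letter) (x : ℝ) : X.other.param x = (X.param (-x))⁻¹ := by
  cases X <;> simp [other, param, Real.sigmoid_def]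

section Charts

variable {n : ℕ} {w : Fin (n + 1) → Letter}

/-- The chart for shape parameters which are greater than `1` behind the letters `R` and less than
`1` behind the letters `L`. -/
def plusChart (hfirst : w 0 = .R) (hlast : w (Fin.last n) = .L) :
    ShapeChart w (wordSystem (surjective_of_first_of_last hfirst hlast)) where
  coord j := (w (j - 1)).param
  index := 1
  orient := 1
  edge k := k - 1
  sgn := 1
  scale := -(n + 1)
  contDiff_coord _ := Letter.contDiff_param _
  orient_mul_deriv_pos _ x := by simpa only [one_mul] using Letter.deriv_param_pos _ x
  coord_pos _ x := Letter.param_pos _ x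
  coord_ne_one _ x := (Letter.inRange_param _ x).ne_one
  edge_surjective k := ⟨k + 1, add_sub_cancel_right k 1⟩
  sgn_ne_zero := one_ne_zero
  scale_ne_zero := neg_ne_zero.2 n.cast_add_one_ne_zero
  logHolonomy_eq x k := by
    have h := logHolonomy_wordParam (surjective_of_first_of_last hfirst hlast) x (k - 1)
    rw [sub_add_cancel] at h
    rw [one_mul, ← h]
    rfl
  height_eq x hx := by
    rw [height_wordSystem _ hfirst hlast hx, neg_mul]
    rfl

theorem reverseWord_zero (hlast : w (Fin.last n) = .L) : reverseWord w 0 = .R := by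
  have hindex : -(0 + 1 : Fin (n + 1)) = Fin.last n := by
    rw [zero_add, neg_eq_iff_add_eq_zero, add_comm (1 : Fin (n + 1)), Fin.last_add_one]
  rw [reverseWord, hindex, hlast]
  rfl

theorem reverseWord_last (hfirst : w 0 = .R) : reverseWord w (Fin.last n) = .L := by
  rw [reverseWord, Fin.last_add_one, neg_zero, hfirst]
  rfl

theorem wordParam_reverseWord (x : Fin (n + 1) → ℝ) :
    wordParam (reverseWord w) x = fun i => ((w (-i)).param (-x (- -i)))⁻¹ := by
  ext i
  rw [wordParam, reverseWord, sub_add_cancel, Letter.other_param, neg_neg]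

/-- The chart for shape parameters which are greater than `1` before the letters `R` and less than
`1` before the letters `L`: up to inversion of the shape parameters, it is the chart `plusChart` of
the reversed word. -/
def minusChart (hfirst : w 0 = .R) (hlast : w (Fin.last n) = .L) : ShapeChart w
    (wordSystem (reverseWord_surjective (surjective_of_first_of_last hfirst hlast))) where
  coord j x := (w j).param (-x)
  index := Equiv.neg _
  orient := -1
  edge k := bottomIndex w (-(k - 1))
  sgn := -1
  scale := -(n + 1)
  contDiff_coord _ := (Letter.contDiff_param _).comp contDiff_neg
  orient_mul_deriv_pos j x := by
    rw [deriv_comp_neg, neg_mul_neg, one_mul]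
    exact Letter.deriv_param_pos _ _
  coord_pos _ _ := Letter.param_pos _ _
  coord_ne_one _ _ := (Letter.inRange_param _ _).ne_one
  edge_surjective k := by
    obtain ⟨j, rfl⟩ := (bottomIndex_bijective (w := w)).2 k
    exact ⟨-j + 1, by simp only [add_sub_cancel_right, neg_neg]⟩
  sgn_ne_zero := neg_ne_zero.2 one_ne_zero
  scale_ne_zero := neg_ne_zero.2 n.cast_add_one_ne_zero
  logHolonomy_eq x k := by
    have hw := surjective_of_first_of_last hfirst hlast
    have hword := logHolonomy_wordParam (reverseWord_surjective hw) x (k - 1)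
    have hreverse := logHolonomy_reverseWord hw (z := fun j => (w j).param (-x (-j)))
      (fun j => (Letter.param_pos _ _).ne') (fun j => (Letter.inRange_param _ _).ne_one) (k - 1)
    rw [sub_add_cancel] at hword
    rw [← hword, wordParam_reverseWord, hreverse, neg_mul_neg, one_mul]
    rfl
  height_eq x hx := by
    have hinv := logPuncture_inv_neg (z := fun j => (w j).param (-x (-j)))
      (Letter.param_pos _ _).ne' (Letter.inRange_param _ _).ne_one
    rw [height_wordSystem _ (reverseWord_zero hlast) (reverseWord_last hfirst) hx,
      wordParam_reverseWord, hinv, neg_mul]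
    rfl

end Charts

/-! ### Sign patterns -/

namespace Letter

variable {X Y : Letter} {z : ℝ}

theorem eq_other_of_ne : ∀ {X Y : Letter}, X ≠ Y → X = Y.other
  | .R, .L, _ => rfl
  | .L, .R, _ => rfl

theorem exists_inRange (hpos : 0 < z) (hone : z ≠ 1) : ∃ X : Letter, X.InRange z := by
  rcases lt_or_gt_of_ne hone with h | h
  · exact ⟨.L, hpos, h⟩
  · exact ⟨.R, h⟩

theorem InRange.eq (hX : X.InRange z) (hY : Y.InRange z) : X = Y := by
  cases X <;> cases Y
  · rfl
  · exact (lt_asymm hX hY.2).elim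
  · exact (lt_asymm hX.2 hY).elim
  · rfl

theorem InRange.dihedralAngle_R (h : X.InRange z) :
    dihedralAngle (1 / (1 - z)) = if X = .R then Real.pi else 0 := by
  cases X
  · exact if_pos (div_neg_of_pos_of_neg one_pos (sub_neg.2 h))
  · exact if_neg (div_pos one_pos (sub_pos.2 h.2)).not_gt

theorem InRange.dihedralAngle_L (h : X.InRange z) :
    dihedralAngle ((z - 1) / z) = if X = .L then Real.pi else 0 := by
  cases X
  · exact if_neg (div_pos (sub_pos.2 h) h.pos).not_gt
  · exact if_pos (div_neg_of_neg_of_pos (sub_neg.2 h.2) h.1)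

theorem isOpen_inRange (X : Letter) : IsOpen {z | X.InRange z} := by
  cases X
  · exact isOpen_Ioi
  · exact isOpen_Ioo

theorem inRange_of_mem_closure (h : z ∈ closure {z | X.InRange z}) (hzero : z ≠ 0)
    (hone : z ≠ 1) : X.InRange z := by
  cases X
  · have hle : z ∈ Set.Ici 1 := closure_Ioi (1 : ℝ) ▸ h
    exact lt_of_le_of_ne hle hone.symm
  · have hle : z ∈ Set.Icc 0 1 := closure_Ioo (zero_ne_one' ℝ) ▸ h
    exact ⟨lt_of_le_of_ne hle.1 hzero.symm, lt_of_le_of_ne hle.2 hone⟩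

end Letter

section Patterns

variable {n : ℕ} {w : Fin (n + 1) → Letter} {σ : Fin (n + 1) → Letter}

theorem totalAngle_eq_card (s : ℤˣ) (hw : w.Surjective) {z : Fin (n + 1) → ℝ}
    (hσ : ∀ j, (σ j).InRange (z j)) (k : Fin (n + 1)) :
    (monodromyTriangulation w s).totalAngle z (topEdge w s k) =
      2 * Real.pi * (Finset.univ.filter fun j => lastBefore w (σ j) j = k).card := by
  rw [totalAngle_topEdge s hw, Finset.card_filter, Nat.cast_sum, Finset.mul_sum]
  refine Finset.sum_congr rfl fun j _ => ?_
  have hzero : dihedralAngle (z j) = 0 := if_neg (hσ j).pos.not_gt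
  rw [(hσ j).dihedralAngle_R, (hσ j).dihedralAngle_L, hzero]
  rcases σ j with _ | _ <;> simp

theorem mem_realDeformationVariety_iff (s : ℤˣ) (hw : w.Surjective) {z : Fin (n + 1) → ℝ}
    (hσ : ∀ j, (σ j).InRange (z j)) :
    z ∈ (monodromyTriangulation w s).realDeformationVariety ↔
      (∀ k, logHolonomy w z k = 0) ∧ Function.Bijective fun j => lastBefore w (σ j) j := by
  have hangle (k : Fin (n + 1)) : (monodromyTriangulation w s).totalAngle z (topEdge w s k) =
      2 * Real.pi ↔ ∃! j, lastBefore w (σ j) j = k := by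
    rw [totalAngle_eq_card s hw hσ, mul_eq_left₀ Real.two_pi_pos.ne', Nat.cast_eq_one,
      Finset.card_eq_one, Finset.singleton_iff_unique_mem]
    simp only [Finset.mem_filter_univ]
  have hholonomy (k : Fin (n + 1)) : (monodromyTriangulation w s).edgeHolonomy z (topEdge w s k) =
      1 ↔ logHolonomy w z k = 0 := by
    rw [edgeHolonomy_eq_exp s hw (fun j => (hσ j).pos) (fun j => (hσ j).ne_one),
      Real.exp_eq_one_iff]
  have hshape (j : Fin (n + 1)) : z j ≠ 0 ∧ z j ≠ 1 := ⟨(hσ j).pos.ne', (hσ j).ne_one⟩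
  rw [IdealTriangulation.realDeformationVariety, Set.mem_ofPred_eq, and_iff_right hshape,
    (topEdge_surjective s hw).forall, Function.bijective_iff_existsUnique, ← forall_and]
  exact forall_congr' fun k => and_congr (hholonomy k) (hangle k)

theorem bijective_lastBefore_pred : Function.Bijective fun j => lastBefore w (w (j - 1)) j := by
  have heq (j : Fin (n + 1)) : lastBefore w (w (j - 1)) j = j - 1 := by
    simpa only [sub_add_cancel] using lastBefore_succ_of_eq (w := w) (j := j - 1) rfl
  simp only [heq]
  exact (Equiv.subRight (1 : Fin (n + 1))).bijective

theorem bijective_lastBefore_self : Function.Bijective fun j => lastBefore w (w j) j := by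
  simp only [← bottomIndex_succ]
  exact bottomIndex_bijective.comp (Equiv.addRight (1 : Fin (n + 1))).bijective

theorem lastBefore_succ_eq_or_apply_ne {X : Letter} (hX : X ∈ Set.range w) (j : Fin (n + 1)) :
    lastBefore w X j + 1 = j ∨ w (lastBefore w X j + 1) ≠ X := by
  induction j using cyclicWord_induction hX with
  | after j hj => exact .inl (by rw [lastBefore_succ_of_eq hj])
  | step j hj ih =>
    rw [lastBefore_succ_of_ne hX hj]
    exact .inr (ih.elim (fun h => by rwa [h]) id)

theorem apply_succ_eq_of_surjective_lastBefore (hw : w.Surjective)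
    (hσ : Function.Surjective fun j => lastBefore w (σ j) j) {j : Fin (n + 1)}
    (hj : w (j + 1) = w j) : σ (j + 1) = w j := by
  obtain ⟨i, rfl⟩ := hσ j
  have hi : w (lastBefore w (σ i) i) = σ i := apply_lastBefore (hw _) i
  rcases lastBefore_succ_eq_or_apply_ne (hw (σ i)) i with h | h
  · rw [h, hi]
  · exact absurd (hj.trans hi) h

-- Between two changes of letters the older of the two last edges is the one at the previous change.
-- If it is already used there, then the tetrahedron at the next change must use the newer one.
theorem apply_succ_of_injective_lastBefore (hw : w.Surjective)
    (hσ : Function.Injective fun j => lastBefore w (σ j) j) {i j : Fin (n + 1)}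
    (hi : lastBefore w (w j).other (j + 1) = i) (hfirst : σ (i + 1) = w i) :
    σ (j + 1) = w j := by
  by_contra hne
  have hwi : w i = (w j).other := hi ▸ apply_lastBefore (hw _) (j + 1)
  have hij : i + 1 = j + 1 := hσ <| by
    simp only [hfirst, lastBefore_succ_of_eq, Letter.eq_other_of_ne hne, hi]
  exact Letter.other_ne _ (hwi.symm.trans (congrArg w (add_right_cancel hij)))

theorem eq_pred_or_eq_self_of_bijective_lastBefore (hw : w.Surjective)
    (hσ : Function.Bijective fun j => lastBefore w (σ j) j) :
    (∀ j, σ j = w (j - 1)) ∨ ∀ j, σ j = w j := by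
  let older (j : Fin (n + 1)) := lastBefore w (w j).other (j + 1)
  let First (j : Fin (n + 1)) : Prop := σ (older j + 1) = w (older j)
  have older_of_ne {j : Fin (n + 1)} (hj : w (j + 1) ≠ w j) : older (j + 1) = j := by
    have hother : (w (j + 1)).other = w j := by
      rw [Letter.eq_other_of_ne hj, Letter.other_other]
    simp only [older, hother]
    rw [lastBefore_succ_of_ne (hw _) hj, lastBefore_succ_of_eq rfl]
  have first_succ (j : Fin (n + 1)) (h : First j) : First (j + 1) := by
    by_cases hj : w (j + 1) = w j
    · have holder : older (j + 1) = older j := by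
        simp only [older, hj]
        exact lastBefore_succ_of_ne (hw _) (hj ▸ (Letter.other_ne _).symm)
      simpa only [First, holder] using h
    · simpa only [First, older_of_ne hj] using apply_succ_of_injective_lastBefore hw hσ.1 rfl h
  have hsame {j : Fin (n + 1)} := apply_succ_eq_of_surjective_lastBefore hw hσ.2 (j := j)
  by_cases hfirst : ∀ j, First j
  · refine .inl fun j => ?_
    obtain ⟨i, rfl⟩ : ∃ i, j = i + 1 := ⟨j - 1, (sub_add_cancel j 1).symm⟩
    rw [add_sub_cancel_right]
    by_cases hi : w (i + 1) = w i
    · exact hsame hi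
    · simpa only [First, older_of_ne hi] using hfirst (i + 1)
  · obtain ⟨k, hk⟩ := not_forall.1 hfirst
    have hnone := cyclic_backward_induction (P := (¬ First ·)) hk fun j => mt (first_succ j)
    refine .inr fun j => ?_
    obtain ⟨i, rfl⟩ : ∃ i, j = i + 1 := ⟨j - 1, (sub_add_cancel j 1).symm⟩
    by_cases hi : w (i + 1) = w i
    · rw [hi, hsame hi]
    · have hne : σ (i + 1) ≠ w i := by simpa only [First, older_of_ne hi] using hnone (i + 1)
      rw [Letter.eq_other_of_ne hne, Letter.eq_other_of_ne hi]

/-- The points of the real deformation variety whose shape parameters lie on the sides of `1` given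
by the letters of `σ`. -/
def patternSet (w : Fin (n + 1) → Letter) (s : ℤˣ) (σ : Fin (n + 1) → Letter) :
    Set (Fin (n + 1) → ℝ) :=
  {z | z ∈ (monodromyTriangulation w s).realDeformationVariety ∧ ∀ j, (σ j).InRange (z j)}

theorem patternSet_pred_union_patternSet_self (s : ℤˣ) (hw : w.Surjective) :
    patternSet w s (fun j => w (j - 1)) ∪ patternSet w s w =
      {z | z ∈ (monodromyTriangulation w s).realDeformationVariety ∧ ∀ k, 0 < z k} := by
  ext z
  constructor
  · rintro (h | h) <;> exact ⟨h.1, fun k => (h.2 k).pos⟩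
  · rintro ⟨hz, hpos⟩
    choose σ hσ using fun j => Letter.exists_inRange (hpos j) (hz.1 j).2
    have hbij := ((mem_realDeformationVariety_iff s hw hσ).1 hz).2
    rcases eq_pred_or_eq_self_of_bijective_lastBefore hw hbij with h | h
    · exact .inl ⟨hz, fun j => (h j ▸ hσ j : (w (j - 1)).InRange (z j))⟩
    · exact .inr ⟨hz, fun j => h j ▸ hσ j⟩

theorem disjoint_patternSet (s : ℤˣ) {τ : Fin (n + 1) → Letter} (hne : σ ≠ τ) :
    Disjoint (patternSet w s σ) (patternSet w s τ) :=
  Set.disjoint_left.2 fun _ hσ hτ => hne (funext fun j => (hσ.2 j).eq (hτ.2 j))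

theorem comp_sub_one_ne_self (hfirst : w 0 = .R) (hlast : w (Fin.last n) = .L) :
    (fun j => w (j - 1)) ≠ w := fun h => by
  have hpred : (0 : Fin (n + 1)) - 1 = Fin.last n := by rw [sub_eq_iff_eq_add, Fin.last_add_one]
  have hzero := congrFun h 0
  simp only [hpred, hfirst, hlast] at hzero
  exact Letter.noConfusion hzero

theorem connectedComponentIn_eq_of_isOpen_of_isClosed {α : Type*} [TopologicalSpace α]
    {F S U K : Set α} {x : α} (hU : IsOpen U) (hK : IsClosed K) (hSU : S ⊆ F ∩ U)
    (hUK : U ⊆ K) (hKS : F ∩ K ⊆ S) (hS : IsPreconnected S) (hx : x ∈ S) :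
    connectedComponentIn F x = S := by
  have hF := connectedComponentIn_subset F x
  refine subset_antisymm (fun y hy => hKS ⟨hF hy, hUK ?_⟩)
    (hS.subset_connectedComponentIn hx fun y hy => (hSU hy).1)
  refine isPreconnected_connectedComponentIn.subset_left_of_subset_union hU hK.isOpen_compl
    (Set.disjoint_compl_right_iff_subset.2 hUK) (fun y hy => ?_)
    ⟨x, mem_connectedComponentIn (hSU hx).1, (hSU hx).2⟩ hy
  exact or_iff_not_imp_right.2 fun hyK => (hSU (hKS ⟨hF hy, not_not.1 hyK⟩)).2

theorem connectedComponentIn_eq_patternSet (s : ℤˣ) (hconn : IsPreconnected (patternSet w s σ))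
    {z : Fin (n + 1) → ℝ} (hz : z ∈ patternSet w s σ) :
    connectedComponentIn (monodromyTriangulation w s).realDeformationVariety z =
      patternSet w s σ := by
  refine connectedComponentIn_eq_of_isOpen_of_isClosed
    (U := Set.univ.pi fun j => {y | (σ j).InRange y})
    (K := Set.univ.pi fun j => closure {y | (σ j).InRange y})
    (isOpen_set_pi Set.finite_univ fun j _ => (σ j).isOpen_inRange)
    (isClosed_set_pi fun _ _ => isClosed_closure) (fun y hy => ⟨hy.1, fun j _ => hy.2 j⟩)
    (Set.pi_mono fun _ _ => subset_closure) ?_ hconn hz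
  rintro y ⟨hy, hclosure⟩
  exact ⟨hy, fun j => Letter.inRange_of_mem_closure (hclosure j trivial) (hy.1 j).1 (hy.1 j).2⟩

theorem ShapeChart.image_solutions {B : BalancedSystem n} (C : ShapeChart w B) (s : ℤˣ)
    (hw : w.Surjective) (hσ : Function.Bijective fun j => lastBefore w (σ j) j)
    (hrange : ∀ j z, (σ j).InRange z ↔ ∃ x, C.coord j x = z) :
    C.shape '' B.solutions = patternSet w s σ := by
  have hshape (x) (j) : (σ j).InRange (C.shape x j) := (hrange j _).2 ⟨_, rfl⟩
  have hmem (x : Fin (n + 1) → ℝ) : C.shape x ∈ patternSet w s σ ↔ x ∈ B.solutions := by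
    rw [patternSet, Set.mem_ofPred_eq, and_iff_left (hshape x),
      mem_realDeformationVariety_iff s hw (hshape x), and_iff_left hσ, C.edge_surjective.forall]
    refine Iff.trans (forall_congr' fun k => ?_) funext_iff.symm
    change logHolonomy w (fun j => C.coord j (x (C.index j))) (C.edge k) = 0 ↔ _
    rw [C.logHolonomy_eq, mul_eq_zero, or_iff_right C.sgn_ne_zero]
    rfl
  refine Set.Subset.antisymm (Set.image_subset_iff.2 fun x => (hmem x).2) fun z hz => ?_
  choose x hx using fun j => (hrange j _).1 (hz.2 j)
  have hz_eq : C.shape (fun i => x (C.index.symm i)) = z :=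
    funext fun j => by simp only [shape, Equiv.symm_apply_apply, hx]
  exact ⟨_, (hmem _).1 (hz_eq ▸ hz), hz_eq⟩

theorem image_plusChart (s : ℤˣ) (hfirst : w 0 = .R) (hlast : w (Fin.last n) = .L) :
    (plusChart hfirst hlast).shape ''
        (wordSystem (surjective_of_first_of_last hfirst hlast)).solutions =
      patternSet w s fun j => w (j - 1) :=
  (plusChart hfirst hlast).image_solutions s (surjective_of_first_of_last hfirst hlast)
    bijective_lastBefore_pred fun _ _ => Letter.inRange_iff _ _

theorem image_minusChart (s : ℤˣ) (hfirst : w 0 = .R) (hlast : w (Fin.last n) = .L) :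
    (minusChart hfirst hlast).shape '' (wordSystem (reverseWord_surjective
        (surjective_of_first_of_last hfirst hlast))).solutions = patternSet w s w :=
  (minusChart hfirst hlast).image_solutions s (surjective_of_first_of_last hfirst hlast)
    bijective_lastBefore_self fun j z => by
      rw [Letter.inRange_iff]
      exact (neg_surjective (G := ℝ)).exists

theorem isPunctureCurve_patternSet_pred (s : ℤˣ) (hfirst : w 0 = .R)
    (hlast : w (Fin.last n) = .L) (hne : (patternSet w s fun j => w (j - 1)).Nonempty) :
    IsPunctureCurve w s (patternSet w s fun j => w (j - 1)) := by
  rw [← image_plusChart s hfirst hlast] at hne ⊢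
  exact (plusChart hfirst hlast).isPunctureCurve s hfirst hlast hne.of_image

theorem isPunctureCurve_patternSet_self (s : ℤˣ) (hfirst : w 0 = .R)
    (hlast : w (Fin.last n) = .L) (hne : (patternSet w s w).Nonempty) :
    IsPunctureCurve w s (patternSet w s w) := by
  rw [← image_minusChart s hfirst hlast] at hne ⊢
  exact (minusChart hfirst hlast).isPunctureCurve s hfirst hlast hne.of_image

theorem IsPunctureCurve.isPreconnected {s : ℤˣ} {V : Set (Fin (n + 1) → ℝ)}
    (hV : IsPunctureCurve w s V) : IsPreconnected V := by
  obtain ⟨γ, hγ, -, rfl, -⟩ := hV.exists_parameterization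
  exact isPreconnected_range hγ.continuous

end Patterns

/-! ### Shapes from eigenforms -/

namespace Letter

variable {h v : ℝ}

theorem inRange_R_div_sq_iff (hh : h ≠ 0) : InRange .R ((v / h) ^ 2) ↔ |h| < |v| := by
  rw [InRange, one_lt_sq_iff_one_lt_abs, abs_div, one_lt_div (abs_pos.2 hh)]

theorem inRange_L_div_sq_iff (hh : h ≠ 0) (hv : v ≠ 0) :
    InRange .L ((v / h) ^ 2) ↔ |v| < |h| := by
  rw [InRange, and_iff_right (by positivity), sq_lt_one_iff_abs_lt_one, abs_div,
    div_lt_one (abs_pos.2 hh)]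

end Letter

section LayerForms

open Matrix

variable {n : ℕ} {w : Fin (n + 1) → Letter}

theorem logHolonomy_eq_zero_of_layers (hw : w.Surjective) {z a b d : Fin (n + 1) → ℝ}
    (hlog : ∀ j, Real.log (z j) = -d j)
    (hR : ∀ j, w j = .R → a (j + 1) = Real.log (z j) ∧ b (j + 1) = b j + Letter.logSq .L (z j) ∧
      d (j + 1) = a j + Letter.logSq .R (z j))
    (hL : ∀ j, w j = .L → b (j + 1) = Real.log (z j) ∧ a (j + 1) = a j + Letter.logSq .R (z j) ∧
      d (j + 1) = b j + Letter.logSq .L (z j)) (k : Fin (n + 1)) : logHolonomy w z k = 0 := by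
  let f (j : Fin (n + 1)) : ℝ := (if bottomIndex w j = k then d j else 0) +
    (if lastBefore w .R j = k then a j else 0) + (if lastBefore w .L j = k then b j else 0)
  have htelescope (j : Fin (n + 1)) : (if j = k then Real.log (z j) else 0) +
      (if bottomIndex w j = k then Real.log (z j) else 0) +
      (if lastBefore w .R j = k then Letter.logSq .R (z j) else 0) +
      (if lastBefore w .L j = k then Letter.logSq .L (z j) else 0) = f (j + 1) - f j := by
    simp only [f, bottomIndex_succ]
    rcases hj : w j with _ | _
    · obtain ⟨ha, hb, hd⟩ := hR j hj
      simp only [ha, hb, hd, lastBefore_succ_of_eq hj,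
        lastBefore_succ_of_ne (hw .L) (j := j) (by simp [hj]), hlog j]
      split_ifs <;> ring
    · obtain ⟨hb, ha, hd⟩ := hL j hj
      simp only [ha, hb, hd, lastBefore_succ_of_eq hj,
        lastBefore_succ_of_ne (hw .R) (j := j) (by simp [hj]), hlog j]
      split_ifs <;> ring
  rw [logHolonomy, Finset.sum_congr rfl fun j _ => htelescope j, Finset.sum_sub_distrib,
    sub_eq_zero]
  exact Equiv.sum_comp (Equiv.addRight (1 : Fin (n + 1))) f

/-- `u j` lists, up to a positive factor, the values on the sides of the `j`-th parallelogram of a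
linear form on the plane which the word multiplies by a positive number. -/
def IsLayerForm (w : Fin (n + 1) → Letter) (u : Fin (n + 1) → Fin 2 → ℝ) : Prop :=
  ∀ j, ∃ c : ℝ, 0 < c ∧ u (j + 1) = c • (u j ᵥ* (w j).mat.map (Int.cast : ℤ → ℝ))

namespace IsLayerForm

variable {u : Fin (n + 1) → Fin 2 → ℝ} {j : Fin (n + 1)}

theorem exists_of_R (hu : IsLayerForm w u) (hj : w j = .R) :
    ∃ c : ℝ, 0 < c ∧ u (j + 1) 0 = c * u j 0 ∧ u (j + 1) 1 = c * (u j 1 + u j 0) := by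
  obtain ⟨c, hc, hsucc⟩ := hu j
  refine ⟨c, hc, ?_, ?_⟩ <;>
    simp [hsucc, hj, Letter.mat, vecMul, dotProduct, Fin.sum_univ_two, add_comm]

theorem exists_of_L (hu : IsLayerForm w u) (hj : w j = .L) :
    ∃ c : ℝ, 0 < c ∧ u (j + 1) 0 = c * (u j 1 + u j 0) ∧ u (j + 1) 1 = c * u j 1 := by
  obtain ⟨c, hc, hsucc⟩ := hu j
  refine ⟨c, hc, ?_, ?_⟩ <;>
    simp [hsucc, hj, Letter.mat, vecMul, dotProduct, Fin.sum_univ_two, add_comm]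

theorem logHolonomy_sq_ratio (hu : IsLayerForm w u) (hw : w.Surjective) (hhor : ∀ j, u j 0 ≠ 0)
    (hvert : ∀ j, u j 1 ≠ 0) (hadd : ∀ j, u j 1 + u j 0 ≠ 0)
    (hsub : ∀ j, u j 1 - u j 0 ≠ 0) (k : Fin (n + 1)) :
    logHolonomy w (fun j => (u j 1 / u j 0) ^ 2) k = 0 := by
  have hlog (j) : Real.log ((u j 1 / u j 0) ^ 2) = 2 * Real.log (u j 1) - 2 * Real.log (u j 0) := by
    rw [Real.log_pow, Real.log_div (hvert j) (hhor j)]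
    push_cast
    ring
  have hlog_one_sub (j) : Real.log (1 - (u j 1 / u j 0) ^ 2) =
      Real.log (u j 1 - u j 0) + Real.log (u j 1 + u j 0) - 2 * Real.log (u j 0) := by
    have hfactor : 1 - (u j 1 / u j 0) ^ 2 =
        -((u j 1 - u j 0) * (u j 1 + u j 0) / u j 0 ^ 2) := by
      have := hhor j
      field_simp
      ring
    rw [hfactor, Real.log_neg_eq_log, Real.log_div (mul_ne_zero (hsub j) (hadd j))
      (pow_ne_zero 2 (hhor j)), Real.log_mul (hsub j) (hadd j), Real.log_pow]
    push_cast
    ring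
  refine logHolonomy_eq_zero_of_layers hw
    (a := fun j => 2 * Real.log (u j 1 - u j 0) - 2 * Real.log (u j 0))
    (b := fun j => 2 * Real.log (u j 1) - 2 * Real.log (u j 1 - u j 0))
    (d := fun j => 2 * Real.log (u j 0) - 2 * Real.log (u j 1))
    (fun j => by rw [hlog]; ring) (fun j hj => ?_) (fun j hj => ?_) k
  · obtain ⟨c, hc, hzero, hone⟩ := hu.exists_of_R hj
    have hdiff : u (j + 1) 1 - u (j + 1) 0 = c * u j 1 := by rw [hzero, hone]; ring
    simp only [Letter.logSq, hlog, hlog_one_sub]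
    rw [hdiff, hzero, hone, Real.log_mul hc.ne' (hhor j), Real.log_mul hc.ne' (hvert j),
      Real.log_mul hc.ne' (hadd j)]
    refine ⟨?_, ?_, ?_⟩ <;> ring
  · obtain ⟨c, hc, hzero, hone⟩ := hu.exists_of_L hj
    have hdiff : u (j + 1) 1 - u (j + 1) 0 = -(c * u j 0) := by rw [hzero, hone]; ring
    simp only [Letter.logSq, hlog, hlog_one_sub]
    rw [hdiff, hzero, hone, Real.log_neg_eq_log, Real.log_mul hc.ne' (hhor j),
      Real.log_mul hc.ne' (hvert j), Real.log_mul hc.ne' (hadd j)]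
    refine ⟨?_, ?_, ?_⟩ <;> ring

theorem sq_ratio_mem_patternSet (hu : IsLayerForm w u) (s : ℤˣ) (hw : w.Surjective)
    {σ : Fin (n + 1) → Letter} (hσ : Function.Bijective fun j => lastBefore w (σ j) j)
    (hhor : ∀ j, u j 0 ≠ 0) (hrange : ∀ j, (σ j).InRange ((u j 1 / u j 0) ^ 2)) :
    (fun j => (u j 1 / u j 0) ^ 2) ∈ patternSet w s σ := by
  have hsq (j) : u j 1 ^ 2 ≠ u j 0 ^ 2 := fun heq => (hrange j).ne_one <| by
    rw [div_pow, heq, div_self (pow_ne_zero 2 (hhor j))]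
  refine ⟨(mem_realDeformationVariety_iff s hw hrange).2
    ⟨hu.logHolonomy_sq_ratio hw hhor (fun j hj => ?_) (fun j hj => hsq j ?_) fun j hj => hsq j ?_,
      hσ⟩, hrange⟩
  · simpa [hj] using (hrange j).pos
  · linear_combination (u j 1 - u j 0) * hj
  · linear_combination (u j 1 + u j 0) * hj

theorem pos_of_pos (hu : IsLayerForm w u) {i : Fin (n + 1)} (hi : 0 < u i 0 ∧ 0 < u i 1)
    (j : Fin (n + 1)) : 0 < u j 0 ∧ 0 < u j 1 := by
  by_contra hj
  refine cyclic_backward_induction (P := fun j => ¬(0 < u j 0 ∧ 0 < u j 1)) hj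
    (fun j => mt fun ⟨hhor, hvert⟩ => ?_) i hi
  rcases hwj : w j with _ | _
  · obtain ⟨c, hc, hzero, hone⟩ := hu.exists_of_R hwj
    rw [hzero, hone]
    constructor <;> positivity
  · obtain ⟨c, hc, hzero, hone⟩ := hu.exists_of_L hwj
    rw [hzero, hone]
    constructor <;> positivity

theorem add_neg_of_R (hu : IsLayerForm w u) (hj : w j = .R) (hsucc : u (j + 1) 1 < 0) :
    u j 1 + u j 0 < 0 := by
  obtain ⟨c, hc, -, hone⟩ := hu.exists_of_R hj
  exact neg_of_mul_neg_right (hone ▸ hsucc) hc.le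

theorem add_pos_of_L (hu : IsLayerForm w u) (hj : w j = .L) (hsucc : 0 < u (j + 1) 0) :
    0 < u j 1 + u j 0 := by
  obtain ⟨c, hc, hzero, -⟩ := hu.exists_of_L hj
  exact pos_of_mul_pos_right (hzero ▸ hsucc) hc.le

theorem pos_neg_of_pos_neg (hu : IsLayerForm w u) {i : Fin (n + 1)} (hi : 0 < u i 0 ∧ u i 1 < 0)
    (j : Fin (n + 1)) : 0 < u j 0 ∧ u j 1 < 0 := by
  refine cyclic_backward_induction (P := fun j => 0 < u j 0 ∧ u j 1 < 0) hi
    (fun j ⟨hhor, hvert⟩ => ?_) j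
  rcases hwj : w j with _ | _
  · obtain ⟨c, hc, hzero, -⟩ := hu.exists_of_R hwj
    have hhor' := pos_of_mul_pos_right (hzero ▸ hhor) hc.le
    exact ⟨hhor', by linarith [hu.add_neg_of_R hwj hvert]⟩
  · obtain ⟨c, hc, -, hone⟩ := hu.exists_of_L hwj
    have hvert' := neg_of_mul_neg_right (hone ▸ hvert) hc.le
    exact ⟨by linarith [hu.add_pos_of_L hwj hhor], hvert'⟩

theorem sq_ratio_mem_patternSet_pred (hu : IsLayerForm w u) (s : ℤˣ) (hw : w.Surjective)
    {i : Fin (n + 1)} (hi : 0 < u i 0 ∧ 0 < u i 1) :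
    (fun j => (u j 1 / u j 0) ^ 2) ∈ patternSet w s fun j => w (j - 1) := by
  have hpos := hu.pos_of_pos hi
  have hhor (j) : 0 < u j 0 := (hpos j).1
  have hvert (j) : 0 < u j 1 := (hpos j).2
  refine hu.sq_ratio_mem_patternSet s hw bijective_lastBefore_pred
    (fun j => (hhor j).ne') fun j => ?_
  obtain ⟨j, rfl⟩ : ∃ k, j = k + 1 := ⟨j - 1, (sub_add_cancel j 1).symm⟩
  rw [add_sub_cancel_right]
  rcases hj : w j with _ | _
  · obtain ⟨c, hc, hzero, hone⟩ := hu.exists_of_R hj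
    rw [Letter.inRange_R_div_sq_iff (hhor _).ne', abs_of_pos (hhor _), abs_of_pos (hvert _),
      hzero, hone]
    exact mul_lt_mul_of_pos_left (lt_add_of_pos_left _ (hvert j)) hc
  · obtain ⟨c, hc, hzero, hone⟩ := hu.exists_of_L hj
    rw [Letter.inRange_L_div_sq_iff (hhor _).ne' (hvert _).ne', abs_of_pos (hhor _),
      abs_of_pos (hvert _), hzero, hone]
    exact mul_lt_mul_of_pos_left (lt_add_of_pos_right _ (hhor j)) hc

theorem sq_ratio_mem_patternSet_self (hu : IsLayerForm w u) (s : ℤˣ) (hw : w.Surjective)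
    {i : Fin (n + 1)} (hi : 0 < u i 0 ∧ u i 1 < 0) :
    (fun j => (u j 1 / u j 0) ^ 2) ∈ patternSet w s w := by
  have hsign := hu.pos_neg_of_pos_neg hi
  have hhor (j) : 0 < u j 0 := (hsign j).1
  have hvert (j) : u j 1 < 0 := (hsign j).2
  refine hu.sq_ratio_mem_patternSet s hw bijective_lastBefore_self
    (fun j => (hhor j).ne') fun j => ?_
  rcases hj : w j with _ | _
  · rw [Letter.inRange_R_div_sq_iff (hhor _).ne', abs_of_pos (hhor _), abs_of_neg (hvert _)]
    linarith [hu.add_neg_of_R hj (hvert _)]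
  · rw [Letter.inRange_L_div_sq_iff (hhor _).ne' (hvert _).ne, abs_of_pos (hhor _),
      abs_of_neg (hvert _)]
    linarith [hu.add_pos_of_L hj (hhor _)]

end IsLayerForm

end LayerForms

section Eigenforms

open Matrix

variable {n : ℕ} {w : Fin (n + 1) → Letter}

theorem prefixMat_zero : prefixMat w 0 = 1 := rfl

theorem prefixMat_succ (k : Fin (n + 1)) : prefixMat w (k + 1) = prefixMat w k * (w k).mat := by
  have hk : (k : ℕ) < (List.ofFn fun i => (w i).mat).length := by
    rw [List.length_ofFn]
    exact k.2
  rw [prefixMat, prefixMat, List.prod_take_succ _ _ hk, List.getElem_ofFn]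

variable (w) in
/-- The values on the sides of the parallelogram `prefixMat w k *ᵥ [0, 1]²` of the linear form
on the plane with coefficients `r`. -/
def sideValues (r : Fin 2 → ℝ) (k : ℕ) : Fin 2 → ℝ :=
  r ᵥ* (prefixMat w k).map (Int.cast : ℤ → ℝ)

theorem sideValues_zero (r : Fin 2 → ℝ) : sideValues w r 0 = r := by
  rw [sideValues, prefixMat_zero, Matrix.map_one _ Int.cast_zero Int.cast_one, vecMul_one]

theorem sideValues_succ (r : Fin 2 → ℝ) (k : Fin (n + 1)) :
    sideValues w r (k + 1) = sideValues w r k ᵥ* (w k).mat.map (Int.cast : ℤ → ℝ) := by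
  rw [sideValues, sideValues, prefixMat_succ, vecMul_vecMul]
  congr 1
  exact Matrix.map_mul (f := Int.castRingHom ℝ)

variable {μ : ℝ} {r : Fin 2 → ℝ}

theorem isLayerForm_sideValues (hμ : 0 < μ) (hr : sideValues w r (n + 1) = μ • r) :
    IsLayerForm w fun k => sideValues w r k := by
  intro j
  simp only [← sideValues_succ]
  by_cases hj : j = Fin.last n
  · refine ⟨μ⁻¹, inv_pos.2 hμ, ?_⟩
    rw [hj, Fin.last_add_one, Fin.val_zero, Fin.val_last, hr, sideValues_zero, smul_smul,
      inv_mul_cancel₀ hμ.ne', one_smul]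
  · exact ⟨1, one_pos, by rw [one_smul, Fin.val_add_one, if_neg hj]⟩

theorem crossRatio_parallelogram {h v : ℝ} (hh : h ≠ 0) :
    crossRatio 0 (h + v) v h = (v / h) ^ 2 := by
  rw [crossRatio, sub_add_cancel_left, sub_add_cancel_right]
  field_simp
  ring

theorem dotProduct_prefixMat_mulVec (r : Fin 2 → ℝ) (k : ℕ) (x : Fin 2 → ℤ) :
    r ⬝ᵥ (fun i => (((prefixMat w k *ᵥ x) i : ℤ) : ℝ)) =
      sideValues w r k ⬝ᵥ fun i => (x i : ℝ) := by
  rw [sideValues, ← dotProduct_mulVec]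
  congr 1
  exact funext fun i => (Int.castRingHom ℝ).map_mulVec (prefixMat w k) x i

theorem isProjectionShape_sq_ratio (hr : sideValues w r (n + 1) = μ • r)
    (hhor : ∀ k : Fin (n + 1), sideValues w r k 0 ≠ 0) :
    IsProjectionShape w μ fun k => (sideValues w r k 1 / sideValues w r k 0) ^ 2 := by
  refine ⟨dotProductEquiv ℝ (Fin 2) r, ?_, fun v => ?_, fun k => ?_⟩
  · have hr0 : r ≠ 0 := fun h => hhor 0 <| by rw [Fin.val_zero, sideValues_zero, h, Pi.zero_apply]
    exact (map_ne_zero_iff _ (dotProductEquiv ℝ (Fin 2)).injective).2 hr0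
  · rw [dotProductEquiv_apply_apply, dotProductEquiv_apply_apply, dotProduct_mulVec]
    exact (congrArg (· ⬝ᵥ v) hr).trans (smul_dotProduct μ r v)
  · simp only [dotProductEquiv_apply_apply, dotProduct_prefixMat_mulVec,
      ← crossRatio_parallelogram (hhor k)]
    simp [corner, dotProduct, Fin.sum_univ_two]

theorem Letter.prod_mat_nonneg (l : List Letter) :
    1 ≤ (l.map mat).prod 0 0 ∧ 0 ≤ (l.map mat).prod 0 1 ∧
      0 ≤ (l.map mat).prod 1 0 ∧ 1 ≤ (l.map mat).prod 1 1 := by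
  induction l with
  | nil => simp
  | cons X l ih =>
    rw [List.map_cons, List.prod_cons]
    cases X <;>
    · simp [mat, mul_apply, Fin.sum_univ_two]
      lia

theorem Letter.det_mat (X : Letter) : X.mat.det = 1 := by
  cases X <;> simp [mat, det_fin_two]

theorem Letter.det_prod_mat (l : List Letter) : (l.map mat).prod.det = 1 := by
  induction l with
  | nil => simp
  | cons X l ih =>
    rw [List.map_cons, List.prod_cons, det_mul, ih, X.det_mat, one_mul]

theorem wordMat_eq_prod : wordMat w = ((List.ofFn w).map Letter.mat).prod := by
  rw [wordMat, prefixMat, List.map_ofFn, List.take_of_length_le (by simp)]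
  rfl

theorem wordMat_zero_one_pos (hfirst : w 0 = .R) : 0 < wordMat w 0 1 := by
  obtain ⟨-, h01, -, h11⟩ := Letter.prod_mat_nonneg (List.ofFn fun i : Fin n => w i.succ)
  rw [wordMat_eq_prod, List.ofFn_succ, List.map_cons, List.prod_cons, hfirst]
  simp only [Letter.mat, mul_apply, Fin.sum_univ_two, of_apply, cons_val]
  lia

theorem wordMat_one_zero_pos (hlast : w (Fin.last n) = .L) : 0 < wordMat w 1 0 := by
  obtain ⟨-, -, h10, h11⟩ := Letter.prod_mat_nonneg (List.ofFn fun i : Fin n => w i.castSucc)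
  rw [wordMat_eq_prod, List.ofFn_succ', List.concat_eq_append, List.map_append, List.prod_append,
    hlast]
  simp only [Letter.mat, mul_apply, Fin.sum_univ_two, of_apply, cons_val, List.map_cons,
    List.map_nil, List.prod_singleton]
  lia

theorem exists_one_lt_add_inv_eq {t : ℝ} (ht : 2 < t) : ∃ μ : ℝ, 1 < μ ∧ μ + μ⁻¹ = t := by
  have hcont : ContinuousOn (fun μ : ℝ => μ + μ⁻¹) (Set.Icc 1 t) :=
    continuousOn_id.add (continuousOn_id.inv₀ fun μ hμ => (one_pos.trans_le hμ.1).ne')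
  have ht0 : 0 < t⁻¹ := by positivity
  obtain ⟨μ, hμ, hsum⟩ := intermediate_value_Ioo (by linarith) hcont
    (show t ∈ Set.Ioo ((1 : ℝ) + 1⁻¹) (t + t⁻¹) from ⟨by norm_num [ht], by linarith⟩)
  exact ⟨μ, hμ.1, hsum⟩

section RealMatrix

variable {M : Matrix (Fin 2) (Fin 2) ℝ}

theorem vecMul_eigenvector (hdet : M.det = 1) (hμ : μ ≠ 0) (htr : μ + μ⁻¹ = M.trace) :
    ![M 1 0, μ - M 0 0] ᵥ* M = μ • ![M 1 0, μ - M 0 0] := by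
  rw [det_fin_two] at hdet
  rw [trace_fin_two] at htr
  ext i
  fin_cases i <;> simp [vecMul, dotProduct, Fin.sum_univ_two]
  · ring
  · linear_combination -hdet - μ * htr + mul_inv_cancel₀ hμ

theorem inv_lt_apply_zero_zero_lt (hdet : M.det = 1) (hoff : 0 < M 0 1 * M 1 0) (hμ : 1 < μ)
    (htr : μ + μ⁻¹ = M.trace) : μ⁻¹ < M 0 0 ∧ M 0 0 < μ := by
  rw [det_fin_two] at hdet
  rw [trace_fin_two] at htr
  have hinv : μ⁻¹ < μ := (inv_lt_one_of_one_lt₀ hμ).trans hμ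
  have hmul : 0 < (M 0 0 - μ⁻¹) * (μ - M 0 0) := by
    have : (M 0 0 - μ⁻¹) * (μ - M 0 0) = M 0 1 * M 1 0 := by
      linear_combination hdet + M 0 0 * htr - mul_inv_cancel₀ (one_pos.trans hμ).ne'
    rwa [this]
  rcases mul_pos_iff.1 hmul with h | h <;> constructor <;> linarith [h.1, h.2]

theorem two_lt_trace (hdet : M.det = 1) (hoff : 0 < M 0 1 * M 1 0) (htrace : 0 < M.trace) :
    2 < M.trace := by
  rw [det_fin_two] at hdet
  rw [trace_fin_two] at htrace ⊢
  nlinarith [sq_nonneg (M 0 0 - M 1 1)]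

end RealMatrix

theorem exists_eigenforms (hfirst : w 0 = .R) (hlast : w (Fin.last n) = .L) :
    ∃ (μ : ℝ) (r r' : Fin 2 → ℝ), 1 < μ ∧
      ((0 < r 0 ∧ 0 < r 1) ∧ sideValues w r (n + 1) = μ • r) ∧
      (0 < r' 0 ∧ r' 1 < 0) ∧ sideValues w r' (n + 1) = μ⁻¹ • r' := by
  let M : Matrix (Fin 2) (Fin 2) ℝ := (wordMat w).map Int.cast
  have h01 : 0 < M 0 1 := Int.cast_pos.2 (wordMat_zero_one_pos hfirst)
  have h10 : 0 < M 1 0 := Int.cast_pos.2 (wordMat_one_zero_pos hlast)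
  have htrace : 0 < M.trace := by
    obtain ⟨h00, -, -, h11⟩ := Letter.prod_mat_nonneg (List.ofFn w)
    rw [← wordMat_eq_prod] at h00 h11
    rw [trace_fin_two]
    exact add_pos (Int.cast_pos.2 (by lia)) (Int.cast_pos.2 (by lia))
  have hdet : M.det = 1 := by
    have := (Int.castRingHom ℝ).map_det (wordMat w)
    rw [wordMat_eq_prod, Letter.det_prod_mat, map_one, ← wordMat_eq_prod] at this
    exact this.symm
  have hoff := mul_pos h01 h10
  obtain ⟨μ, hμ, htr⟩ := exists_one_lt_add_inv_eq (two_lt_trace hdet hoff htrace)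
  obtain ⟨hlower, hupper⟩ := inv_lt_apply_zero_zero_lt hdet hoff hμ htr
  have hμ0 : μ ≠ 0 := (one_pos.trans hμ).ne'
  exact ⟨μ, ![M 1 0, μ - M 0 0], ![M 1 0, μ⁻¹ - M 0 0], hμ,
    ⟨⟨h10, sub_pos.2 hupper⟩, vecMul_eigenvector hdet hμ0 htr⟩, ⟨h10, sub_neg.2 hlower⟩,
    vecMul_eigenvector hdet (inv_ne_zero hμ0) (by rw [inv_inv, add_comm, htr])⟩

theorem exists_projectionShape_mem_patternSet_pred (s : ℤˣ) (hw : w.Surjective) (hμ : 0 < μ)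
    (hsign : 0 < r 0 ∧ 0 < r 1) (hr : sideValues w r (n + 1) = μ • r) :
    ∃ z ∈ patternSet w s fun j => w (j - 1), IsProjectionShape w μ z := by
  have hform := isLayerForm_sideValues hμ hr
  have hzero : 0 < sideValues w r (0 : Fin (n + 1)) 0 ∧ 0 < sideValues w r (0 : Fin (n + 1)) 1 := by
    rwa [Fin.val_zero, sideValues_zero]
  exact ⟨_, hform.sq_ratio_mem_patternSet_pred s hw hzero,
    isProjectionShape_sq_ratio hr fun k => (hform.pos_of_pos hzero k).1.ne'⟩

theorem exists_projectionShape_mem_patternSet_self (s : ℤˣ) (hw : w.Surjective) (hμ : 0 < μ)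
    (hsign : 0 < r 0 ∧ r 1 < 0) (hr : sideValues w r (n + 1) = μ • r) :
    ∃ z ∈ patternSet w s w, IsProjectionShape w μ z := by
  have hform := isLayerForm_sideValues hμ hr
  have hzero : 0 < sideValues w r (0 : Fin (n + 1)) 0 ∧ sideValues w r (0 : Fin (n + 1)) 1 < 0 := by
    rwa [Fin.val_zero, sideValues_zero]
  exact ⟨_, hform.sq_ratio_mem_patternSet_self s hw hzero,
    isProjectionShape_sq_ratio hr fun k => (hform.pos_neg_of_pos_neg hzero k).1.ne'⟩

end Eigenforms

/-! ### Conjugation of Anosov matrices to words -/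

section IsAnosov

open Matrix
open scoped MatrixGroups

theorem sq_add_det_eq_trace_mul_of_hasEigenvalue {M : Matrix (Fin 2) (Fin 2) ℝ} {a : ℝ}
    (ha : Module.End.HasEigenvalue (toLin' M) a) : a ^ 2 + M.det = M.trace * a := by
  rw [Module.End.hasEigenvalue_iff_isRoot_charpoly, charpoly_toLin', charpoly_fin_two] at ha
  have heval : a ^ 2 - M.trace * a + M.det = 0 := by simpa [Polynomial.IsRoot] using ha
  linear_combination heval

theorem four_mul_det_lt_sq_trace {M : Matrix (Fin 2) (Fin 2) ℝ} {a b : ℝ} (hab : a ≠ b)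
    (ha : Module.End.HasEigenvalue (toLin' M) a) (hb : Module.End.HasEigenvalue (toLin' M) b) :
    4 * M.det < M.trace ^ 2 := by
  have ha := sq_add_det_eq_trace_mul_of_hasEigenvalue ha
  have hb := sq_add_det_eq_trace_mul_of_hasEigenvalue hb
  have hsum : M.trace = a + b :=
    mul_left_cancel₀ (sub_ne_zero.2 hab) (by linear_combination hb - ha)
  have hdisc : M.trace ^ 2 - 4 * M.det = (a - b) ^ 2 := by
    rw [hsum] at ha ⊢
    linear_combination -4 * ha
  linarith [sq_pos_of_ne_zero (sub_ne_zero.2 hab)]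

theorem IsAnosov.two_lt_abs_trace {φ : SL(2, ℤ)} (hφ : IsAnosov φ) :
    2 < |trace (φ : Matrix (Fin 2) (Fin 2) ℤ)| := by
  obtain ⟨a, b, hab, ha, hb⟩ := hφ
  have hlt := four_mul_det_lt_sq_trace hab ha hb
  have hdet : (φ.1.map (Int.cast : ℤ → ℝ)).det = 1 := by
    simpa using ((Int.castRingHom ℝ).map_det φ.1).symm
  have htrace : (φ.1.map (Int.cast : ℤ → ℝ)).trace =
      (trace (φ : Matrix (Fin 2) (Fin 2) ℤ) : ℤ) := by
    simp [trace_fin_two]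
  rw [hdet, htrace] at hlt
  exact lt_of_pow_lt_pow_left₀ 2 (abs_nonneg _) (by rw [sq_abs]; exact_mod_cast hlt)

end IsAnosov

section NonnegativeConjugate

open Matrix ModularGroup
open Matrix.SpecialLinearGroup (coe_mul coe_inv)
open scoped MatrixGroups

variable (φ : SL(2, ℤ))

theorem trace_eq_of_isConj {φ ψ : SL(2, ℤ)} (h : IsConj φ ψ) :
    trace (ψ : Matrix (Fin 2) (Fin 2) ℤ) = trace (φ : Matrix (Fin 2) (Fin 2) ℤ) := by
  obtain ⟨A, rfl⟩ := isConj_iff.1 h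
  rw [coe_mul, trace_mul_comm, ← coe_mul,
    inv_mul_cancel_left]

theorem coe_conj_T_zpow (k : ℤ) : (↑(T ^ k * φ * (T ^ k)⁻¹) : Matrix (Fin 2) (Fin 2) ℤ) =
    !![φ 0 0 + k * φ 1 0, φ 0 1 + k * φ 1 1 - k * (φ 0 0 + k * φ 1 0);
      φ 1 0, φ 1 1 - k * φ 1 0] := by
  rw [← _root_.zpow_neg, coe_mul, coe_mul, coe_T_zpow,
    coe_T_zpow, eta_fin_two (φ : Matrix (Fin 2) (Fin 2) ℤ)]
  ext i j
  fin_cases i <;> fin_cases j <;> simp <;> ring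

theorem coe_conj_S : (↑(S * φ * S⁻¹) : Matrix (Fin 2) (Fin 2) ℤ) =
    !![φ 1 1, -φ 1 0; -φ 0 1, φ 0 0] := by
  rw [coe_mul, coe_mul, coe_inv, coe_S,
    eta_fin_two (φ : Matrix (Fin 2) (Fin 2) ℤ)]
  simp [adjugate_fin_two]

theorem abs_add_lt_or_abs_sub_lt {e y : ℤ} (hy : y ≠ 0) (h : |y| < |e|) :
    |e + 2 * y| < |e| ∨ |e - 2 * y| < |e| := by
  grind

variable {φ}

theorem exists_isConj_of_abs_lower_lt (hlower : φ 1 0 ≠ 0) (hlt : |φ 1 0| < |φ 0 0 - φ 1 1|) :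
    ∃ ψ, IsConj φ ψ ∧ |ψ 0 0 - ψ 1 1| < |φ 0 0 - φ 1 1| := by
  have hdiag (k : ℤ) : (T ^ k * φ * (T ^ k)⁻¹) 0 0 - (T ^ k * φ * (T ^ k)⁻¹) 1 1 =
      φ 0 0 - φ 1 1 + k * (2 * φ 1 0) := by
    simp only [coe_conj_T_zpow, of_apply, cons_val]
    ring
  rcases abs_add_lt_or_abs_sub_lt hlower hlt with h | h
  · exact ⟨_, isConj_iff.2 ⟨T ^ (1 : ℤ), rfl⟩, by rwa [hdiag, one_mul]⟩
  · exact ⟨_, isConj_iff.2 ⟨T ^ (-1 : ℤ), rfl⟩, by rwa [hdiag, neg_one_mul, ← sub_eq_add_neg]⟩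

theorem exists_isConj_of_abs_upper_lt (hupper : φ 0 1 ≠ 0) (hlt : |φ 0 1| < |φ 0 0 - φ 1 1|) :
    ∃ ψ, IsConj φ ψ ∧ |ψ 0 0 - ψ 1 1| < |φ 0 0 - φ 1 1| := by
  have hlower : (S * φ * S⁻¹) 1 0 = -φ 0 1 := by simp only [coe_conj_S, of_apply, cons_val]
  have hdiag : (S * φ * S⁻¹) 0 0 - (S * φ * S⁻¹) 1 1 = φ 1 1 - φ 0 0 := by
    simp only [coe_conj_S, of_apply, cons_val]
  obtain ⟨ψ, hψ, hψlt⟩ := exists_isConj_of_abs_lower_lt (φ := S * φ * S⁻¹)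
    (by rwa [hlower, neg_ne_zero]) (by rwa [hlower, hdiag, abs_neg, abs_sub_comm])
  rw [hdiag, abs_sub_comm (φ 1 1)] at hψlt
  exact ⟨ψ, (isConj_iff.2 ⟨S, rfl⟩).trans hψ, hψlt⟩

theorem exists_isConj_of_mul_neg (htrace : 2 < trace (φ : Matrix (Fin 2) (Fin 2) ℤ))
    (hneg : φ 0 1 * φ 1 0 < 0) :
    ∃ ψ, IsConj φ ψ ∧ |ψ 0 0 - ψ 1 1| < |φ 0 0 - φ 1 1| := by
  have hdet := φ.det_coe
  rw [det_fin_two] at hdet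
  rw [trace_fin_two] at htrace
  have hdisc : 4 * |φ 0 1 * φ 1 0| < (φ 0 0 - φ 1 1) ^ 2 := by
    rw [abs_of_neg hneg]
    nlinarith
  rw [abs_mul, ← sq_abs] at hdisc
  obtain ⟨hupper, hlower⟩ := mul_ne_zero_iff.1 hneg.ne
  rcases le_total |φ 0 1| |φ 1 0| with hle | hle
  · exact exists_isConj_of_abs_upper_lt hupper <|
      lt_of_pow_lt_pow_left₀ 2 (abs_nonneg _) (by nlinarith [abs_nonneg (φ 0 1)])
  · exact exists_isConj_of_abs_lower_lt hlower <|
      lt_of_pow_lt_pow_left₀ 2 (abs_nonneg _) (by nlinarith [abs_nonneg (φ 1 0)])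

theorem exists_isConj_nonneg_of_mul_nonneg (htrace : 0 < trace (φ : Matrix (Fin 2) (Fin 2) ℤ))
    (hnonneg : 0 ≤ φ 0 1 * φ 1 0) : ∃ ψ, IsConj φ ψ ∧ ∀ i j, 0 ≤ ψ i j := by
  have hdet := φ.det_coe
  rw [det_fin_two] at hdet
  rw [trace_fin_two] at htrace
  obtain ⟨h00, h11⟩ : 0 < φ 0 0 ∧ 0 < φ 1 1 :=
    (mul_pos_iff.1 (by linarith : 0 < φ 0 0 * φ 1 1)).resolve_right fun h => by
      linarith [h.1, h.2]
  rcases mul_nonneg_iff.1 hnonneg with ⟨h01, h10⟩ | ⟨h01, h10⟩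
  · exact ⟨φ, .refl φ, Fin.forall_fin_two.2 ⟨Fin.forall_fin_two.2 ⟨h00.le, h01⟩,
      Fin.forall_fin_two.2 ⟨h10, h11.le⟩⟩⟩
  · refine ⟨S * φ * S⁻¹, isConj_iff.2 ⟨S, rfl⟩, ?_⟩
    simp only [coe_conj_S, Fin.forall_fin_two, of_apply, cons_val]
    lia

theorem exists_isConj_nonneg (φ : SL(2, ℤ)) (htrace : 2 < trace (φ : Matrix (Fin 2) (Fin 2) ℤ)) :
    ∃ ψ, IsConj φ ψ ∧ ∀ i j, 0 ≤ ψ i j := by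
  induction hm : (φ 0 0 - φ 1 1).natAbs using Nat.strong_induction_on generalizing φ with
  | _ m ih =>
    rcases lt_or_ge (φ 0 1 * φ 1 0) 0 with hneg | hnonneg
    · obtain ⟨ψ, hψ, hlt⟩ := exists_isConj_of_mul_neg htrace hneg
      obtain ⟨χ, hχ, hnonneg⟩ :=
        ih _ (by rw [← hm]; zify; exact hlt) ψ (trace_eq_of_isConj hψ ▸ htrace) rfl
      exact ⟨χ, hψ.trans hχ, hnonneg⟩
    · exact exists_isConj_nonneg_of_mul_nonneg (by linarith) hnonneg

end NonnegativeConjugate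

section NonnegativeFactorization

open Matrix

theorem rows_le_or_rows_ge_or_eq_one {M : Matrix (Fin 2) (Fin 2) ℤ} (hdet : M.det = 1)
    (hM : ∀ i j, 0 ≤ M i j) : (∀ j, M 1 j ≤ M 0 j) ∨ (∀ j, M 0 j ≤ M 1 j) ∨ M = 1 := by
  rw [det_fin_two] at hdet
  simp only [Fin.forall_fin_two] at hM ⊢
  obtain ⟨⟨h00, h01⟩, h10, h11⟩ := hM
  rcases le_or_gt (M 1 0) (M 0 0) with hleft | hleft <;>
    rcases le_or_gt (M 1 1) (M 0 1) with hright | hright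
  · exact .inl ⟨hleft, hright⟩
  · rcases hleft.eq_or_lt with hleft | hleft
    · exact .inr (.inl ⟨hleft.ge, hright.le⟩)
    have hle : (M 1 0 + 1) * (M 0 1 + 1) ≤ M 0 0 * M 1 1 :=
      mul_le_mul hleft hright (by linarith) h00
    have hzero10 : M 1 0 = 0 := by nlinarith
    have hzero01 : M 0 1 = 0 := by nlinarith
    rw [hzero10, mul_zero, sub_zero] at hdet
    refine .inr (.inr ?_)
    rw [eta_fin_two M, hzero10, hzero01, Int.eq_one_of_mul_eq_one_right h00 hdet,
      Int.eq_one_of_mul_eq_one_left h11 hdet, one_fin_two]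
  · nlinarith
  · exact .inr (.inl ⟨hleft.le, hright.le⟩)

theorem row_sum_pos {M : Matrix (Fin 2) (Fin 2) ℤ} (hdet : M.det = 1) (hM : ∀ i j, 0 ≤ M i j)
    (i : Fin 2) : 0 < M i 0 + M i 1 := by
  refine (add_nonneg (hM i 0) (hM i 1)).lt_of_ne fun hsum => ?_
  have hzero : ∀ j, M i j = 0 := Fin.forall_fin_two.2 (by have := hM i; grind)
  exact one_ne_zero (hdet.symm.trans (det_eq_zero_of_row_eq_zero i hzero))

theorem exists_eq_mat_mul {M : Matrix (Fin 2) (Fin 2) ℤ} (hdet : M.det = 1)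
    (hM : ∀ i j, 0 ≤ M i j) (hne : M ≠ 1) :
    ∃ (X : Letter) (N : Matrix (Fin 2) (Fin 2) ℤ), M = X.mat * N ∧ (∀ i j, 0 ≤ N i j) ∧
      ∑ i, ∑ j, N i j < ∑ i, ∑ j, M i j := by
  have hrow0 := row_sum_pos hdet hM 0
  have hrow1 := row_sum_pos hdet hM 1
  have hcases := rows_le_or_rows_ge_or_eq_one hdet hM
  simp only [hne, or_false, Fin.forall_fin_two] at hM hcases
  simp only [Fin.sum_univ_two, Fin.forall_fin_two]
  rcases hcases with hrows | hrows
  · refine ⟨.R, !![M 0 0 - M 1 0, M 0 1 - M 1 1; M 1 0, M 1 1], ?_, ?_, ?_⟩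
    · rw [Letter.mat, mul_fin_two]
      simpa using eta_fin_two M
    all_goals simp only [of_apply, cons_val]; lia
  · refine ⟨.L, !![M 0 0, M 0 1; M 1 0 - M 0 0, M 1 1 - M 0 1], ?_, ?_, ?_⟩
    · rw [Letter.mat, mul_fin_two]
      simpa using eta_fin_two M
    all_goals simp only [of_apply, cons_val]; lia

theorem exists_prod_mat_eq {M : Matrix (Fin 2) (Fin 2) ℤ} (hdet : M.det = 1)
    (hM : ∀ i j, 0 ≤ M i j) : ∃ l : List Letter, (l.map Letter.mat).prod = M := by
  induction hm : (∑ i, ∑ j, M i j).toNat using Nat.strong_induction_on generalizing M with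
  | _ m ih =>
    by_cases hone : M = 1
    · exact ⟨[], hone.symm⟩
    obtain ⟨X, N, rfl, hN, hlt⟩ := exists_eq_mat_mul hdet hM hone
    rw [det_mul, X.det_mat, one_mul] at hdet
    have hsum : 0 ≤ ∑ i, ∑ j, N i j :=
      Finset.sum_nonneg fun i _ => Finset.sum_nonneg fun j _ => hN i j
    obtain ⟨l, rfl⟩ := ih _ (by lia) hdet hN rfl
    exact ⟨X :: l, rfl⟩

end NonnegativeFactorization

section Rotation

open Matrix

theorem isConj_prod_of_isRotated {G : Type*} [Group G] {l l' : List G} (h : l ~r l') :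
    IsConj l.prod l'.prod := by
  obtain ⟨k, rfl⟩ := h
  induction k generalizing l with
  | zero => rw [List.rotate_zero]
  | succ k ih =>
    cases l with
    | nil => simp
    | cons a l =>
      rw [List.rotate_cons_succ]
      refine .trans (isConj_iff.2 ⟨a⁻¹, ?_⟩) ih
      rw [List.prod_cons, List.prod_append, List.prod_singleton, inv_mul_cancel_left, inv_inv]

theorem trace_prod_mat_of_notMem {X : Letter} {l : List Letter} (hX : X ∉ l) :
    (l.map Letter.mat).prod.trace = 2 := by
  have hunipotent : ∃ k : ℤ, (l.map Letter.mat).prod =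
      match X with
      | .R => !![1, 0; k, 1]
      | .L => !![1, k; 0, 1] := by
    induction l with
    | nil => exact ⟨0, by cases X <;> exact one_fin_two⟩
    | cons Y l ih =>
      rw [List.mem_cons, not_or] at hX
      obtain ⟨k, hk⟩ := ih hX.2
      refine ⟨k + 1, ?_⟩
      rw [List.map_cons, List.prod_cons, hk]
      cases X <;> cases Y <;> first | exact absurd rfl hX.1 | simp [Letter.mat, add_comm]
  obtain ⟨k, hk⟩ := hunipotent
  cases X <;> simp [hk, trace_fin_two]

theorem mem_of_two_lt_trace {l : List Letter} (h : 2 < (l.map Letter.mat).prod.trace)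
    (X : Letter) : X ∈ l :=
  by_contra fun hX => h.ne' (trace_prod_mat_of_notMem hX)

theorem isRotated_R_cons_append_L {c d : List Letter} (hL : Letter.L ∈ d) :
    ∃ m, (.R :: (c ++ d)) ~r (.R :: (m ++ [.L])) := by
  induction d using List.reverseRecOn generalizing c with
  | nil => simp at hL
  | append_singleton d X ih =>
    cases X with
    | L => exact ⟨c ++ d, by rw [List.append_assoc]⟩
    | R =>
      obtain ⟨m, hm⟩ := ih (c := .R :: c) (by simpa using hL)
      refine ⟨m, .trans ?_ hm⟩
      rw [← List.append_assoc, ← List.cons_append]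
      exact List.isRotated_append

theorem exists_isRotated_R_cons_append_L {l : List Letter} (hR : Letter.R ∈ l)
    (hL : Letter.L ∈ l) : ∃ m, l ~r (.R :: (m ++ [.L])) := by
  obtain ⟨a, b, rfl⟩ := List.append_of_mem hR
  obtain ⟨m, hm⟩ := isRotated_R_cons_append_L (c := []) (d := b ++ a) (by simp_all [or_comm])
  exact ⟨m, List.isRotated_append.trans hm⟩

end Rotation

section MonodromyWord

open Matrix
open scoped MatrixGroups

/-- The transvection `X.mat` as an element of `SL(2, ℤ)`. -/
def Letter.sl (X : Letter) : SL(2, ℤ) :=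
  ⟨X.mat, X.det_mat⟩

theorem Letter.coe_prod_sl (l : List Letter) :
    ((l.map sl).prod : Matrix (Fin 2) (Fin 2) ℤ) = (l.map mat).prod := by
  induction l with
  | nil => rfl
  | cons X l ih =>
    rw [List.map_cons, List.prod_cons, Matrix.SpecialLinearGroup.coe_mul, ih]
    rfl

theorem exists_word_prod_eq (m : List Letter) :
    ∃ (n : ℕ) (w : Fin (n + 1) → Letter), w 0 = .R ∧ w (Fin.last n) = .L ∧
      wordMat w = ((Letter.R :: (m ++ [.L])).map Letter.mat).prod := by
  refine ⟨(m ++ [Letter.L]).length, (Letter.R :: (m ++ [.L])).get, rfl, ?_, ?_⟩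
  · simp
  · rw [wordMat_eq_prod, List.ofFn_get]

theorem exists_isMonodromyWord_one {φ : SL(2, ℤ)}
    (htrace : 2 < trace (φ : Matrix (Fin 2) (Fin 2) ℤ)) :
    ∃ (n : ℕ) (w : Fin (n + 1) → Letter), IsMonodromyWord φ w 1 := by
  obtain ⟨ψ, hψ, hnonneg⟩ := exists_isConj_nonneg φ htrace
  obtain ⟨l, hl⟩ := exists_prod_mat_eq ψ.det_coe hnonneg
  rw [← trace_eq_of_isConj hψ, ← hl] at htrace
  obtain ⟨m, hm⟩ :=
    exists_isRotated_R_cons_append_L (mem_of_two_lt_trace htrace .R) (mem_of_two_lt_trace htrace .L)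
  obtain ⟨n, w, hfirst, hlast, hw⟩ := exists_word_prod_eq m
  have hψl : ψ = (l.map Letter.sl).prod := Subtype.ext ((Letter.coe_prod_sl l).trans hl).symm
  obtain ⟨A, hA⟩ :=
    isConj_iff.1 (hψ.trans (hψl ▸ isConj_prod_of_isRotated (hm.map Letter.sl)))
  refine ⟨n, w, hfirst, hlast, A, ?_⟩
  rw [hA, Units.val_one, one_smul, hw]
  exact Letter.coe_prod_sl _

theorem exists_isMonodromyWord {φ : SL(2, ℤ)} (hφ : IsAnosov φ) :
    ∃ (n : ℕ) (w : Fin (n + 1) → Letter) (s : ℤˣ), IsMonodromyWord φ w s := by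
  rcases lt_abs.1 hφ.two_lt_abs_trace with htrace | htrace
  · obtain ⟨n, w, hw⟩ := exists_isMonodromyWord_one htrace
    exact ⟨n, w, 1, hw⟩
  · have htrace_neg : 2 < trace ((-φ : SL(2, ℤ)) : Matrix (Fin 2) (Fin 2) ℤ) := by
      rwa [Matrix.SpecialLinearGroup.coe_neg, trace_neg]
    obtain ⟨n, w, hfirst, hlast, A, hA⟩ := exists_isMonodromyWord_one htrace_neg
    refine ⟨n, w, -1, hfirst, hlast, A, ?_⟩
    have hneg : A * -φ * A⁻¹ = -(A * φ * A⁻¹) := by rw [mul_neg, neg_mul]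
    rw [hneg, Units.val_one, one_smul] at hA
    rw [← hA, Units.val_neg, Units.val_one, neg_one_smul]
    exact (neg_neg _).symm

end MonodromyWord

end PuncturedTorus

end

open PuncturedTorus in
theorem theorem1 (φ : Matrix.SpecialLinearGroup (Fin 2) ℤ) (hφ : IsAnosov φ) :
    (∃ (n : ℕ) (w : Fin (n + 1) → Letter) (s : ℤˣ), IsMonodromyWord φ w s) ∧
    ∀ (n : ℕ) (w : Fin (n + 1) → Letter) (s : ℤˣ), IsMonodromyWord φ w s →
      ∃ zp zm : Fin (n + 1) → ℝ,
        (∃ μ : ℝ, 1 < μ ∧ IsProjectionShape w μ zp) ∧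
        (∃ μ : ℝ, 0 < μ ∧ μ < 1 ∧ IsProjectionShape w μ zm) ∧
        zp ∈ (monodromyTriangulation w s).realDeformationVariety ∧
        zm ∈ (monodromyTriangulation w s).realDeformationVariety ∧
        Disjoint (connectedComponentIn (monodromyTriangulation w s).realDeformationVariety zp)
          (connectedComponentIn (monodromyTriangulation w s).realDeformationVariety zm) ∧
        connectedComponentIn (monodromyTriangulation w s).realDeformationVariety zp ∪
            connectedComponentIn (monodromyTriangulation w s).realDeformationVariety zm =
          {z | z ∈ (monodromyTriangulation w s).realDeformationVariety ∧ ∀ k, 0 < z k} ∧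
        ∀ V : Set (Fin (n + 1) → ℝ),
          V = connectedComponentIn (monodromyTriangulation w s).realDeformationVariety zp ∨
            V = connectedComponentIn (monodromyTriangulation w s).realDeformationVariety zm →
          (∀ z ∈ V, 0 < punctureLength w s z) ∧
          (∀ z ∈ V, ∃ v ∈ (monodromyTriangulation w s).tangentSpace z, ∀ k, 0 < v k) ∧
          ∃ γ : ℝ → Fin (n + 1) → ℝ,
            ContDiff ℝ ∞ γ ∧ Topology.IsEmbedding γ ∧ Set.range γ = V ∧
            (∀ t, deriv γ t ≠ 0) ∧
            (∀ t, (monodromyTriangulation w s).tangentSpace (γ t) =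
              Submodule.span ℝ {deriv γ t}) ∧
            ∀ t, Real.log (punctureLength w s (γ t)) = t := by
  refine ⟨exists_isMonodromyWord hφ, fun n w s ⟨hfirst, hlast, _⟩ => ?_⟩
  have hw : w.Surjective := surjective_of_first_of_last hfirst hlast
  obtain ⟨μ, r, r', hμ, ⟨hr_sign, hr⟩, hr'_sign, hr'⟩ := exists_eigenforms hfirst hlast
  have hμ_pos : 0 < μ := one_pos.trans hμ
  obtain ⟨zp, hzp, hzp_shape⟩ :=
    exists_projectionShape_mem_patternSet_pred s hw hμ_pos hr_sign hr
  obtain ⟨zm, hzm, hzm_shape⟩ :=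
    exists_projectionShape_mem_patternSet_self s hw (inv_pos.2 hμ_pos) hr'_sign hr'
  have hcurve_p := isPunctureCurve_patternSet_pred s hfirst hlast ⟨zp, hzp⟩
  have hcurve_m := isPunctureCurve_patternSet_self s hfirst hlast ⟨zm, hzm⟩
  refine ⟨zp, zm, ⟨μ, hμ, hzp_shape⟩,
    ⟨μ⁻¹, inv_pos.2 hμ_pos, inv_lt_one_of_one_lt₀ hμ, hzm_shape⟩, hzp.1, hzm.1, ?_⟩
  rw [connectedComponentIn_eq_patternSet s hcurve_p.isPreconnected hzp,
    connectedComponentIn_eq_patternSet s hcurve_m.isPreconnected hzm]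
  refine ⟨disjoint_patternSet s (comp_sub_one_ne_self hfirst hlast),
    patternSet_pred_union_patternSet_self s hw, ?_⟩
  rintro V (rfl | rfl)
  · exact ⟨hcurve_p.1, hcurve_p.2, hcurve_p.3⟩
  · exact ⟨hcurve_m.1, hcurve_m.2, hcurve_m.3⟩
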